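/- **Average two-resolvent global law.** Fix $L>0$, $\delta>0$ and constants $(C_p)_{p\ge 1}$. For an $N\times N$ matrix $A$ write $\langle A\rangle := N^{-1}\operatorname{Tr}A$, $\Im A:=(A-A^*)/(2\mathrm i)$, and let $\|A\|$ be the operator norm induced by the Euclidean norm. *Setting.* For each $N$ let $W=W^*\in\mathbf C^{N\times N}$ be a Wigner matrix: its entries $w_{ij}$, $i\le j$, are independent, $w_{ij}\overset{d}{=}N^{-1/2}\chi_{\mathrm{od}}$ for $i<j$ and $w_{jj}\overset{d}{=}N^{-1/2}\chi_{\mathrm d}$, where $\chi_{\mathrm d}$ is a centered real random variable, $\chi_{\mathrm{od}}$ is a real or complex random variable with $\mathbf E\chi_{\mathrm{od}}=0$ and $\mathbf E|\chi_{\mathrm{od}}|^2=1$, and $\mathbf E|\chi_{\mathrm d}|^p+\mathbf E|\chi_{\mathrm{od}}|^p\le C_p$ for all integers $p\ge 1$ (the laws of $\chi_{\mathrm d},\chi_{\mathrm{od}}$ may depend on $N$, the $C_p$ do not). Let $\mathcal U_N$ be the set of all $u=(D_1,D_2,z_1,z_2)$ where $D_1,D_2\in\mathbf C^{N\times N}$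 are Hermitian with $\|D_j\|\le L$ and $z_1,z_2\in\mathbf C$ satisfy $\operatorname{dist}(z_j,[-(L+2),L+2])\ge\delta$. Put $G_j:=(D_j+W-z_j)^{-1}$. For $z_j\in\mathbf C\setminus\mathbf R$ let $M_j=M_j(z_j)$ be the solution of the Matrix Dyson equation $$-M_j^{-1}=z_j-D_j+\langle M_j\rangle,\qquad \Im z_j\,\Im M_j>0 ,$$ and for real $z_j$ let $M_j(z_j):=\lim_{\eta\downarrow0}M_j(z_j+\mathrm i\eta)$. *Claim.* For every $N$ and $u\in\mathcal U_N$ the matrices $M_1,M_2$ exist and are unique, and $1-\langle M_1M_2\rangle\ne0$, so that $$M(z_1,z_2):=\frac{M_1M_2}{1-\langle M_1M_2\rangle}$$ is well defined. Moreover, there is a constant $C(\delta)>0$, depending only on $\delta$, $L$ and $(C_p)_p$, such that $$\big|\langle G_1G_2\rangle-\langle M(z_1,z_2)\rangle\big|\prec\frac{C(\delta)}{N},$$ that is, for all $\xi,K>0$ there is $N_0$ such that for all $N\ge N_0$ $$\sup_{u\in\mathcal U_N}\mathbf P\Big[\big|\langle G_1G_2\rangle-\langle M(z_1,z_2)\rangle\big|>N^{\xi}\,\frac{C(\delta)}{N}\Big]\le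 N^{-K}.$$ Here both resolvents exist with very high probability: for every $K>0$ there is $N_0$ such that for all $N\ge N_0$ and all $u\in\mathcal U_N$, with probability at least $1-N^{-K}$ both $D_j+W-z_j$ are invertible. -/

import Mathlib

open MeasureTheory ProbabilityTheory Filter Topology

noncomputable section

namespace TwoResolvent

open scoped ComplexOrder

/-- The normalized trace `⟨A⟩ = N⁻¹ Tr A`. -/
def ntr {N : ℕ} (A : Matrix (Fin N) (Fin N) ℂ) : ℂ := (N : ℂ)⁻¹ * A.trace

/-- The operator norm of a matrix induced by the Euclidean norm on `ℂ^N`. -/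
def opNorm {N : ℕ} (A : Matrix (Fin N) (Fin N) ℂ) : ℝ :=
  ‖Matrix.toEuclideanCLM (n := Fin N) (𝕜 := ℂ) A‖

/-- The imaginary part `Im M = (M - M*) / (2i)` of a matrix. -/
def imPart {N : ℕ} (M : Matrix (Fin N) (Fin N) ℂ) : Matrix (Fin N) (Fin N) ℂ :=
  (2 * Complex.I)⁻¹ • (M - M.conjTranspose)

/-- `M` solves the Matrix Dyson equation `-M⁻¹ = z - D + ⟨M⟩` at the spectral parameter
`z ∈ ℂ ∖ ℝ`, under the constraint `Im z · Im M > 0`. -/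
structure IsMDESolution {N : ℕ} (D : Matrix (Fin N) (Fin N) ℂ) (z : ℂ)
    (M : Matrix (Fin N) (Fin N) ℂ) : Prop where
  isUnit : IsUnit M
  eqn : -M⁻¹ = z • (1 : Matrix (Fin N) (Fin N) ℂ) - D + ntr M • (1 : Matrix (Fin N) (Fin N) ℂ)
  im_pos : ((z.im : ℂ) • imPart M).PosDef

/-- `M` is the value at `z ∈ ℂ` of the solution of the Matrix Dyson equation: for nonreal `z` it
solves the equation at `z`, and for real `z` it is the boundary value
`lim_{η ↓ 0} M(z + iη)` of solutions. -/
def IsMDEValue {N : ℕ} (D : Matrix (Fin N) (Fin N) ℂ) (z : ℂ)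
    (M : Matrix (Fin N) (Fin N) ℂ) : Prop :=
  (z.im ≠ 0 → IsMDESolution D z M) ∧
  (z.im = 0 → ∃ F : ℝ → Matrix (Fin N) (Fin N) ℂ,
    (∀ η : ℝ, 0 < η → IsMDESolution D (z + η * Complex.I) (F η)) ∧
    Tendsto F (𝓝[>] 0) (𝓝 M))

/-- The matrix `M(z)`: the solution of the Matrix Dyson equation with deformation `D`. It is
picked by choice; that there is exactly one candidate is part of the theorem. -/
def mdeM {N : ℕ} (D : Matrix (Fin N) (Fin N) ℂ) (z : ℂ) : Matrix (Fin N) (Fin N) ℂ :=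
  Classical.epsilon (IsMDEValue D z)

/-- The resolvent `(H - z)⁻¹`. -/
def resolvent {N : ℕ} (H : Matrix (Fin N) (Fin N) ℂ) (z : ℂ) : Matrix (Fin N) (Fin N) ℂ :=
  (H - z • (1 : Matrix (Fin N) (Fin N) ℂ))⁻¹

/-- The deterministic approximation `M₁ M₂ / (1 - ⟨M₁ M₂⟩)`. -/
def twoResolventM {N : ℕ} (M₁ M₂ : Matrix (Fin N) (Fin N) ℂ) : Matrix (Fin N) (Fin N) ℂ :=
  (1 - ntr (M₁ * M₂))⁻¹ • (M₁ * M₂)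

/-- The moment assumption on the single entry laws: `νd` is the law of the centered real variable
`χ_d`, and `νod` is the law of the real or complex variable `χ_od`, which is centered with
`E |χ_od|² = 1`; all moments are bounded by the constants `Cp p`. -/
structure EntryLaws (Cp : ℕ → ℝ) (νd : Measure ℝ) (νod : Measure ℂ) : Prop where
  prob_d : IsProbabilityMeasure νd
  prob_od : IsProbabilityMeasure νod
  integrable_d : ∀ p : ℕ, 1 ≤ p → Integrable (fun x : ℝ => |x| ^ p) νd
  integrable_od : ∀ p : ℕ, 1 ≤ p → Integrable (fun x : ℂ => ‖x‖ ^ p) νod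
  mean_d : ∫ x, x ∂νd = 0
  mean_od : ∫ x, x ∂νod = 0
  variance_od : ∫ x, ‖x‖ ^ 2 ∂νod = 1
  moment_le : ∀ p : ℕ, 1 ≤ p → ∫ x, |x| ^ p ∂νd + ∫ x, ‖x‖ ^ p ∂νod ≤ Cp p

/-- `W` is an `N × N` Wigner matrix on the probability space `(Ω, P)` whose single entry laws obey
the moment bounds `Cp`: it is Hermitian, its entries `w_ij`, `i ≤ j`, are independent,
`w_ij` is distributed as `N^{-1/2} χ_od` for `i < j`, and `w_ii` as `N^{-1/2} χ_d`. -/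
structure IsWigner (Cp : ℕ → ℝ) {Ω : Type*} [MeasurableSpace Ω] (P : Measure Ω) {N : ℕ}
    (W : Ω → Matrix (Fin N) (Fin N) ℂ) : Prop where
  isHermitian : ∀ ω, (W ω).IsHermitian
  indep : iIndepFun (fun (p : {p : Fin N × Fin N // p.1 ≤ p.2}) ω => W ω p.1.1 p.1.2) P
  entries : ∃ (νd : Measure ℝ) (νod : Measure ℂ), EntryLaws Cp νd νod ∧
    (∀ i j : Fin N, i < j →
      HasLaw (fun ω => W ω i j) (νod.map fun x : ℂ => x / (√(N : ℝ) : ℂ)) P) ∧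
    (∀ i : Fin N,
      HasLaw (fun ω => W ω i i) (νd.map fun x : ℝ => (x : ℂ) / (√(N : ℝ) : ℂ)) P)

/-- Stochastic domination `X ≺ Y` of families indexed by `N` and by a parameter `u ∈ U N`:
for all `ξ, C > 0`, `sup_u P[X > N^ξ Y] ≤ N^{-C}` for all `N ≥ N₀(ξ, C)`. -/
def StochDom {Ω : ℕ → Type*} [∀ N, MeasurableSpace (Ω N)] (P : ∀ N, Measure (Ω N))
    {U : ℕ → Type*} (X Y : ∀ N, U N → Ω N → ℝ) : Prop :=
  ∀ ξ : ℝ, 0 < ξ → ∀ C : ℝ, 0 < C → ∃ N₀ : ℕ, ∀ N : ℕ, N₀ ≤ N →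
    ⨆ u : U N, P N {ω | (N : ℝ) ^ ξ * Y N u ω < X N u ω} ≤ ENNReal.ofReal ((N : ℝ) ^ (-C))

/-- The events `E N u` hold with very high probability, uniformly in the parameter `u ∈ U N`:
for every `C > 0`, `sup_u P[not E] ≤ N^{-C}` for all `N ≥ N₀(C)`. -/
def WVHP {Ω : ℕ → Type*} [∀ N, MeasurableSpace (Ω N)] (P : ∀ N, Measure (Ω N))
    {U : ℕ → Type*} (E : ∀ N, U N → Set (Ω N)) : Prop :=
  ∀ C : ℝ, 0 < C → ∃ N₀ : ℕ, ∀ N : ℕ, N₀ ≤ N →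
    ⨆ u : U N, P N (E N u)ᶜ ≤ ENNReal.ofReal ((N : ℝ) ^ (-C))

/-- The distance of `z` from the real interval `[-(L+2), L+2]`. -/
def spectralDist (L : ℝ) (z : ℂ) : ℝ :=
  Metric.infDist z ((fun x : ℝ => (x : ℂ)) '' Set.Icc (-(L + 2)) (L + 2))

/-- The parameters at dimension `N`: Hermitian deformations `D₁, D₂` with norm at most `L` and
spectral parameters `z₁, z₂` at distance at least `δ` from `[-(L+2), L+2]`. -/
structure Params (L δ : ℝ) (N : ℕ) where
  D₁ : Matrix (Fin N) (Fin N) ℂ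
  D₂ : Matrix (Fin N) (Fin N) ℂ
  z₁ : ℂ
  z₂ : ℂ
  herm₁ : D₁.IsHermitian
  herm₂ : D₂.IsHermitian
  norm₁ : opNorm D₁ ≤ L
  norm₂ : opNorm D₂ ≤ L
  dist₁ : δ ≤ spectralDist L z₁
  dist₂ : δ ≤ spectralDist L z₂

end TwoResolvent

end

/-!
The idea is to prove the law by perturbation theory at spectral parameters with `|Im z| ≥ N^{-ε}`,
where all resolvents are bounded deterministically by a small power of `N`, and then to reach the
rest of the domain, the real axis included, by analyticity. Write `κ > 0` for a small multiple of
`δ`, and `q` for a small power of `N`. Every loss below is a power of `q`, so it is absorbed by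
`N^ξ`, and the constant in the law can be taken to be `1`.

*The deterministic part.* With `w = z + ⟨M⟩` the Dyson equation says that `M` is the resolvent of
`D` at `w`, so it is a scalar equation for `w`. Taking imaginary parts gives `⟨M M*⟩ < 1`, and by
Cauchy–Schwarz `⟨M M'⟩ ≠ 1` for two solutions, which is uniqueness (`resolvent_eqn_sub`).
Existence (`exists_dysonPoint_of_pos`) comes from minimizing, over a compact invariant set, the
hyperbolic displacement of the self-map `w ↦ z + ⟨(D - w)⁻¹⟩` of the half-plane. Away from the
spectrum `⟨M M*⟩ ≤ (1 + κ)⁻¹`, so `1 - ⟨M₁ M₂⟩` is bounded below (`DysonBounds.norm_one_sub`), the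
solution is Lipschitz in `z`, and the boundary values on the real axis exist
(`exists_isMDEValue`).

*Truncation and norm.* With very high probability all entries of `W` are at most `q N^{-1/2}`;
larger ones may be replaced by zero, which almost preserves the means and variances
(`IsWigner.exists_truncation`). For the truncated matrix, the trace of a high power is a weighted
sum over walks. Summing one step at a time, with a potential that accounts for the edges traversed
exactly once (`walkSum_le`), gives growth rate `2 + o(1)`, whence `‖W‖ ≤ 2 + κ/4` outside a set of
very small measure (`measure_norm_tmat_ge_le`), hence invertibility and bounded resolvents
(`resolvent_far`).

*The law off the axis.* Resampling one entry and expanding the resolvents exactly to second order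
gives a cumulant expansion with explicit remainder (`IsResPair.expand`,
`IsResPair.norm_integral_ntr_add_le`). An Efron–Stein inequality applied to powers of a random
variable bounds its high moments (`dyadic_moment_le`), so normalized traces of resolvents
concentrate at scale `1/N` up to powers of `q` (`concentration`). Together these say that
`T = E⟨G₁ G₂⟩` solves `T = ⟨M₁ M₂⟩ (1 + T)` up to errors of order `1/N` times a power of `q`, and
stability gives `T ≈ ⟨M₁ M₂⟩ / (1 - ⟨M₁ M₂⟩)` (`norm_expect_ntr_mul_sub_le`).

*Reaching the axis.* On `‖W‖ ≤ 2 + κ/4` the difference between `⟨G₁ G₂⟩` and its deterministic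
approximation is holomorphic and bounded on a disc of radius of order `κ` in a common shift of
`z₁` and `z₂`. It is small at a net of points of a smaller circle, except at the few points where
a shifted parameter is close to the real axis. After multiplication by a high power of a
holomorphic weight that is one at the centre and small near the exceptional points, the maximum
principle bounds the difference at the centre (`norm_apply_zero_le`, `measure_lawDiff_zero_le`).
-/

noncomputable section
namespace TwoResolvent
open scoped ComplexOrder Matrix Matrix.Norms.L2Operator

variable {N : ℕ}

/-! ### Norms, normalized traces and resolvents -/

/-- The normalized squared Hilbert–Schmidt norm `⟨A A*⟩`. -/
def nhs (A : Matrix (Fin N) (Fin N) ℂ) : ℝ := (N : ℝ)⁻¹ * ∑ i, ∑ j, ‖A i j‖ ^ 2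

lemma nhs_nonneg (A : Matrix (Fin N) (Fin N) ℂ) : 0 ≤ nhs A := by
  unfold nhs; positivity

lemma sum_col_sq_le (A : Matrix (Fin N) (Fin N) ℂ) (j : Fin N) :
    ∑ i, ‖A i j‖ ^ 2 ≤ ‖A‖ ^ 2 := by
  have h := Matrix.l2_opNorm_mulVec A (EuclideanSpace.single j (1 : ℂ))
  rw [PiLp.norm_single, norm_one, mul_one] at h
  have h2 := pow_le_pow_left₀ (norm_nonneg _) h 2
  rw [EuclideanSpace.norm_sq_eq] at h2
  refine le_trans (le_of_eq ?_) h2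
  refine Finset.sum_congr rfl fun i _ => ?_
  simp [EuclideanSpace.single]

lemma norm_entry_le (A : Matrix (Fin N) (Fin N) ℂ) (i j : Fin N) : ‖A i j‖ ≤ ‖A‖ := by
  have h := sum_col_sq_le A j
  have h1 : ‖A i j‖ ^ 2 ≤ ∑ i, ‖A i j‖ ^ 2 :=
    Finset.single_le_sum (f := fun i => ‖A i j‖ ^ 2) (fun _ _ => by positivity) (Finset.mem_univ i)
  exact le_of_sq_le_sq (h1.trans h) (norm_nonneg _)
where
  le_of_sq_le_sq {a b : ℝ} (h : a ^ 2 ≤ b ^ 2) (hb : 0 ≤ b) : a ≤ b := abs_le_of_sq_le_sq' h hb |>.2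

lemma sum_sq_le (A : Matrix (Fin N) (Fin N) ℂ) : ∑ i, ∑ j, ‖A i j‖ ^ 2 ≤ N * ‖A‖ ^ 2 := by
  rw [Finset.sum_comm]
  refine (Finset.sum_le_sum fun j _ => sum_col_sq_le A j).trans ?_
  simp

lemma nhs_le (A : Matrix (Fin N) (Fin N) ℂ) : nhs A ≤ ‖A‖ ^ 2 := by
  unfold nhs
  rcases Nat.eq_zero_or_pos N with rfl | h
  · simp
  · have h' : (0 : ℝ) < N := by exact_mod_cast h
    rw [inv_mul_le_iff₀ h']
    exact sum_sq_le A

lemma sum_norm_entry_le (A : Matrix (Fin N) (Fin N) ℂ) :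
    ∑ i, ∑ j, ‖A i j‖ ≤ N * √N * ‖A‖ := by
  have h1 : (∑ p : Fin N × Fin N, ‖A p.1 p.2‖) ^ 2 ≤ (N * √N * ‖A‖) ^ 2 := by
    refine (sq_sum_le_card_mul_sum_sq (s := Finset.univ)
      (f := fun p : Fin N × Fin N => ‖A p.1 p.2‖)).trans ?_
    rw [Fintype.sum_prod_type, mul_pow, mul_pow, Real.sq_sqrt (Nat.cast_nonneg _)]
    simp only [Finset.card_univ, Fintype.card_prod, Fintype.card_fin]
    push_cast
    have := sum_sq_le A
    calc (N : ℝ) * N * ∑ i, ∑ j, ‖A i j‖ ^ 2 ≤ N * N * (N * ‖A‖ ^ 2) := by gcongr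
      _ = _ := by ring
  rw [← Fintype.sum_prod_type' (f := fun i j => ‖A i j‖)]
  exact (abs_le_of_sq_le_sq' h1 (by positivity)).2

lemma norm_ntr_le (A : Matrix (Fin N) (Fin N) ℂ) : ‖ntr A‖ ≤ ‖A‖ := by
  unfold ntr
  rcases Nat.eq_zero_or_pos N with rfl | h
  · simp
  · have h' : (0 : ℝ) < N := by exact_mod_cast h
    rw [norm_mul, norm_inv, Complex.norm_natCast, inv_mul_le_iff₀ h', Matrix.trace]
    refine (norm_sum_le _ _).trans ((Finset.sum_le_sum fun i _ => norm_entry_le A i i).trans ?_)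
    simp

lemma ntr_add (A B : Matrix (Fin N) (Fin N) ℂ) : ntr (A + B) = ntr A + ntr B := by
  simp [ntr, mul_add]

lemma ntr_sub (A B : Matrix (Fin N) (Fin N) ℂ) : ntr (A - B) = ntr A - ntr B := by
  simp [ntr, mul_sub]

lemma ntr_smul (c : ℂ) (A : Matrix (Fin N) (Fin N) ℂ) : ntr (c • A) = c * ntr A := by
  simp [ntr]; ring

lemma ntr_mul_comm (A B : Matrix (Fin N) (Fin N) ℂ) : ntr (A * B) = ntr (B * A) := by
  simp [ntr, Matrix.trace_mul_comm A B]

lemma ntr_conjTranspose (A : Matrix (Fin N) (Fin N) ℂ) : ntr Aᴴ = (starRingEnd ℂ) (ntr A) := by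
  simp [ntr, Matrix.trace_conjTranspose]

/-- Cauchy–Schwarz for the normalized trace. -/
lemma ntr_mul_sq_le (A B : Matrix (Fin N) (Fin N) ℂ) : ‖ntr (A * B)‖ ^ 2 ≤ nhs A * nhs B := by
  have h1 : ‖(A * B).trace‖ ≤ ∑ p : Fin N × Fin N, ‖A p.1 p.2‖ * ‖B p.2 p.1‖ := by
    rw [Matrix.trace, Fintype.sum_prod_type]
    refine (norm_sum_le _ _).trans (Finset.sum_le_sum fun i _ => ?_)
    rw [Matrix.diag_apply, Matrix.mul_apply]
    exact (norm_sum_le _ _).trans (Finset.sum_le_sum fun j _ => (norm_mul _ _).le)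
  have h2 : ‖(A * B).trace‖ ^ 2 ≤ (∑ i, ∑ j, ‖A i j‖ ^ 2) * ∑ i, ∑ j, ‖B i j‖ ^ 2 := by
    refine (pow_le_pow_left₀ (norm_nonneg _) h1 2).trans ?_
    refine (Finset.sum_mul_sq_le_sq_mul_sq _ _ _).trans (le_of_eq ?_)
    congr 1
    · rw [Fintype.sum_prod_type]
    · rw [Fintype.sum_prod_type, Finset.sum_comm]
  unfold ntr nhs
  rw [norm_mul, norm_inv, Complex.norm_natCast, mul_pow]
  calc ((N : ℝ)⁻¹) ^ 2 * ‖(A * B).trace‖ ^ 2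
      ≤ ((N : ℝ)⁻¹) ^ 2 * ((∑ i, ∑ j, ‖A i j‖ ^ 2) * ∑ i, ∑ j, ‖B i j‖ ^ 2) := by gcongr
    _ = _ := by ring

lemma ntr_mul_conjTranspose (A : Matrix (Fin N) (Fin N) ℂ) : ntr (A * Aᴴ) = (nhs A : ℂ) := by
  unfold ntr nhs Matrix.trace
  push_cast
  congr 1
  refine Finset.sum_congr rfl fun i _ => ?_
  rw [Matrix.diag_apply, Matrix.mul_apply]
  refine Finset.sum_congr rfl fun j _ => ?_
  rw [Matrix.conjTranspose_apply, Complex.star_def, Complex.mul_conj, Complex.normSq_eq_norm_sq]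
  push_cast; rfl

/-- Cauchy–Schwarz against the identity matrix. -/
lemma ntr_sq_le (A : Matrix (Fin N) (Fin N) ℂ) : ‖ntr A‖ ^ 2 ≤ nhs A := by
  have h := ntr_mul_sq_le A 1
  rw [mul_one] at h
  refine h.trans (mul_le_of_le_one_right (nhs_nonneg A) ((nhs_le 1).trans ?_))
  rcases isEmpty_or_nonempty (Fin N) with h | h
  · have : (1 : Matrix (Fin N) (Fin N) ℂ) = 0 := Subsingleton.elim _ _
    simp [this]
  · simp

/-- A matrix whose numerical range stays at distance `c > 0` from the origin is invertible, and
its inverse is bounded by `c⁻¹`. -/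
lemma isUnit_of_coercive {A : Matrix (Fin N) (Fin N) ℂ} {c : ℝ} (hc : 0 < c)
    (h : ∀ v : EuclideanSpace ℂ (Fin N),
      c * ‖v‖ ^ 2 ≤ ‖inner ℂ v (Matrix.toEuclideanCLM (n := Fin N) (𝕜 := ℂ) A v)‖) :
    IsUnit A ∧ ‖A⁻¹‖ ≤ c⁻¹ := by
  have h1 : ∀ v : EuclideanSpace ℂ (Fin N),
      c * ‖v‖ ≤ ‖Matrix.toEuclideanCLM (n := Fin N) (𝕜 := ℂ) A v‖ := by
    intro v
    rcases eq_or_lt_of_le (norm_nonneg v) with hv | hv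
    · rw [← hv]; simp
    · have := (h v).trans (norm_inner_le_norm _ _)
      nlinarith
  have hu : IsUnit A := by
    rw [← Matrix.mulVec_injective_iff_isUnit]
    intro x y hxy
    have h2 := h1 (WithLp.toLp 2 (x - y))
    rw [Matrix.toEuclideanCLM_toLp, Matrix.mulVec_sub, hxy, sub_self] at h2
    simp only [WithLp.toLp_zero, norm_zero] at h2
    have h3 : ‖(WithLp.toLp 2 (x - y) : EuclideanSpace ℂ (Fin N))‖ ≤ 0 := by
      by_contra hcon
      push Not at hcon
      nlinarith
    have h4 := norm_le_zero_iff.mp h3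
    have h5 : x - y = 0 := by simpa using congrArg WithLp.ofLp h4
    exact sub_eq_zero.mp h5
  refine ⟨hu, ?_⟩
  rw [Matrix.cstar_norm_def]
  refine ContinuousLinearMap.opNorm_le_bound _ (inv_nonneg.mpr hc.le) fun v => ?_
  have h2 := h1 (Matrix.toEuclideanCLM (n := Fin N) (𝕜 := ℂ) A⁻¹ v)
  have h3 : Matrix.toEuclideanCLM (n := Fin N) (𝕜 := ℂ) A
      (Matrix.toEuclideanCLM (n := Fin N) (𝕜 := ℂ) A⁻¹ v) = v := by
    rw [← mul_apply_eq_comp, ← map_mul,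
      Matrix.mul_nonsing_inv _ ((Matrix.isUnit_iff_isUnit_det _).mp hu), map_one]
    rfl
  rw [h3] at h2
  rwa [inv_mul_eq_div, le_div_iff₀' hc]

lemma inner_hermitian_im {H : Matrix (Fin N) (Fin N) ℂ} (hH : H.IsHermitian)
    (v : EuclideanSpace ℂ (Fin N)) :
    (inner ℂ v (Matrix.toEuclideanCLM (n := Fin N) (𝕜 := ℂ) H v)).im = 0 := by
  have h : IsSelfAdjoint (Matrix.toEuclideanCLM (n := Fin N) (𝕜 := ℂ) H) := by
    have h0 : IsSelfAdjoint H := hH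
    exact h0.map (Matrix.toEuclideanCLM (n := Fin N) (𝕜 := ℂ))
  have h2 := h.isSymmetric
  exact (LinearMap.IsSymmetric.im_inner_self_apply (𝕜 := ℂ) h2 v)

lemma inner_sub_smul (H : Matrix (Fin N) (Fin N) ℂ) (z : ℂ) (v : EuclideanSpace ℂ (Fin N)) :
    inner ℂ v (Matrix.toEuclideanCLM (n := Fin N) (𝕜 := ℂ) (H - z • 1) v) =
      inner ℂ v (Matrix.toEuclideanCLM (n := Fin N) (𝕜 := ℂ) H v) - z * (‖v‖ : ℂ) ^ 2 := by
  rw [map_sub, map_smul, map_one, sub_apply, inner_sub_right,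
    smul_apply, inner_smul_right]
  congr 2
  exact inner_self_eq_norm_sq_to_K v

lemma resolvent_bound_im {H : Matrix (Fin N) (Fin N) ℂ} (hH : H.IsHermitian) {z : ℂ}
    (hz : z.im ≠ 0) : IsUnit (H - z • 1) ∧ ‖resolvent H z‖ ≤ |z.im|⁻¹ := by
  refine isUnit_of_coercive (abs_pos.mpr hz) fun v => ?_
  rw [inner_sub_smul]
  refine le_trans (le_of_eq ?_) (Complex.abs_im_le_norm _)
  rw [Complex.sub_im, inner_hermitian_im hH, ← Complex.ofReal_pow, Complex.im_mul_ofReal, zero_sub,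
    abs_neg, abs_mul, abs_of_nonneg (sq_nonneg ‖v‖)]

/-- The bound away from the real part of the numerical range; `H` need not be Hermitian. -/
lemma resolvent_bound_re {H : Matrix (Fin N) (Fin N) ℂ} {z : ℂ} {c : ℝ} (hc : 0 < c)
    (hz : ‖H‖ + c ≤ |z.re|) : IsUnit (H - z • 1) ∧ ‖resolvent H z‖ ≤ c⁻¹ := by
  refine isUnit_of_coercive hc fun v => ?_
  rw [inner_sub_smul]
  have h1 : ‖inner ℂ v (Matrix.toEuclideanCLM (n := Fin N) (𝕜 := ℂ) H v)‖ ≤ ‖H‖ * ‖v‖ ^ 2 := by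
    refine (norm_inner_le_norm _ _).trans ?_
    have := (Matrix.toEuclideanCLM (n := Fin N) (𝕜 := ℂ) H).le_opNorm v
    calc ‖v‖ * _ ≤ ‖v‖ * (‖H‖ * ‖v‖) := by gcongr; exact this
      _ = _ := by ring
  have h2 : ‖z * (‖v‖ : ℂ) ^ 2‖ = ‖z‖ * ‖v‖ ^ 2 := by simp
  have h3 := norm_sub_norm_le (z * (‖v‖ : ℂ) ^ 2)
    (inner ℂ v (Matrix.toEuclideanCLM (n := Fin N) (𝕜 := ℂ) H v))
  rw [norm_sub_rev] at h3
  rw [h2] at h3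
  have h4 := Complex.abs_re_le_norm z
  have h5 : (‖H‖ + c) * ‖v‖ ^ 2 ≤ ‖z‖ * ‖v‖ ^ 2 := by gcongr; exact hz.trans h4
  linarith

lemma resolvent_mul_cancel {H : Matrix (Fin N) (Fin N) ℂ} {z : ℂ} (h : IsUnit (H - z • 1)) :
    resolvent H z * (H - z • 1) = 1 :=
  Matrix.nonsing_inv_mul _ ((Matrix.isUnit_iff_isUnit_det _).mp h)

lemma mul_resolvent_cancel {H : Matrix (Fin N) (Fin N) ℂ} {z : ℂ} (h : IsUnit (H - z • 1)) :
    (H - z • 1) * resolvent H z = 1 :=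
  Matrix.mul_nonsing_inv _ ((Matrix.isUnit_iff_isUnit_det _).mp h)

/-- The resolvent identity, for two matrices and two spectral parameters. -/
lemma resolvent_sub {H H' : Matrix (Fin N) (Fin N) ℂ} {z z' : ℂ} (h : IsUnit (H - z • 1))
    (h' : IsUnit (H' - z' • 1)) :
    resolvent H z - resolvent H' z' =
      resolvent H z * ((H' - H) + (z - z') • 1) * resolvent H' z' := by
  have e : (H' - H) + (z - z') • (1 : Matrix (Fin N) (Fin N) ℂ) =
      (H' - z' • 1) - (H - z • 1) := by rw [sub_smul]; abel
  rw [e, mul_sub, sub_mul, mul_assoc, mul_resolvent_cancel h', resolvent_mul_cancel h, mul_one,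
    one_mul]

lemma resolvent_conjTranspose {H : Matrix (Fin N) (Fin N) ℂ} (hH : H.IsHermitian) (z : ℂ) :
    (resolvent H z)ᴴ = resolvent H ((starRingEnd ℂ) z) := by
  unfold resolvent
  rw [Matrix.conjTranspose_nonsing_inv, Matrix.conjTranspose_sub, hH.eq, Matrix.conjTranspose_smul,
    Matrix.conjTranspose_one]
  rfl

end TwoResolvent
end

noncomputable section
namespace TwoResolvent
open scoped ComplexOrder Matrix Matrix.Norms.L2Operator

variable {N : ℕ}

/-! ### The Matrix Dyson equation -/

/-- The Ward identity `Im ⟨R⟩ = Im w ⟨R R*⟩` for `R = (D - w)⁻¹`. -/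
lemma resolvent_im {D : Matrix (Fin N) (Fin N) ℂ} (hD : D.IsHermitian) {w : ℂ} (hw : w.im ≠ 0) :
    (ntr (resolvent D w)).im = w.im * nhs (resolvent D w) := by
  have hw' : ((starRingEnd ℂ) w).im ≠ 0 := by simpa using hw
  have h := resolvent_sub (resolvent_bound_im hD hw).1 (resolvent_bound_im hD hw').1
  rw [sub_self, zero_add, Algebra.mul_smul_comm, mul_one, Algebra.smul_mul_assoc,
    ← resolvent_conjTranspose hD] at h
  have h2 := congrArg ntr h
  rw [ntr_sub, ntr_smul, ntr_mul_conjTranspose, ntr_conjTranspose] at h2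
  have h3 := congrArg Complex.im h2
  simp at h3
  linarith

/-- `w = z + m`, where `m = ⟨(D - w)⁻¹⟩` and `w` lies on the same side of the real axis as `z`:
the scalar form of the Matrix Dyson equation at a nonreal spectral parameter. -/
structure IsDysonPoint (D : Matrix (Fin N) (Fin N) ℂ) (z w : ℂ) : Prop where
  eqn : w = z + ntr (resolvent D w)
  sign : 0 < z.im * w.im

lemma IsDysonPoint.im_ne {D : Matrix (Fin N) (Fin N) ℂ} {z w : ℂ} (h : IsDysonPoint D z w) :
    w.im ≠ 0 := fun h0 => by have := h.sign; rw [h0] at this; simp at this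

/-- The imaginary part of the Dyson equation, with the Ward identity inserted. -/
lemma IsDysonPoint.im_eq {D : Matrix (Fin N) (Fin N) ℂ} (hD : D.IsHermitian) {z w : ℂ}
    (h : IsDysonPoint D z w) : z.im = w.im * (1 - nhs (resolvent D w)) := by
  have h1 := congrArg Complex.im h.eqn
  rw [Complex.add_im, resolvent_im hD h.im_ne] at h1
  linarith

/-- At a solution of the Dyson equation on the correct side of the real axis, `⟨M M*⟩ < 1`. -/
lemma IsDysonPoint.nhs_lt {D : Matrix (Fin N) (Fin N) ℂ} (hD : D.IsHermitian) {z w : ℂ}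
    (h : IsDysonPoint D z w) : nhs (resolvent D w) < 1 := by
  have h1 := h.im_eq hD
  have h2 := h.sign
  rw [h1] at h2
  by_contra hc
  push Not at hc
  nlinarith [mul_nonneg (mul_self_nonneg w.im) (sub_nonneg.mpr hc)]

/-- The exact stability relation: the difference of two solutions, times the stability factor
`1 - ⟨M M'⟩`, is the difference of the spectral parameters. -/
lemma resolvent_eqn_sub {D : Matrix (Fin N) (Fin N) ℂ} {z z' w w' : ℂ} (hu : IsUnit (D - w • 1))
    (hu' : IsUnit (D - w' • 1)) (h : w = z + ntr (resolvent D w))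
    (h' : w' = z' + ntr (resolvent D w')) :
    (w - w') * (1 - ntr (resolvent D w * resolvent D w')) = z - z' := by
  have h1 := resolvent_sub hu hu'
  rw [sub_self, zero_add, Algebra.mul_smul_comm, mul_one, Algebra.smul_mul_assoc] at h1
  have h2 := congrArg ntr h1
  rw [ntr_sub, ntr_smul] at h2
  linear_combination h - h' + h2

lemma norm_ntr_mul_lt {A B : Matrix (Fin N) (Fin N) ℂ} {a b : ℝ} (hA : nhs A ≤ a)
    (hB : nhs B ≤ b) (ha : 0 ≤ a) (hab : a * b < 1) : ‖ntr (A * B)‖ < 1 := by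
  have h := ntr_mul_sq_le A B
  have h2 : nhs A * nhs B ≤ a * b := mul_le_mul hA hB (nhs_nonneg _) ha
  have h3 : ‖ntr (A * B)‖ ^ 2 < 1 := by linarith
  exact (sq_lt_one_iff₀ (norm_nonneg _)).mp h3

lemma IsDysonPoint.unique {D : Matrix (Fin N) (Fin N) ℂ} (hD : D.IsHermitian) {z w w' : ℂ}
    (h : IsDysonPoint D z w) (h' : IsDysonPoint D z w') : w = w' := by
  have h1 := resolvent_eqn_sub (resolvent_bound_im hD h.im_ne).1
    (resolvent_bound_im hD h'.im_ne).1 h.eqn h'.eqn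
  rw [sub_self] at h1
  rcases mul_eq_zero.mp h1 with h2 | h2
  · exact sub_eq_zero.mp h2
  · exfalso
    have h3 : ‖ntr (resolvent D w * resolvent D w')‖ < 1 := by
      refine norm_ntr_mul_lt le_rfl le_rfl (nhs_nonneg _) ?_
      have a1 := h.nhs_lt hD
      have a2 := h'.nhs_lt hD
      nlinarith [nhs_nonneg (resolvent D w), nhs_nonneg (resolvent D w')]
    rw [← sub_eq_zero.mp h2] at h3
    simp at h3

lemma IsDysonPoint.isMDESolution {D : Matrix (Fin N) (Fin N) ℂ} (hD : D.IsHermitian) {z w : ℂ}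
    (h : IsDysonPoint D z w) : IsMDESolution D z (resolvent D w) := by
  obtain ⟨hu, -⟩ := resolvent_bound_im hD h.im_ne
  have hR : IsUnit (resolvent D w) := by
    unfold resolvent; exact (Matrix.isUnit_nonsing_inv_iff).mpr hu
  refine ⟨hR, ?_, ?_⟩
  · have : (resolvent D w)⁻¹ = D - w • 1 := by
      unfold resolvent
      exact Matrix.nonsing_inv_nonsing_inv _ ((Matrix.isUnit_iff_isUnit_det _).mp hu)
    rw [this]
    conv_lhs => rw [h.eqn]
    rw [add_smul]; abel
  · have hw' : ((starRingEnd ℂ) w).im ≠ 0 := by simpa using h.im_ne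
    have h1 := resolvent_sub hu (resolvent_bound_im hD hw').1
    rw [sub_self, zero_add, Algebra.mul_smul_comm, mul_one, Algebra.smul_mul_assoc,
      ← resolvent_conjTranspose hD] at h1
    -- By the resolvent identity at `w` and its conjugate, `Im M = Im w · M M*`.
    have h2 : (z.im : ℂ) • imPart (resolvent D w) =
        ((z.im * w.im : ℝ) : ℂ) • (resolvent D w * (resolvent D w)ᴴ) := by
      unfold imPart
      rw [h1, smul_smul, smul_smul]
      congr 1
      rw [Complex.sub_conj]
      push_cast
      field_simp
    rw [h2]
    refine Matrix.PosDef.smul ?_ ?_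
    · refine Matrix.PosDef.mul_conjTranspose_self _ ?_
      exact Matrix.vecMul_injective_iff_isUnit.mpr hR
    · exact_mod_cast h.sign

lemma IsMDESolution.exists_dysonPoint {D : Matrix (Fin N) (Fin N) ℂ} {z : ℂ}
    (hz : z.im ≠ 0) {M : Matrix (Fin N) (Fin N) ℂ} (h : IsMDESolution D z M) :
    IsDysonPoint D z (z + ntr M) ∧ M = resolvent D (z + ntr M) := by
  have h1 : M = resolvent D (z + ntr M) := by
    have h2 : M⁻¹ = D - (z + ntr M) • 1 := by
      rw [← neg_inj, h.eqn, add_smul]; abel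
    unfold resolvent
    rw [← h2, Matrix.nonsing_inv_nonsing_inv _ ((Matrix.isUnit_iff_isUnit_det _).mp h.isUnit)]
  refine ⟨⟨by rw [← h1], ?_⟩, h1⟩
  -- Positivity of `Im z · Im M` passes to the trace and puts `w` on the side of `z`.
  have h3 := h.im_pos.posSemidef.trace_nonneg
  have h4 : 0 ≤ z.im * (ntr M).im := by
    have h5 : (z.im : ℂ) * ntr (imPart M) = ((z.im * (ntr M).im : ℝ) : ℂ) := by
      unfold imPart
      rw [ntr_smul, ntr_sub, ntr_conjTranspose, Complex.sub_conj]
      push_cast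
      field_simp
    have h6 : 0 ≤ (z.im : ℂ) * ntr (imPart M) := by
      rw [Matrix.trace_smul, smul_eq_mul] at h3
      unfold ntr
      rw [mul_left_comm]
      exact mul_nonneg (by positivity) h3
    rw [h5] at h6
    exact_mod_cast h6
  rw [Complex.add_im, mul_add]
  have := mul_self_pos.mpr hz
  linarith

/-- Solutions of the scalar Dyson equation in the upper half plane. The map
`f(w) = z + ⟨(D - w)⁻¹⟩` strictly decreases the pseudo-hyperbolic quantity
`|w - w'|² / (Im w · Im w')`, so that a minimizer of its displacement over a compact invariant set
is a fixed point. -/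
lemma exists_dysonPoint_of_pos {D : Matrix (Fin N) (Fin N) ℂ} (hD : D.IsHermitian) {z : ℂ}
    (hz : 0 < z.im) : ∃ w, IsDysonPoint D z w := by
  set f : ℂ → ℂ := fun w => z + ntr (resolvent D w) with hf
  set K : Set ℂ := {w | z.im ≤ w.im} ∩ Metric.closedBall z (z.im)⁻¹ with hK
  have hKc : IsCompact K :=
    (isCompact_closedBall z _).inter_left (isClosed_le continuous_const Complex.continuous_im)
  have him : ∀ w ∈ K, 0 < w.im := fun w hw => lt_of_lt_of_le hz hw.1
  have hfim : ∀ w ∈ K, (f w).im = z.im + w.im * nhs (resolvent D w) := fun w hw => by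
    simp only [hf, Complex.add_im, resolvent_im hD (him w hw).ne']
  have hfK : ∀ w ∈ K, f w ∈ K := fun w hw => by
    refine ⟨?_, ?_⟩
    · show z.im ≤ (f w).im
      rw [hfim w hw]
      have := mul_nonneg (him w hw).le (nhs_nonneg (resolvent D w))
      linarith
    · rw [Metric.mem_closedBall, dist_eq_norm]
      simp only [hf, add_sub_cancel_left]
      refine (norm_ntr_le _).trans ((resolvent_bound_im hD (him w hw).ne').2.trans ?_)
      rw [abs_of_pos (him w hw)]
      exact inv_anti₀ hz hw.1
  have hsub : ∀ w ∈ K, ∀ w' ∈ K,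
      f w - f w' = (w - w') * ntr (resolvent D w * resolvent D w') := fun w hw w' hw' => by
    have h1 := resolvent_sub (resolvent_bound_im hD (him w hw).ne').1
      (resolvent_bound_im hD (him w' hw').ne').1
    rw [sub_self, zero_add, Algebra.mul_smul_comm, mul_one, Algebra.smul_mul_assoc] at h1
    have h2 := congrArg ntr h1
    rw [ntr_sub, ntr_smul] at h2
    simp only [hf]
    linear_combination h2
  have hfcont : ContinuousOn f K := by
    have hl : LipschitzOnWith (Real.toNNReal ((z.im)⁻¹ * (z.im)⁻¹)) f K := by
      refine LipschitzOnWith.of_dist_le_mul fun w hw w' hw' => ?_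
      rw [dist_eq_norm, dist_eq_norm, hsub w hw w' hw', norm_mul, mul_comm,
        Real.coe_toNNReal _ (by positivity)]
      gcongr
      refine (norm_ntr_le _).trans ((norm_mul_le _ _).trans ?_)
      gcongr
      · refine (resolvent_bound_im hD (him w hw).ne').2.trans ?_
        rw [abs_of_pos (him w hw)]; exact inv_anti₀ hz hw.1
      · refine (resolvent_bound_im hD (him w' hw').ne').2.trans ?_
        rw [abs_of_pos (him w' hw')]; exact inv_anti₀ hz hw'.1
    exact hl.continuousOn
  have hzK : z ∈ K := ⟨le_refl z.im, Metric.mem_closedBall_self (by positivity)⟩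
  -- The pseudo-hyperbolic displacement of `f`, whose minimizer is shown to be a fixed point.
  set ψ : ℂ → ℝ := fun w => ‖f w - w‖ ^ 2 / (w.im * (f w).im) with hψ
  have hψc : ContinuousOn ψ K := by
    refine ContinuousOn.div ((hfcont.sub continuousOn_id).norm.pow 2)
      (Complex.continuous_im.continuousOn.mul (Complex.continuous_im.comp_continuousOn hfcont)) ?_
    intro w hw
    exact (mul_pos (him w hw) (him _ (hfK w hw))).ne'
  obtain ⟨w, hwK, hmin⟩ := hKc.exists_isMinOn ⟨z, hzK⟩ hψc
  refine ⟨w, ?_, mul_pos hz (him w hwK)⟩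
  -- If `w` is not fixed, compare its displacement with that of `f w`. By Cauchy–Schwarz the
  -- numerator gains the factor `a b`, which is less than the gain of the denominator, because
  -- `Im f w > a Im w` and `Im f (f w) > b Im f w`.
  by_contra hne
  have hne' : 0 < ‖f w - w‖ ^ 2 := by
    have : f w - w ≠ 0 := fun h0 => hne (sub_eq_zero.mp h0).symm
    positivity
  have h1 : ψ w ≤ ψ (f w) := hmin (hfK w hwK)
  have hfw := hfK w hwK
  simp only [hψ] at h1
  rw [hsub _ hfw _ hwK, norm_mul, mul_pow] at h1
  set a := nhs (resolvent D w)
  set b := nhs (resolvent D (f w))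
  have hcs : ‖ntr (resolvent D (f w) * resolvent D w)‖ ^ 2 ≤ b * a := ntr_mul_sq_le _ _
  have e1 := hfim w hwK
  have e2 := hfim (f w) hfw
  have p1 := him w hwK
  have p2 := him _ hfw
  have p3 := him _ (hfK _ hfw)
  rw [div_le_div_iff₀ (mul_pos p1 p2) (mul_pos p2 p3)] at h1
  have ha : 0 ≤ a := nhs_nonneg _
  have hb : 0 ≤ b := nhs_nonneg _
  have h2 : ‖f w - w‖ ^ 2 * ((f w).im * (f (f w)).im) ≤
      ‖f w - w‖ ^ 2 * ((b * a) * (w.im * (f w).im)) := by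
    refine h1.trans (le_of_eq_of_le (mul_assoc _ _ _) ?_)
    gcongr
  have h3 := le_of_mul_le_mul_left h2 hne'
  have h4 : (f (f w)).im ≤ b * a * w.im := by
    refine le_of_mul_le_mul_left ?_ p2
    linarith
  have h5 : w.im * a < (f w).im := by rw [e1]; linarith
  have h6 : b * (w.im * a) ≤ b * (f w).im := mul_le_mul_of_nonneg_left h5.le hb
  nlinarith

lemma exists_dysonPoint {D : Matrix (Fin N) (Fin N) ℂ} (hD : D.IsHermitian) {z : ℂ}
    (hz : z.im ≠ 0) : ∃ w, IsDysonPoint D z w := by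
  rcases lt_or_gt_of_ne hz with h | h
  · obtain ⟨w, hw⟩ := exists_dysonPoint_of_pos hD (z := (starRingEnd ℂ) z) (by simpa using h)
    refine ⟨(starRingEnd ℂ) w, ?_, ?_⟩
    · rw [← resolvent_conjTranspose hD, ntr_conjTranspose]
      conv_lhs => rw [hw.eqn]
      simp
    · have := hw.sign
      simpa using this
  · exact exists_dysonPoint_of_pos hD h

/-- The spectral parameter `z` has distance at least of order `κ` from `[-(L+2), L+2]`. -/
def Far (L κ : ℝ) (z : ℂ) : Prop := κ ≤ |z.im| ∨ L + 2 + κ ≤ |z.re|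

lemma far_of_spectralDist {L δ : ℝ} (hL : 0 < L) {z : ℂ} (h : δ ≤ spectralDist L z) :
    Far L (δ / 2) z := by
  by_contra hc
  unfold Far at hc
  push Not at hc
  obtain ⟨h1, h2⟩ := hc
  -- the point of the interval that is closest to `Re z`
  set c : ℝ := max (-(L + 2)) (min (L + 2) z.re) with hcdef
  have hc1 : c ∈ Set.Icc (-(L + 2)) (L + 2) :=
    ⟨le_max_left _ _, max_le (by linarith) (min_le_left _ _)⟩
  have h3 : spectralDist L z ≤ dist z (c : ℂ) :=
    Metric.infDist_le_dist_of_mem ⟨c, hc1, rfl⟩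
  have h4 : dist z (c : ℂ) ≤ |z.re - c| + |z.im| := by
    rw [dist_eq_norm]
    refine (Complex.norm_le_abs_re_add_abs_im _).trans ?_
    simp
  have hpos : 0 < δ := by linarith [abs_nonneg z.im]
  have h5 : |z.re - c| < δ / 2 := by
    rw [abs_lt] at h2 ⊢
    rcases le_total z.re (L + 2) with h6 | h6
    · rw [min_eq_right h6] at hcdef
      rcases le_total (-(L + 2)) z.re with h7 | h7
      · rw [max_eq_right h7] at hcdef
        constructor <;> linarith
      · rw [max_eq_left h7] at hcdef
        constructor <;> linarith
    · rw [min_eq_left h6, max_eq_right (by linarith)] at hcdef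
      constructor <;> linarith
  linarith

lemma Far.add {L κ κ' : ℝ} {z ζ : ℂ} (h : Far L κ z) (hζ : ‖ζ‖ ≤ κ') : Far L (κ - κ') (z + ζ) := by
  rcases h with h | h
  · left
    have h1 := Complex.abs_im_le_norm ζ
    have h2 := abs_sub_abs_le_abs_sub z.im (-ζ.im)
    rw [abs_neg, sub_neg_eq_add] at h2
    rw [Complex.add_im]; linarith
  · right
    have h1 := Complex.abs_re_le_norm ζ
    have h2 := abs_sub_abs_le_abs_sub z.re (-ζ.re)
    rw [abs_neg, sub_neg_eq_add] at h2
    rw [Complex.add_re]; linarith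

lemma Far.mono {L κ κ' : ℝ} {z : ℂ} (h : Far L κ z) (hκ : κ' ≤ κ) : Far L κ' z := by
  rcases h with h | h
  · left; linarith
  · right; linarith

/-- The bounds on the value `w = z + m` that hold uniformly away from the spectrum. The bound on
the normalized Hilbert–Schmidt norm of `M = (D - w)⁻¹` by a constant below `1` is what makes the
Dyson equation stable. -/
structure DysonBounds (D : Matrix (Fin N) (Fin N) ℂ) (κ : ℝ) (z w : ℂ) : Prop where
  isUnit : IsUnit (D - w • 1)
  eqn : w = z + ntr (resolvent D w)
  nhs_le : nhs (resolvent D w) ≤ (1 + κ)⁻¹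
  norm_le : ‖resolvent D w‖ ≤ 1 + κ⁻¹

lemma resolvent_far_re {D : Matrix (Fin N) (Fin N) ℂ} {L κ : ℝ} (hκ : 0 < κ)
    (hL : ‖D‖ ≤ L) {w : ℂ} (hw : L + 1 + κ ≤ |w.re|) :
    IsUnit (D - w • 1) ∧ ‖resolvent D w‖ ≤ (1 + κ)⁻¹ :=
  resolvent_bound_re (by positivity) (by linarith)

/-- The bounds hold for two different reasons. If `|Im z| ≥ κ`, then `Im z = Im w (1 - ⟨M M*⟩)`
with `|Im w| ≤ |Im z| + 1`. If `|Re z| ≥ L + 2 + κ`, then `|⟨M⟩| ≤ 1` keeps `Re w` at distance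
at least `1 + κ` from the spectrum of `D`. -/
lemma IsDysonPoint.bounds {D : Matrix (Fin N) (Fin N) ℂ} (hD : D.IsHermitian) {L κ : ℝ}
    (hκ : 0 < κ) (hL : ‖D‖ ≤ L) {z w : ℂ} (hz : Far L κ z) (h : IsDysonPoint D z w) :
    DysonBounds D κ z w := by
  have ha := h.nhs_lt hD
  have hm : ‖ntr (resolvent D w)‖ ≤ 1 := by
    have := ntr_sq_le (resolvent D w)
    exact (sq_le_one_iff₀ (norm_nonneg _)).mp (by linarith)
  have h0 : (1 + κ)⁻¹ ≤ 1 := inv_le_one_of_one_le₀ (by linarith)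
  rcases hz with hz | hz
  · have h1 := h.im_eq hD
    have h2 : |w.im| ≤ |z.im| + 1 := by
      have e := congrArg Complex.im h.eqn
      rw [Complex.add_im] at e
      rw [e]
      exact (abs_add_le _ _).trans (add_le_add le_rfl ((Complex.abs_im_le_norm _).trans hm))
    have h3 : |z.im| = |w.im| * (1 - nhs (resolvent D w)) := by
      rw [h1, abs_mul, abs_of_pos (by linarith : 0 < 1 - nhs (resolvent D w))]
    have h4 : |z.im| ≤ |w.im| := by
      rw [h3]; exact mul_le_of_le_one_right (abs_nonneg _) (by linarith [nhs_nonneg (resolvent D w)])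
    refine ⟨(resolvent_bound_im hD h.im_ne).1, h.eqn, ?_, ?_⟩
    · rw [← one_div, le_div_iff₀ (by positivity)]
      set a := nhs (resolvent D w)
      have ha0 : 0 ≤ a := nhs_nonneg _
      have h5 : |z.im| ≤ (|z.im| + 1) * (1 - a) := by
        rw [h3]
        rw [← h3]
        calc |z.im| = |w.im| * (1 - a) := h3
          _ ≤ (|z.im| + 1) * (1 - a) := by
            apply mul_le_mul_of_nonneg_right h2; linarith
      nlinarith [mul_le_mul_of_nonneg_right hz ha0]
    · refine (resolvent_bound_im hD h.im_ne).2.trans ?_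
      have : |w.im|⁻¹ ≤ κ⁻¹ := inv_anti₀ hκ (hz.trans h4)
      linarith
  · have h1 : L + 1 + κ ≤ |w.re| := by
      have e := congrArg Complex.re h.eqn
      rw [Complex.add_re] at e
      have h2 := (Complex.abs_re_le_norm (ntr (resolvent D w))).trans hm
      have h3 := abs_sub_abs_le_abs_sub z.re (-(ntr (resolvent D w)).re)
      rw [abs_neg, sub_neg_eq_add, ← e] at h3
      linarith
    obtain ⟨h2, h3⟩ := resolvent_far_re hκ hL h1
    refine ⟨h2, h.eqn, (nhs_le _).trans ?_, ?_⟩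
    · have h5 : (0:ℝ) ≤ (1 + κ)⁻¹ := by positivity
      nlinarith [norm_nonneg (resolvent D w)]
    · have : 0 < κ⁻¹ := by positivity
      linarith

/-- The stability factor is bounded away from zero, by Cauchy–Schwarz. -/
lemma DysonBounds.norm_one_sub {D D' : Matrix (Fin N) (Fin N) ℂ} {κ : ℝ} (hκ : 0 < κ)
    {z w z' w' : ℂ} (h : DysonBounds D κ z w) (h' : DysonBounds D' κ z' w') :
    κ / (1 + κ) ≤ ‖1 - ntr (resolvent D w * resolvent D' w')‖ := by
  have h1 := ntr_mul_sq_le (resolvent D w) (resolvent D' w')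
  have h2 : ‖ntr (resolvent D w * resolvent D' w')‖ ≤ (1 + κ)⁻¹ := by
    refine (abs_le_of_sq_le_sq' ?_ (by positivity)).2
    refine h1.trans ?_
    rw [sq]
    exact mul_le_mul h.nhs_le h'.nhs_le (nhs_nonneg _) (by positivity)
  have h3 := norm_sub_norm_le (1 : ℂ) (ntr (resolvent D w * resolvent D' w'))
  rw [norm_one] at h3
  have h4 : κ / (1 + κ) = 1 - (1 + κ)⁻¹ := by field_simp; ring
  linarith

lemma DysonBounds.lipschitz {D : Matrix (Fin N) (Fin N) ℂ} {κ : ℝ} (hκ : 0 < κ)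
    {z w z' w' : ℂ} (h : DysonBounds D κ z w) (h' : DysonBounds D κ z' w') :
    ‖w - w'‖ ≤ (1 + κ) / κ * ‖z - z'‖ := by
  have h1 := resolvent_eqn_sub h.isUnit h'.isUnit h.eqn h'.eqn
  have h2 := h.norm_one_sub hκ h'
  rw [← h1, norm_mul]
  have h3 : (1 + κ) / κ * (κ / (1 + κ)) = 1 := by field_simp
  calc ‖w - w'‖ = ‖w - w'‖ * ((1 + κ) / κ * (κ / (1 + κ))) := by rw [h3, mul_one]
    _ ≤ ‖w - w'‖ * ((1 + κ) / κ * ‖1 - ntr (resolvent D w * resolvent D w')‖) := by gcongr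
    _ = _ := by ring

lemma resolvent_sub_norm_le {D : Matrix (Fin N) (Fin N) ℂ} {w w' : ℂ} (hu : IsUnit (D - w • 1))
    (hu' : IsUnit (D - w' • 1)) :
    ‖resolvent D w - resolvent D w'‖ ≤ ‖resolvent D w‖ * ‖resolvent D w'‖ * ‖w - w'‖ := by
  rw [resolvent_sub hu hu', sub_self, zero_add, Algebra.mul_smul_comm, mul_one,
    Algebra.smul_mul_assoc, norm_smul, mul_comm]
  gcongr
  exact norm_mul_le _ _

lemma continuous_ntr : Continuous (ntr : Matrix (Fin N) (Fin N) ℂ → ℂ) := by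
  unfold ntr Matrix.trace
  fun_prop

lemma continuous_nhs : Continuous (nhs : Matrix (Fin N) (Fin N) ℂ → ℝ) := by
  unfold nhs
  fun_prop

/-- Away from the spectrum, the value of the solution of the Matrix Dyson equation exists, also
as a boundary value on the real line. -/
lemma exists_isMDEValue {D : Matrix (Fin N) (Fin N) ℂ} (hD : D.IsHermitian) {L κ : ℝ}
    (hκ : 0 < κ) (hL : ‖D‖ ≤ L) {z : ℂ} (hz : Far L κ z) :
    ∃ w, DysonBounds D κ z w ∧ IsMDEValue D z (resolvent D w) := by
  by_cases h0 : z.im = 0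
  · have hzre : L + 2 + κ ≤ |z.re| := by
      rcases hz with h | h
      · rw [h0, abs_zero] at h; linarith
      · exact h
    have hre : ∀ η : ℝ, (z + η * Complex.I).re = z.re := fun η => by simp
    have him : ∀ η : ℝ, (z + η * Complex.I).im = η := fun η => by simp [h0]
    have hex : ∀ η : ℝ, ∃ w, 0 < η → IsDysonPoint D (z + η * Complex.I) w := fun η => by
      by_cases hη : 0 < η
      · obtain ⟨w, hw⟩ := exists_dysonPoint hD (z := z + η * Complex.I) (by rw [him]; exact hη.ne')
        exact ⟨w, fun _ => hw⟩
      · exact ⟨0, fun h => absurd h hη⟩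
    -- The solutions `w η` at `z + i η` form a Cauchy family as `η ↓ 0`, by the Lipschitz bound,
    -- and the bounds pass to the limit `w₀`.
    choose w hw using hex
    have hb : ∀ η : ℝ, 0 < η → DysonBounds D κ (z + η * Complex.I) (w η) := fun η hη =>
      (hw η hη).bounds hD hκ hL (Or.inr (by rw [hre]; exact hzre))
    have hlip : ∀ η η' : ℝ, 0 < η → 0 < η' → ‖w η - w η'‖ ≤ (1 + κ) / κ * |η - η'| := by
      intro η η' hη hη'
      refine ((hb η hη).lipschitz hκ (hb η' hη')).trans (le_of_eq ?_)
      congr 1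
      rw [add_sub_add_left_eq_sub, ← sub_mul, ← Complex.ofReal_sub, norm_mul, Complex.norm_I,
        mul_one, Complex.norm_real, Real.norm_eq_abs]
    have hc : Cauchy (map w (𝓝[>] (0 : ℝ))) := by
      rw [Metric.cauchy_iff]
      refine ⟨inferInstance, fun ε hε => ?_⟩
      set r : ℝ := ε * (κ / (1 + κ)) with hr
      have hrpos : 0 < r := by positivity
      refine ⟨w '' Set.Ioo 0 r, image_mem_map (Ioo_mem_nhdsGT hrpos), ?_⟩
      rintro _ ⟨η, hη, rfl⟩ _ ⟨η', hη', rfl⟩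
      rw [dist_eq_norm]
      have h2 : |η - η'| < r := by
        rw [abs_lt]; constructor <;> linarith [hη.1, hη.2, hη'.1, hη'.2]
      calc ‖w η - w η'‖ ≤ (1 + κ) / κ * |η - η'| := hlip _ _ hη.1 hη'.1
        _ < (1 + κ) / κ * r := by gcongr
        _ = ε := by rw [hr]; field_simp
    obtain ⟨w₀, hw₀⟩ := cauchy_map_iff_exists_tendsto.mp hc
    have hpos : ∀ᶠ η : ℝ in 𝓝[>] (0 : ℝ), 0 < η := self_mem_nhdsWithin
    have hre0 : L + 1 + κ ≤ |w₀.re| := by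
      refine ge_of_tendsto ((Complex.continuous_re.tendsto _).comp hw₀).abs ?_
      filter_upwards [hpos] with η hη
      have hm : ‖ntr (resolvent D (w η))‖ ≤ 1 := by
        have h1 := ntr_sq_le (resolvent D (w η))
        have h2 := (hw η hη).nhs_lt hD
        exact (sq_le_one_iff₀ (norm_nonneg _)).mp (by linarith)
      have e := congrArg Complex.re (hw η hη).eqn
      rw [Complex.add_re, hre] at e
      have h2 := (Complex.abs_re_le_norm (ntr (resolvent D (w η)))).trans hm
      have h3 := abs_sub_abs_le_abs_sub z.re (-(ntr (resolvent D (w η))).re)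
      rw [abs_neg, sub_neg_eq_add, ← e] at h3
      show L + 1 + κ ≤ |(w η).re|
      linarith
    obtain ⟨hu0, hn0⟩ := resolvent_far_re hκ hL hre0
    have hn1 : ‖resolvent D w₀‖ ≤ 1 + κ⁻¹ := by
      have h1 : (1 + κ)⁻¹ ≤ 1 := inv_le_one_of_one_le₀ (by linarith)
      have : 0 < κ⁻¹ := by positivity
      linarith
    have hRt : Tendsto (fun η => resolvent D (w η)) (𝓝[>] (0 : ℝ)) (𝓝 (resolvent D w₀)) := by
      rw [tendsto_iff_norm_sub_tendsto_zero]
      have h1 : Tendsto (fun η => (1 + κ⁻¹) * (1 + κ⁻¹) * ‖w η - w₀‖) (𝓝[>] (0 : ℝ)) (𝓝 0) := by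
        have := (tendsto_iff_norm_sub_tendsto_zero.mp hw₀).const_mul ((1 + κ⁻¹) * (1 + κ⁻¹))
        rwa [mul_zero] at this
      refine squeeze_zero' (Eventually.of_forall fun _ => norm_nonneg _) ?_ h1
      filter_upwards [hpos] with η hη
      refine (resolvent_sub_norm_le (hb η hη).isUnit hu0).trans ?_
      gcongr
      exact (hb η hη).norm_le
    refine ⟨w₀, ⟨hu0, ?_, ?_, hn1⟩, fun h => absurd h0 h, fun _ => ⟨fun η => resolvent D (w η),
      fun η hη => (hw η hη).isMDESolution hD, hRt⟩⟩
    · have h1 : Tendsto (fun η : ℝ => z + η * Complex.I + ntr (resolvent D (w η))) (𝓝[>] (0 : ℝ))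
          (𝓝 (z + (0 : ℝ) * Complex.I + ntr (resolvent D w₀))) := by
        refine Tendsto.add ?_ ((continuous_ntr.tendsto _).comp hRt)
        refine Tendsto.mono_left ?_ nhdsWithin_le_nhds
        exact Continuous.tendsto (by fun_prop) 0
      have h2 := tendsto_nhds_unique_of_eventuallyEq hw₀ h1 (by
        filter_upwards [hpos] with η hη
        exact (hw η hη).eqn)
      simpa using h2
    · refine le_of_tendsto ((continuous_nhs.tendsto _).comp hRt) ?_
      filter_upwards [hpos] with η hη
      exact (hb η hη).nhs_le
  · obtain ⟨w, hw⟩ := exists_dysonPoint hD h0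
    exact ⟨w, hw.bounds hD hκ hL hz, fun _ => hw.isMDESolution hD, fun h => absurd h h0⟩

lemma IsMDESolution.unique {D : Matrix (Fin N) (Fin N) ℂ} (hD : D.IsHermitian) {z : ℂ}
    (hz : z.im ≠ 0) {M M' : Matrix (Fin N) (Fin N) ℂ} (h : IsMDESolution D z M)
    (h' : IsMDESolution D z M') : M = M' := by
  obtain ⟨h1, h2⟩ := h.exists_dysonPoint hz
  obtain ⟨h1', h2'⟩ := h'.exists_dysonPoint hz
  rw [h2, h2', h1.unique hD h1']

lemma IsMDEValue.unique {D : Matrix (Fin N) (Fin N) ℂ} (hD : D.IsHermitian) {z : ℂ}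
    {M M' : Matrix (Fin N) (Fin N) ℂ} (h : IsMDEValue D z M) (h' : IsMDEValue D z M') :
    M = M' := by
  by_cases h0 : z.im = 0
  · obtain ⟨F, hF, hFt⟩ := h.2 h0
    obtain ⟨F', hF', hFt'⟩ := h'.2 h0
    refine tendsto_nhds_unique_of_eventuallyEq hFt hFt' ?_
    filter_upwards [self_mem_nhdsWithin] with η hη
    exact (hF η hη).unique hD (by simpa [h0] using (ne_of_gt hη)) (hF' η hη)
  · exact (h.1 h0).unique hD h0 (h'.1 h0)

/-- The point `w(z) = z + ⟨M(z)⟩`. -/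
def dysonPt (D : Matrix (Fin N) (Fin N) ℂ) (z : ℂ) : ℂ := z + ntr (mdeM D z)

lemma mdeM_bounds {D : Matrix (Fin N) (Fin N) ℂ} (hD : D.IsHermitian) {L κ : ℝ}
    (hκ : 0 < κ) (hL : ‖D‖ ≤ L) {z : ℂ} (hz : Far L κ z) :
    DysonBounds D κ z (dysonPt D z) ∧ mdeM D z = resolvent D (dysonPt D z) := by
  obtain ⟨w, hw, hM⟩ := exists_isMDEValue hD hκ hL hz
  have h1 : mdeM D z = resolvent D w :=
    (Classical.epsilon_spec (p := IsMDEValue D z) ⟨_, hM⟩).unique hD hM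
  have h2 : dysonPt D z = w := by unfold dysonPt; rw [h1, ← hw.eqn]
  rw [h2]
  exact ⟨hw, h1⟩

/-- `w(z)` is complex differentiable away from the spectrum, the real line included. -/
lemma differentiableAt_dysonPt {D : Matrix (Fin N) (Fin N) ℂ} (hD : D.IsHermitian) {L κ : ℝ}
    (hκ : 0 < κ) (hL : ‖D‖ ≤ L) {z : ℂ} (hz : Far L κ z) :
    DifferentiableAt ℂ (dysonPt D) z := by
  have hκ2 : 0 < κ / 2 := by positivity
  have hnear : ∀ᶠ z' in 𝓝 z, DysonBounds D (κ / 2) z' (dysonPt D z') := by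
    filter_upwards [Metric.ball_mem_nhds z hκ2] with z' hz'
    have : Far L (κ / 2) z' := by
      have h1 := hz.add (ζ := z' - z) (κ' := κ / 2)
        (by rw [← dist_eq_norm]; exact (Metric.mem_ball.mp hz').le)
      rw [add_sub_cancel] at h1
      exact h1.mono (by linarith)
    exact (mdeM_bounds hD hκ2 hL this).1
  have hb := hnear.self_of_nhds
  have hcont : Tendsto (dysonPt D) (𝓝 z) (𝓝 (dysonPt D z)) := by
    rw [tendsto_iff_norm_sub_tendsto_zero]
    have h1 : Tendsto (fun z' => (1 + κ / 2) / (κ / 2) * ‖z' - z‖) (𝓝 z) (𝓝 0) := by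
      have : Tendsto (fun z' : ℂ => (1 + κ / 2) / (κ / 2) * ‖z' - z‖) (𝓝 z)
        (𝓝 ((1 + κ / 2) / (κ / 2) * ‖z - z‖)) := Continuous.tendsto (by fun_prop) z
      simpa using this
    refine squeeze_zero' (Eventually.of_forall fun _ => norm_nonneg _) ?_ h1
    filter_upwards [hnear] with z' hz'
    exact hz'.lipschitz hκ2 hb
  have hR : Tendsto (fun z' => resolvent D (dysonPt D z')) (𝓝 z) (𝓝 (resolvent D (dysonPt D z))) := by
    rw [tendsto_iff_norm_sub_tendsto_zero]
    have h1 := (tendsto_iff_norm_sub_tendsto_zero.mp hcont).const_mul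
      ((1 + (κ / 2)⁻¹) * (1 + (κ / 2)⁻¹))
    rw [mul_zero] at h1
    refine squeeze_zero' (Eventually.of_forall fun _ => norm_nonneg _) ?_ h1
    filter_upwards [hnear] with z' hz'
    refine (resolvent_sub_norm_le hz'.isUnit hb.isUnit).trans ?_
    gcongr
    · exact hz'.norm_le
    · exact hb.norm_le
  have hne : ∀ z', DysonBounds D (κ / 2) z' (dysonPt D z') →
      1 - ntr (resolvent D (dysonPt D z') * resolvent D (dysonPt D z)) ≠ 0 := fun z' hz' h0 => by
    have h1 := hz'.norm_one_sub hκ2 hb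
    rw [h0, norm_zero] at h1
    have : 0 < κ / 2 / (1 + κ / 2) := by positivity
    linarith
  -- The stability relation computes the difference quotient as `(1 - ⟨R(w(z')) R(w(z))⟩)⁻¹`.
  have hd : HasDerivAt (dysonPt D)
      (1 - ntr (resolvent D (dysonPt D z) * resolvent D (dysonPt D z)))⁻¹ z := by
    rw [hasDerivAt_iff_tendsto_slope]
    have h1 : Tendsto (fun z' => (1 - ntr (resolvent D (dysonPt D z') *
        resolvent D (dysonPt D z)))⁻¹) (𝓝[≠] z)
        (𝓝 (1 - ntr (resolvent D (dysonPt D z) * resolvent D (dysonPt D z)))⁻¹) := by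
      refine Tendsto.inv₀ ?_ (hne z hb)
      refine tendsto_const_nhds.sub ((continuous_ntr.tendsto _).comp ?_)
      exact (hR.mul_const _).mono_left nhdsWithin_le_nhds
    refine h1.congr' ?_
    filter_upwards [hnear.filter_mono nhdsWithin_le_nhds, self_mem_nhdsWithin] with z' hz' hzz
    have h2 := resolvent_eqn_sub hz'.isUnit hb.isUnit hz'.eqn hb.eqn
    have h3 : z' - z ≠ 0 := sub_ne_zero.mpr hzz
    rw [slope_def_field]
    field_simp [hne z' hz', h3]
    rw [← h2, mul_comm]
  exact hd.differentiableAt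

lemma differentiableAt_resolvent {H : Matrix (Fin N) (Fin N) ℂ} {f : ℂ → ℂ} {ζ : ℂ}
    (hf : DifferentiableAt ℂ f ζ) (hu : IsUnit (H - f ζ • 1)) :
    DifferentiableAt ℂ (fun x => resolvent H (f x)) ζ := by
  have h1 : (fun x => resolvent H (f x)) = fun x => Ring.inverse (H - f x • 1) := by
    ext1 x; unfold resolvent; rw [Matrix.nonsing_inv_eq_ringInverse]
  rw [h1]
  have h2 : DifferentiableAt ℂ (fun x => H - f x • (1 : Matrix (Fin N) (Fin N) ℂ)) ζ := by
    fun_prop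
  obtain ⟨u, hu⟩ := hu
  have h3 : DifferentiableAt ℂ (Ring.inverse : Matrix (Fin N) (Fin N) ℂ → _) (H - f ζ • 1) := by
    rw [← hu]
    exact (hasFDerivAt_ringInverse u).differentiableAt
  exact DifferentiableAt.comp ζ h3 h2

lemma differentiableAt_ntr {f : ℂ → Matrix (Fin N) (Fin N) ℂ} {ζ : ℂ}
    (hf : DifferentiableAt ℂ f ζ) : DifferentiableAt ℂ (fun x => ntr (f x)) ζ := by
  let T : Matrix (Fin N) (Fin N) ℂ →ₗ[ℂ] ℂ :=
    { toFun := ntr, map_add' := ntr_add, map_smul' := fun c A => ntr_smul c A }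
  exact (LinearMap.toContinuousLinearMap T).differentiableAt.comp ζ hf

end TwoResolvent
end

noncomputable section
namespace TwoResolvent

/-! ### Resampling and concentration on product spaces -/

section Resampling

variable {ι α : Type*} [Fintype ι] [DecidableEq ι] [MeasurableSpace α]

/-- Exchange the coordinates in `S` between two points of a product space. -/
def swapOn (S : Finset ι) (p : (ι → α) × (ι → α)) : (ι → α) × (ι → α) :=
  (S.piecewise p.2 p.1, S.piecewise p.1 p.2)

variable (ν : ι → Measure α) [∀ i, IsProbabilityMeasure (ν i)]

omit [Fintype ι] in
lemma measurable_piecewise (S : Finset ι) :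
    Measurable fun p : (ι → α) × (ι → α) => S.piecewise p.2 p.1 := by
  refine measurable_pi_lambda _ fun i => ?_
  by_cases h : i ∈ S
  · simp only [Finset.piecewise_eq_of_mem _ _ _ h]; fun_prop
  · simp only [Finset.piecewise_eq_of_notMem _ _ _ h]; fun_prop

lemma measurePreserving_swapOn (S : Finset ι) :
    MeasurePreserving (swapOn S) ((Measure.pi ν).prod (Measure.pi ν))
      ((Measure.pi ν).prod (Measure.pi ν)) := by
  have h1 := measurePreserving_arrowProdEquivProdArrow α α ι ν ν
  have h2 : MeasurePreserving (fun (x : ι → α × α) i => (if i ∈ S then Prod.swap else id) (x i))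
      (Measure.pi fun i => (ν i).prod (ν i)) (Measure.pi fun i => (ν i).prod (ν i)) := by
    refine measurePreserving_pi _ _ fun i => ?_
    by_cases h : i ∈ S
    · simp only [h, if_true]; exact Measure.measurePreserving_swap
    · simp only [h, if_false]; exact MeasurePreserving.id _
  have h3 := (h1.comp h2).comp h1.symm
  convert h3 using 1
  ext1 p
  have : ∀ (x : ι → α × α), MeasurableEquiv.arrowProdEquivProdArrow α α ι x =
      (fun i => (x i).1, fun i => (x i).2) := fun _ => rfl
  have e : (MeasurableEquiv.arrowProdEquivProdArrow α α ι).symm p = fun i => (p.1 i, p.2 i) := rfl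
  simp only [Function.comp, this, e, swapOn]
  ext i <;> by_cases h : i ∈ S <;> simp [h]

variable {ν}

lemma integral_swapOn {E : Type*} [NormedAddCommGroup E] [NormedSpace ℝ E] [MeasurableSpace E]
    [BorelSpace E] [SecondCountableTopology E] (S : Finset ι) (F : (ι → α) × (ι → α) → E)
    (hF : Measurable F) :
    ∫ p, F (swapOn S p) ∂((Measure.pi ν).prod (Measure.pi ν)) =
      ∫ p, F p ∂((Measure.pi ν).prod (Measure.pi ν)) := by
  have h := measurePreserving_swapOn ν S
  rw [← integral_map h.measurable.aemeasurable (by rw [h.map_eq]; exact hF.aestronglyMeasurable),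
    h.map_eq]

lemma integrable_of_bdd {β E : Type*} [MeasurableSpace β] {m : Measure β} [IsFiniteMeasure m]
    [NormedAddCommGroup E] [MeasurableSpace E] [BorelSpace E] [SecondCountableTopology E]
    {f : β → E} (hf : Measurable f) (C : ℝ) (hC : ∀ x, ‖f x‖ ≤ C) : Integrable f m :=
  Integrable.of_bound hf.aestronglyMeasurable C (Eventually.of_forall hC)

/-- One step of the Efron–Stein inequality: the covariance of `f` with the increment of `f` from
resampling one more coordinate `k` is at most half the mean square of the increment itself. -/
lemma covariance_resample_le {f : (ι → α) → ℝ} (hf : Measurable f) {C : ℝ} (hC : ∀ x, |f x| ≤ C)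
    {S : Finset ι} {k : ι} (hk : k ∉ S) :
    ∫ p, f p.1 * (f (S.piecewise p.2 p.1) - f ((insert k S).piecewise p.2 p.1))
        ∂((Measure.pi ν).prod (Measure.pi ν)) ≤
      2⁻¹ * ∫ p, (f p.1 - f (Function.update p.1 k (p.2 k))) ^ 2
        ∂((Measure.pi ν).prod (Measure.pi ν)) := by
  have hu : ∀ p : (ι → α) × (ι → α),
      Function.update p.1 k (p.2 k) = ({k} : Finset ι).piecewise p.2 p.1 := fun p =>
    (Finset.piecewise_singleton p.2 p.1 k).symm
  have m1 : Measurable fun p : (ι → α) × (ι → α) => f p.1 := hf.comp measurable_fst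
  have mS : ∀ S : Finset ι, Measurable fun p : (ι → α) × (ι → α) => f (S.piecewise p.2 p.1) :=
    fun S => hf.comp (measurable_piecewise S)
  -- an empty product space carries no constraint on `C`, but there all integrals vanish
  have hC0 : 0 ≤ C ∨ IsEmpty (ι → α) := by
    rcases isEmpty_or_nonempty (ι → α) with h | ⟨⟨x⟩⟩
    · exact Or.inr h
    · exact Or.inl ((abs_nonneg _).trans (hC x))
  rcases hC0 with hC0 | hE
  swap
  · have : IsEmpty ((ι → α) × (ι → α)) := inferInstance
    simp [Measure.eq_zero_of_isEmpty]
  have hdiff : ∀ x y : ι → α, |f x - f y| ≤ 2 * C := fun x y =>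
    (abs_sub _ _).trans (by linarith [hC x, hC y])
  set m := (Measure.pi ν).prod (Measure.pi ν)
  set T := ∫ p, f p.1 * (f (S.piecewise p.2 p.1) - f ((insert k S).piecewise p.2 p.1)) ∂m with hT
  set V := ∫ p, (f p.1 - f (Function.update p.1 k (p.2 k))) ^ 2 ∂m with hV
  -- exchanging the `k`-th coordinates
  have e1 : T = ∫ p, f (({k} : Finset ι).piecewise p.2 p.1) *
      (f ((insert k S).piecewise p.2 p.1) - f (S.piecewise p.2 p.1)) ∂m := by
    rw [hT, ← integral_swapOn {k} (fun p => f p.1 * (f (S.piecewise p.2 p.1) -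
      f ((insert k S).piecewise p.2 p.1))) (m1.mul ((mS S).sub (mS (insert k S))))]
    refine integral_congr_ae (Eventually.of_forall fun p => ?_)
    have a1 : S.piecewise (swapOn {k} p).2 (swapOn {k} p).1 = (insert k S).piecewise p.2 p.1 := by
      ext i
      by_cases hi : i = k
      · subst hi; simp [swapOn, hk]
      · by_cases h2 : i ∈ S <;> simp [swapOn, hi, h2]
    have a2 : (insert k S).piecewise (swapOn {k} p).2 (swapOn {k} p).1 = S.piecewise p.2 p.1 := by
      ext i
      by_cases hi : i = k
      · subst hi; simp [swapOn, hk]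
      · by_cases h2 : i ∈ S <;> simp [swapOn, hi, h2]
    simp only [a1, a2]
    rfl
  -- exchanging the coordinates in `S`
  have e2 : V = ∫ p, (f (S.piecewise p.2 p.1) - f ((insert k S).piecewise p.2 p.1)) ^ 2 ∂m := by
    have mV : Measurable fun p : (ι → α) × (ι → α) =>
        (f p.1 - f (Function.update p.1 k (p.2 k))) ^ 2 := by
      simp only [hu]; exact (m1.sub (mS {k})).pow_const 2
    rw [hV, ← integral_swapOn S _ mV]
    refine integral_congr_ae (Eventually.of_forall fun p => ?_)
    have a1 : Function.update (swapOn S p).1 k ((swapOn S p).2 k) =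
        (insert k S).piecewise p.2 p.1 := by
      ext i
      by_cases hi : i = k
      · subst hi; simp [swapOn, hk]
      · by_cases h2 : i ∈ S <;> simp [swapOn, hi, h2]
    simp only [a1]
    rfl
  have i1 : Integrable (fun p : (ι → α) × (ι → α) =>
      f p.1 * (f (S.piecewise p.2 p.1) - f ((insert k S).piecewise p.2 p.1))) m := by
    refine integrable_of_bdd (m1.mul ((mS S).sub (mS (insert k S)))) (C * (2 * C)) fun p => ?_
    rw [Real.norm_eq_abs, abs_mul]
    exact mul_le_mul (hC _) (hdiff _ _) (abs_nonneg _) hC0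
  have i2 : Integrable (fun p : (ι → α) × (ι → α) => f (({k} : Finset ι).piecewise p.2 p.1) *
      (f ((insert k S).piecewise p.2 p.1) - f (S.piecewise p.2 p.1))) m := by
    refine integrable_of_bdd ((mS _).mul ((mS _).sub (mS S))) (C * (2 * C)) fun p => ?_
    rw [Real.norm_eq_abs, abs_mul]
    exact mul_le_mul (hC _) (hdiff _ _) (abs_nonneg _) hC0
  have i3 : Integrable (fun p : (ι → α) × (ι → α) =>
      (f p.1 - f (Function.update p.1 k (p.2 k))) ^ 2) m := by
    refine integrable_of_bdd ?_ ((2 * C) ^ 2) fun p => ?_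
    · simp only [hu]; exact (m1.sub (mS {k})).pow_const 2
    · rw [norm_pow, Real.norm_eq_abs]
      exact pow_le_pow_left₀ (abs_nonneg _) (hdiff _ _) 2
  have i4 : Integrable (fun p : (ι → α) × (ι → α) =>
      (f (S.piecewise p.2 p.1) - f ((insert k S).piecewise p.2 p.1)) ^ 2) m := by
    refine integrable_of_bdd (((mS S).sub (mS _)).pow_const 2) ((2 * C) ^ 2) fun p => ?_
    rw [norm_pow, Real.norm_eq_abs]
    exact pow_le_pow_left₀ (abs_nonneg _) (hdiff _ _) 2
  -- Average the two expressions for `T` and for `V` and apply `a b ≤ (a² + b²) / 2`.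
  have e3 : T + T ≤ 2⁻¹ * V + 2⁻¹ * V := by
    conv_lhs => rw [hT]; rhs; rw [← hT, e1]
    conv_rhs => rhs; rw [e2]
    rw [← integral_add i1 i2, hV, ← integral_const_mul, ← integral_const_mul,
      ← integral_add (i3.const_mul _) (i4.const_mul _)]
    refine integral_mono (i1.add i2) ((i3.const_mul _).add (i4.const_mul _)) fun p => ?_
    simp only [hu]
    nlinarith [sq_nonneg ((f p.1 - f (({k} : Finset ι).piecewise p.2 p.1)) -
      (f (S.piecewise p.2 p.1) - f ((insert k S).piecewise p.2 p.1)))]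
  linarith

/-- The **Efron–Stein inequality** for bounded functions: the coordinates are resampled one
after the other, and the covariances of `f` with the increments telescope to its variance. -/
lemma efron_stein {f : (ι → α) → ℝ} (hf : Measurable f) {C : ℝ} (hC : ∀ x, |f x| ≤ C) :
    ∫ x, f x ^ 2 ∂(Measure.pi ν) - (∫ x, f x ∂(Measure.pi ν)) ^ 2 ≤
      2⁻¹ * ∑ k, ∫ p, (f p.1 - f (Function.update p.1 k (p.2 k))) ^ 2
        ∂((Measure.pi ν).prod (Measure.pi ν)) := by
  set m := (Measure.pi ν).prod (Measure.pi ν)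
  have m1 : Measurable fun p : (ι → α) × (ι → α) => f p.1 := hf.comp measurable_fst
  have mS : ∀ S : Finset ι, Measurable fun p : (ι → α) × (ι → α) => f (S.piecewise p.2 p.1) :=
    fun S => hf.comp (measurable_piecewise S)
  have hint : ∀ S : Finset ι, Integrable (fun p : (ι → α) × (ι → α) =>
      f p.1 * f (S.piecewise p.2 p.1)) m := fun S => by
    refine integrable_of_bdd (m1.mul (mS S)) (C * C) fun p => ?_
    rw [Real.norm_eq_abs, abs_mul]
    exact mul_le_mul (hC _) (hC _) (abs_nonneg _) ((abs_nonneg _).trans (hC p.1))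
  have key : ∀ S : Finset ι, ∫ p, f p.1 * f ((∅ : Finset ι).piecewise p.2 p.1) ∂m -
      ∫ p, f p.1 * f (S.piecewise p.2 p.1) ∂m ≤
      2⁻¹ * ∑ k ∈ S, ∫ p, (f p.1 - f (Function.update p.1 k (p.2 k))) ^ 2 ∂m := by
    intro S
    induction S using Finset.induction_on with
    | empty => simp
    | insert k S hk ih =>
      have h1 := covariance_resample_le (ν := ν) hf hC hk
      simp only [mul_sub] at h1
      rw [integral_sub (hint S) (hint _)] at h1
      rw [Finset.sum_insert hk, mul_add]
      linarith
  have h := key Finset.univ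
  simp only [Finset.piecewise_empty, Finset.piecewise_univ] at h
  rw [integral_prod_mul] at h
  have e : ∫ p, f p.1 * f p.1 ∂m = ∫ x, f x ^ 2 ∂(Measure.pi ν) := by
    have := integral_fun_fst (μ := Measure.pi ν) (ν := Measure.pi ν) (fun x => f x ^ 2)
    simp only [probReal_univ, one_smul] at this
    rw [← this]
    simp only [sq]
    rfl
  rw [e] at h
  rw [sq (∫ x, f x ∂(Measure.pi ν))]
  exact h

lemma sq_pow_sub_pow_le (a b : ℝ) (q : ℕ) :
    (a ^ q - b ^ q) ^ 2 ≤
      (q : ℝ) ^ 2 * ((a - b) ^ 2 * (a ^ 2) ^ (q - 1) + (a - b) ^ 2 * (b ^ 2) ^ (q - 1)) := by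
  have h := abs_pow_sub_pow_le a b q
  have h2 : (a ^ q - b ^ q) ^ 2 ≤ (|a - b| * q * max |a| |b| ^ (q - 1)) ^ 2 := by
    rw [← sq_abs (a ^ q - b ^ q)]
    exact pow_le_pow_left₀ (abs_nonneg _) h 2
  refine h2.trans ?_
  have h3 : (max |a| |b| ^ (q - 1)) ^ 2 ≤ (a ^ 2) ^ (q - 1) + (b ^ 2) ^ (q - 1) := by
    rw [← pow_mul, mul_comm, pow_mul]
    rcases le_total |a| |b| with h | h
    · rw [max_eq_right h, sq_abs]
      have : 0 ≤ (a ^ 2) ^ (q - 1) := by positivity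
      linarith
    · rw [max_eq_left h, sq_abs]
      have : 0 ≤ (b ^ 2) ^ (q - 1) := by positivity
      linarith
  calc (|a - b| * q * max |a| |b| ^ (q - 1)) ^ 2
      = (q : ℝ) ^ 2 * ((a - b) ^ 2 * (max |a| |b| ^ (q - 1)) ^ 2) := by
        rw [mul_pow, mul_pow, sq_abs]; ring
    _ ≤ (q : ℝ) ^ 2 * ((a - b) ^ 2 * ((a ^ 2) ^ (q - 1) + (b ^ 2) ^ (q - 1))) := by gcongr
    _ = _ := by ring

/-- The Efron–Stein inequality applied to a power: if the squared increments of `Y` sum up to at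
most `V` pointwise, then `Var(Y^q) ≤ q² V E Y^{2q-2}`. -/
lemma moment_step {Y : (ι → α) → ℝ} (hY : Measurable Y) {C : ℝ} (hC : ∀ x, |Y x| ≤ C) {V : ℝ}
    (hV : ∀ x x' : ι → α, ∑ k, (Y x - Y (Function.update x k (x' k))) ^ 2 ≤ V) (q : ℕ) :
    ∫ x, (Y x ^ q) ^ 2 ∂(Measure.pi ν) ≤ (∫ x, Y x ^ q ∂(Measure.pi ν)) ^ 2 +
      (q : ℝ) ^ 2 * (V * ∫ x, (Y x ^ 2) ^ (q - 1) ∂(Measure.pi ν)) := by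
  set m := (Measure.pi ν).prod (Measure.pi ν)
  have hes := efron_stein (ν := ν) (hY.pow_const q) (C := C ^ q) (fun x => by
    rw [abs_pow]; exact pow_le_pow_left₀ (abs_nonneg _) (hC x) q)
  have hu : ∀ (k : ι) (p : (ι → α) × (ι → α)),
      Function.update p.1 k (p.2 k) = (swapOn {k} p).1 := fun k p =>
    (Finset.piecewise_singleton p.2 p.1 k).symm
  have m1 : Measurable fun p : (ι → α) × (ι → α) => Y p.1 := hY.comp measurable_fst
  have m2 : ∀ k, Measurable fun p : (ι → α) × (ι → α) => Y (Function.update p.1 k (p.2 k)) := by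
    intro k
    simp only [hu]
    exact hY.comp (measurable_fst.comp (measurePreserving_swapOn ν {k}).measurable)
  have hdiff : ∀ x y : ι → α, |Y x - Y y| ≤ 2 * C := fun x y =>
    (abs_sub _ _).trans (by linarith [hC x, hC y])
  have mA : ∀ k, Measurable fun p : (ι → α) × (ι → α) =>
      (Y p.1 - Y (Function.update p.1 k (p.2 k))) ^ 2 * (Y p.1 ^ 2) ^ (q - 1) := fun k =>
    ((m1.sub (m2 k)).pow_const 2).mul ((m1.pow_const 2).pow_const _)
  have hsq : ∀ x, Y x ^ 2 ≤ C ^ 2 := fun x => by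
    rw [← sq_abs]; exact pow_le_pow_left₀ (abs_nonneg _) (hC x) 2
  have iA : ∀ k, Integrable (fun p : (ι → α) × (ι → α) =>
      (Y p.1 - Y (Function.update p.1 k (p.2 k))) ^ 2 * (Y p.1 ^ 2) ^ (q - 1)) m := fun k => by
    refine integrable_of_bdd (mA k) ((2 * C) ^ 2 * (C ^ 2) ^ (q - 1)) fun p => ?_
    rw [Real.norm_eq_abs, abs_mul, abs_pow, abs_pow, abs_pow, sq_abs (Y p.1)]
    exact mul_le_mul (pow_le_pow_left₀ (abs_nonneg _) (hdiff _ _) 2)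
      (pow_le_pow_left₀ (sq_nonneg _) (hsq _) _) (by positivity) (by positivity)
  -- exchanging the `k`-th coordinates turns the power at the resampled point into the one at
  -- the original point
  have eB : ∀ k, ∫ p, (Y p.1 - Y (Function.update p.1 k (p.2 k))) ^ 2 *
      (Y (Function.update p.1 k (p.2 k)) ^ 2) ^ (q - 1) ∂m =
      ∫ p, (Y p.1 - Y (Function.update p.1 k (p.2 k))) ^ 2 * (Y p.1 ^ 2) ^ (q - 1) ∂m := by
    intro k
    rw [← integral_swapOn {k} _ (mA k)]
    refine integral_congr_ae (Eventually.of_forall fun p => ?_)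
    have a1 : Function.update (swapOn {k} p).1 k ((swapOn {k} p).2 k) = p.1 := by
      ext i
      by_cases hi : i = k
      · subst hi; simp [swapOn]
      · simp [swapOn, hi]
    simp only [a1, hu]
    rw [sub_sq_comm]
  have iB : ∀ k, Integrable (fun p : (ι → α) × (ι → α) =>
      (Y p.1 - Y (Function.update p.1 k (p.2 k))) ^ 2 *
      (Y (Function.update p.1 k (p.2 k)) ^ 2) ^ (q - 1)) m := fun k => by
    refine integrable_of_bdd (((m1.sub (m2 k)).pow_const 2).mul (((m2 k).pow_const 2).pow_const _))
      ((2 * C) ^ 2 * (C ^ 2) ^ (q - 1)) fun p => ?_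
    rw [Real.norm_eq_abs, abs_mul, abs_pow, abs_pow, abs_pow, sq_abs (Y _)]
    exact mul_le_mul (pow_le_pow_left₀ (abs_nonneg _) (hdiff _ _) 2)
      (pow_le_pow_left₀ (sq_nonneg _) (hsq _) _) (by positivity) (by positivity)
  have hstep : ∀ k, ∫ p, (Y p.1 ^ q - Y (Function.update p.1 k (p.2 k)) ^ q) ^ 2 ∂m ≤
      (q : ℝ) ^ 2 * (2 * ∫ p, (Y p.1 - Y (Function.update p.1 k (p.2 k))) ^ 2 *
        (Y p.1 ^ 2) ^ (q - 1) ∂m) := by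
    intro k
    have e : 2 * ∫ p, (Y p.1 - Y (Function.update p.1 k (p.2 k))) ^ 2 * (Y p.1 ^ 2) ^ (q - 1) ∂m =
        ∫ p, (Y p.1 - Y (Function.update p.1 k (p.2 k))) ^ 2 * (Y p.1 ^ 2) ^ (q - 1) +
          (Y p.1 - Y (Function.update p.1 k (p.2 k))) ^ 2 *
          (Y (Function.update p.1 k (p.2 k)) ^ 2) ^ (q - 1) ∂m := by
      rw [integral_add (iA k) (iB k), eB k]; ring
    rw [e, ← integral_const_mul]
    refine integral_mono ?_ (((iA k).add (iB k)).const_mul _) fun p => sq_pow_sub_pow_le _ _ q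
    refine integrable_of_bdd (((m1.pow_const q).sub ((m2 k).pow_const q)).pow_const 2)
      ((2 * C ^ q) ^ 2) fun p => ?_
    rw [norm_pow, Real.norm_eq_abs]
    refine pow_le_pow_left₀ (abs_nonneg _) ((abs_sub _ _).trans ?_) 2
    rw [abs_pow, abs_pow]
    have a := pow_le_pow_left₀ (abs_nonneg _) (hC p.1) q
    have b := pow_le_pow_left₀ (abs_nonneg _) (hC (Function.update p.1 k (p.2 k))) q
    linarith
  have hsum : ∑ k, ∫ p, (Y p.1 - Y (Function.update p.1 k (p.2 k))) ^ 2 *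
      (Y p.1 ^ 2) ^ (q - 1) ∂m ≤ V * ∫ x, (Y x ^ 2) ^ (q - 1) ∂(Measure.pi ν) := by
    rw [← integral_finsetSum _ fun k _ => iA k]
    have e : ∫ x, (Y x ^ 2) ^ (q - 1) ∂(Measure.pi ν) = ∫ p, (Y p.1 ^ 2) ^ (q - 1) ∂m := by
      have := integral_fun_fst (μ := Measure.pi ν) (ν := Measure.pi ν)
        (fun x => (Y x ^ 2) ^ (q - 1))
      simp only [probReal_univ, one_smul] at this
      exact this.symm
    rw [e, ← integral_const_mul]
    refine integral_mono (integrable_finsetSum _ fun k _ => iA k) ?_ fun p => ?_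
    · refine Integrable.const_mul (integrable_of_bdd ((m1.pow_const 2).pow_const _)
        ((C ^ 2) ^ (q - 1)) fun p => ?_) _
      rw [Real.norm_eq_abs, abs_pow, abs_pow, sq_abs]
      exact pow_le_pow_left₀ (sq_nonneg _) (hsq _) _
    · simp only
      rw [← Finset.sum_mul]
      exact mul_le_mul_of_nonneg_right (hV p.1 p.2) (by positivity)
  have hfin := Finset.sum_le_sum fun k (_ : k ∈ Finset.univ) => hstep k
  rw [← Finset.mul_sum, ← Finset.mul_sum] at hfin
  have h4 : (q : ℝ) ^ 2 * (2 * ∑ k, ∫ p, (Y p.1 - Y (Function.update p.1 k (p.2 k))) ^ 2 *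
      (Y p.1 ^ 2) ^ (q - 1) ∂m) ≤ (q : ℝ) ^ 2 * (2 * (V * ∫ x, (Y x ^ 2) ^ (q - 1)
        ∂(Measure.pi ν))) := by gcongr
  linarith

/-- The constants in the dyadic moment bounds. -/
def momentConst : ℕ → ℝ
  | 0 => 1
  | j + 1 => 2 * momentConst j ^ 2 + (2 * (2 ^ (j + 1) : ℝ) ^ 2) ^ (2 ^ (j + 1))

lemma momentConst_nonneg (j : ℕ) : 0 ≤ momentConst j := by
  cases j <;> unfold momentConst <;> positivity

/-- All dyadic moments of a centered function are controlled by a pointwise bound on its summed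
squared increments. -/
lemma dyadic_moment_le {Y : (ι → α) → ℝ} (hY : Measurable Y) {C : ℝ} (hC : ∀ x, |Y x| ≤ C) {V : ℝ}
    (hV0 : 0 ≤ V) (hV : ∀ x x' : ι → α, ∑ k, (Y x - Y (Function.update x k (x' k))) ^ 2 ≤ V)
    (hmean : ∫ x, Y x ∂(Measure.pi ν) = 0) (j : ℕ) :
    ∫ x, Y x ^ (2 ^ (j + 1)) ∂(Measure.pi ν) ≤ momentConst j * V ^ (2 ^ j) := by
  induction j with
  | zero =>
    have h := moment_step (ν := ν) hY hC hV 1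
    simp only [pow_one, hmean] at h
    simpa [momentConst] using h
  | succ j ih =>
    set q : ℕ := 2 ^ (j + 1) with hq
    have hq1 : 1 ≤ q := Nat.one_le_two_pow
    have h := moment_step (ν := ν) hY hC hV q
    have hsq : ∀ x, Y x ^ 2 ≤ C ^ 2 := fun x => by
      rw [← sq_abs]; exact pow_le_pow_left₀ (abs_nonneg _) (hC x) 2
    have iq : ∀ n : ℕ, Integrable (fun x => (Y x ^ 2) ^ n) (Measure.pi ν) := fun n => by
      refine integrable_of_bdd ((hY.pow_const 2).pow_const _) ((C ^ 2) ^ n) fun x => ?_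
      rw [Real.norm_eq_abs, abs_pow, abs_pow, sq_abs]
      exact pow_le_pow_left₀ (sq_nonneg _) (hsq _) _
    set b : ℝ := 2 * (q : ℝ) ^ 2 * V with hb
    have hb0 : 0 ≤ b := by positivity
    -- a crude form of Young's inequality
    have hyoung : ∀ a : ℝ, 0 ≤ a → b * a ^ (q - 1) ≤ a ^ q + b ^ q := by
      intro a ha
      have e : q = (q - 1) + 1 := by omega
      rcases le_total b a with hab | hab
      · have : b * a ^ (q - 1) ≤ a ^ q := by
          conv_rhs => rw [e, pow_succ, mul_comm]
          gcongr
        have : 0 ≤ b ^ q := by positivity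
        linarith
      · have : b * a ^ (q - 1) ≤ b ^ q := by
          conv_rhs => rw [e, pow_succ, mul_comm]
          gcongr
        have : 0 ≤ a ^ q := by positivity
        linarith
    have h2 : b * ∫ x, (Y x ^ 2) ^ (q - 1) ∂(Measure.pi ν) ≤
        ∫ x, (Y x ^ 2) ^ q ∂(Measure.pi ν) + b ^ q := by
      have e : ∫ x, ((Y x ^ 2) ^ q + b ^ q) ∂(Measure.pi ν) =
          ∫ x, (Y x ^ 2) ^ q ∂(Measure.pi ν) + b ^ q := by
        rw [integral_add (iq q) (integrable_const _)]; simp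
      rw [← e, ← integral_const_mul]
      exact integral_mono ((iq _).const_mul _) ((iq q).add (integrable_const _))
        fun x => hyoung _ (sq_nonneg _)
    have e1 : ∫ x, (Y x ^ q) ^ 2 ∂(Measure.pi ν) = ∫ x, (Y x ^ 2) ^ q ∂(Measure.pi ν) := by
      congr 1; ext x; rw [← pow_mul, ← pow_mul, mul_comm]
    have e2 : ∫ x, Y x ^ (2 ^ (j + 1 + 1)) ∂(Measure.pi ν) =
        ∫ x, (Y x ^ 2) ^ q ∂(Measure.pi ν) := by
      congr 1; ext x; rw [← pow_mul, hq]; congr 1; ring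
    have h0 : 0 ≤ ∫ x, Y x ^ q ∂(Measure.pi ν) := by
      refine integral_nonneg fun x => ?_
      have : q = 2 * 2 ^ j := by rw [hq]; ring
      rw [this, pow_mul]; positivity
    have h3 : (∫ x, Y x ^ q ∂(Measure.pi ν)) ^ 2 ≤ (momentConst j * V ^ (2 ^ j)) ^ 2 :=
      pow_le_pow_left₀ h0 ih 2
    have h4 : (momentConst j * V ^ (2 ^ j)) ^ 2 = momentConst j ^ 2 * V ^ q := by
      rw [mul_pow, ← pow_mul, hq, pow_succ 2 j]
    have h5 : b ^ q = (2 * (q : ℝ) ^ 2) ^ q * V ^ q := by rw [hb, mul_pow]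
    have h6 : momentConst (j + 1) = 2 * momentConst j ^ 2 + (2 * (q : ℝ) ^ 2) ^ q := by
      rw [hq]; push_cast; rfl
    rw [e2, h6, add_mul]
    rw [e1] at h
    nlinarith

/-- Concentration of a bounded function around its mean. -/
lemma concentration {f : (ι → α) → ℝ} (hf : Measurable f) {C : ℝ} (hC : ∀ x, |f x| ≤ C) {V : ℝ}
    (hV0 : 0 ≤ V) (hV : ∀ x x' : ι → α, ∑ k, (f x - f (Function.update x k (x' k))) ^ 2 ≤ V)
    (j : ℕ) {t : ℝ} (ht : 0 < t) :
    Measure.pi ν {x | t ≤ |f x - ∫ y, f y ∂(Measure.pi ν)|} ≤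
      ENNReal.ofReal (momentConst j * (V / t ^ 2) ^ (2 ^ j)) := by
  set e := ∫ y, f y ∂(Measure.pi ν) with he
  set Y : (ι → α) → ℝ := fun x => f x - e with hYdef
  have hif : Integrable f (Measure.pi ν) := integrable_of_bdd hf C hC
  have hY : Measurable Y := hf.sub measurable_const
  have hYC : ∀ x, |Y x| ≤ C + |e| := fun x => (abs_sub _ _).trans (by linarith [hC x])
  have hmean : ∫ x, Y x ∂(Measure.pi ν) = 0 := by
    rw [hYdef, integral_sub hif (integrable_const _)]; simp [he]
  have h := dyadic_moment_le (ν := ν) hY hYC hV0 (fun x x' => by simpa [hYdef] using hV x x') hmean j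
  set n : ℕ := 2 ^ (j + 1) with hn
  have hev : ∀ x, 0 ≤ Y x ^ n := fun x => by
    have : n = 2 * 2 ^ j := by rw [hn]; ring
    rw [this, pow_mul]; positivity
  have hint : Integrable (fun x => Y x ^ n) (Measure.pi ν) :=
    integrable_of_bdd (hY.pow_const n) ((C + |e|) ^ n) fun x => by
      rw [Real.norm_eq_abs, abs_pow]; exact pow_le_pow_left₀ (abs_nonneg _) (hYC x) n
  -- Markov's inequality for the moment of order `2 ^ (j + 1)`
  have hm := mul_meas_ge_le_integral_of_nonneg (Eventually.of_forall hev) hint (t ^ n)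
  have hsub : {x | t ≤ |f x - e|} ⊆ {x | t ^ n ≤ Y x ^ n} := fun x hx => by
    have : Y x ^ n = |Y x| ^ n := by
      have h2 : n = 2 * 2 ^ j := by rw [hn]; ring
      rw [h2, pow_mul, pow_mul, sq_abs]
    show t ^ n ≤ Y x ^ n
    rw [this]
    exact pow_le_pow_left₀ ht.le hx n
  refine (measure_mono hsub).trans ?_
  rw [ENNReal.le_ofReal_iff_toReal_le (measure_ne_top _ _) (by
    have := momentConst_nonneg j
    positivity)]
  have htn : 0 < t ^ n := by positivity
  have h2 : t ^ n = (t ^ 2) ^ (2 ^ j) := by rw [← pow_mul, hn]; congr 1; ring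
  rw [div_pow, ← mul_div_assoc, ← h2, le_div_iff₀ htn, mul_comm]
  exact hm.trans h

end Resampling

end TwoResolvent
end

noncomputable section
namespace TwoResolvent

variable {N : ℕ}

/-! ### Weighted walks -/

/-- The positions on and above the diagonal, which index the independent entries. -/
abbrev Idx (N : ℕ) : Type := {p : Fin N × Fin N // p.1 ≤ p.2}

/-- The position on or above the diagonal that belongs to an unordered pair. -/
def idx (i j : Fin N) : Idx N := ⟨(min i j, max i j), min_le_max⟩

lemma idx_comm (i j : Fin N) : idx i j = idx j i := by
  unfold idx; simp only [min_comm, max_comm]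

lemma idx_eq_iff {i j k l : Fin N} : idx i j = idx k l ↔ (i = k ∧ j = l) ∨ (i = l ∧ j = k) := by
  unfold idx
  simp only [Subtype.mk.injEq, Prod.mk.injEq, Fin.ext_iff, Fin.coe_min, Fin.coe_max]
  omega

/-- The number of edges at `x` that are traversed exactly once, for the traversal counts `n`. -/
def openDeg (n : Idx N → ℕ) (x : Fin N) : ℕ :=
  ∑ y ∈ Finset.univ.erase x, if n (idx x y) = 1 then 1 else 0

/-- The potential of a walk with traversal counts `n` that currently sits at `c`. A step along an
edge that was traversed exactly once lowers it if there was more than one such edge to choose from,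
and only steps to an already visited vertex that are not of this type can raise it. -/
def pot (n : Idx N → ℕ) (c : Fin N) : ℕ :=
  (openDeg n c - 1) + ∑ x ∈ Finset.univ.erase c, (openDeg n x - 2)

/-- The end points of the edges that the walk has traversed; loops do not count. -/
def visited (n : Idx N → ℕ) : Finset (Fin N) := {x | ∃ y, y ≠ x ∧ n (idx x y) ≠ 0}

/-- One more traversal of the edge `p`. -/
def bump (n : Idx N → ℕ) (p : Idx N) : Idx N → ℕ := Function.update n p (n p + 1)

lemma bump_self (n : Idx N → ℕ) (p : Idx N) : bump n p p = n p + 1 := by simp [bump]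

lemma bump_of_ne (n : Idx N → ℕ) {p q : Idx N} (h : q ≠ p) : bump n p q = n q := by simp [bump, h]

/-- The traversal of an edge by the walk at its end point `c`: an edge that was traversed
exactly once is lost, and a new edge is gained. -/
lemma openDeg_bump (n : Idx N → ℕ) {c y : Fin N} (h : y ≠ c) :
    openDeg (bump n (idx c y)) c + (if n (idx c y) = 1 then 1 else 0) =
      openDeg n c + (if n (idx c y) = 0 then 1 else 0) := by
  unfold openDeg
  have hm : y ∈ Finset.univ.erase c := by simp [h]
  rw [← Finset.add_sum_erase _ _ hm, ← Finset.add_sum_erase _ (fun y => if n (idx c y) = 1 then 1 else 0) hm,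
    bump_self]
  have : ∑ x ∈ (Finset.univ.erase c).erase y, (if bump n (idx c y) (idx c x) = 1 then 1 else 0) =
      ∑ x ∈ (Finset.univ.erase c).erase y, (if n (idx c x) = 1 then 1 else 0) := by
    refine Finset.sum_congr rfl fun x hx => ?_
    rw [bump_of_ne]
    simp only [Finset.mem_erase] at hx
    rw [Ne, idx_eq_iff]
    rintro (⟨-, h2⟩ | ⟨h1, h2⟩)
    · exact hx.1 h2
    · exact h h1.symm
  rw [this]
  simp only [Nat.add_eq_right]
  ring

lemma openDeg_bump_of_ne (n : Idx N → ℕ) {c y x : Fin N} (hc : x ≠ c) (hy : x ≠ y) :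
    openDeg (bump n (idx c y)) x = openDeg n x := by
  unfold openDeg
  refine Finset.sum_congr rfl fun z _ => ?_
  rw [bump_of_ne]
  rw [Ne, idx_eq_iff]
  rintro (⟨h1, -⟩ | ⟨h1, -⟩)
  · exact hc h1
  · exact hy h1

lemma openDeg_le_card_visited (n : Idx N → ℕ) (x : Fin N) : openDeg n x ≤ (visited n).card := by
  unfold openDeg
  rw [← Finset.card_filter]
  refine Finset.card_le_card fun y hy => ?_
  simp only [Finset.mem_filter, Finset.mem_erase, Finset.mem_univ, and_true] at hy
  simp only [visited, Finset.mem_filter, Finset.mem_univ, true_and]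
  exact ⟨x, hy.1.symm, by rw [idx_comm, hy.2]; exact one_ne_zero⟩

lemma openDeg_eq_zero (n : Idx N → ℕ) {x : Fin N} (h : x ∉ visited n) : openDeg n x = 0 := by
  simp only [visited, Finset.mem_filter, Finset.mem_univ, true_and, not_exists, not_and,
    not_not] at h
  unfold openDeg
  refine Finset.sum_eq_zero fun y hy => ?_
  rw [h y (Finset.ne_of_mem_erase hy)]
  simp

/-- The change of the potential in one step, according to how often the edge was traversed
before: never, once, or more often. -/
lemma pot_bump (n : Idx N → ℕ) {c y : Fin N} (h : y ≠ c) :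
    (n (idx c y) = 0 → pot (bump n (idx c y)) y ≤ pot n c + 2 ∧
      (y ∉ visited n → pot (bump n (idx c y)) y ≤ pot n c)) ∧
    (n (idx c y) = 1 → pot (bump n (idx c y)) y ≤ pot n c ∧
      (2 ≤ openDeg n c → pot (bump n (idx c y)) y + 1 ≤ pot n c)) ∧
    (2 ≤ n (idx c y) → pot (bump n (idx c y)) y ≤ pot n c + 1) := by
  have h1 := openDeg_bump n h
  have h2 := openDeg_bump n (c := y) (y := c) h.symm
  rw [idx_comm y c] at h2
  have hR : ∑ x ∈ (Finset.univ.erase y).erase c, (openDeg (bump n (idx c y)) x - 2) =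
      ∑ x ∈ (Finset.univ.erase c).erase y, (openDeg n x - 2) := by
    rw [Finset.erase_right_comm]
    refine Finset.sum_congr rfl fun x hx => ?_
    simp only [Finset.mem_erase] at hx
    rw [openDeg_bump_of_ne n hx.2.1 hx.1]
  -- Only the terms of the two end points change, so split them off from both potentials.
  have e1 : pot (bump n (idx c y)) y = (openDeg (bump n (idx c y)) y - 1) +
      ((openDeg (bump n (idx c y)) c - 2) +
        ∑ x ∈ (Finset.univ.erase c).erase y, (openDeg n x - 2)) := by
    unfold pot
    rw [← Finset.add_sum_erase _ _ (show c ∈ Finset.univ.erase y by simp [h.symm]), hR]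
  have e2 : pot n c = (openDeg n c - 1) + ((openDeg n y - 2) +
        ∑ x ∈ (Finset.univ.erase c).erase y, (openDeg n x - 2)) := by
    unfold pot
    rw [← Finset.add_sum_erase _ _ (show y ∈ Finset.univ.erase c by simp [h])]
  have hz := openDeg_eq_zero n (x := y)
  refine ⟨fun h0 => ⟨?_, fun hv => ?_⟩, fun h0 => ⟨?_, fun hv => ?_⟩, fun h0 => ?_⟩
  · simp only [h0] at h1 h2
    simp at h1 h2
    omega
  · have := hz hv
    simp only [h0] at h1 h2
    simp at h1 h2
    omega
  · simp only [h0] at h1 h2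
    simp at h1 h2
    omega
  · simp only [h0] at h1 h2
    simp at h1 h2
    omega
  · rw [if_neg (by omega), if_neg (by omega)] at h1 h2
    omega

/-- The bound for the joint moment of an entry of size at most `β` and variance at most `N⁻¹`
that enters with multiplicity `k`. -/
def edgeWeight (N : ℕ) (β : ℝ) : ℕ → ℝ
  | 0 => 1
  | 1 => (N : ℝ)⁻¹
  | k + 2 => (N : ℝ)⁻¹ * β ^ k

/-- The factor by which the weight of an edge changes when it is traversed once more. -/
def stepWeight (N : ℕ) (β : ℝ) : ℕ → ℝ
  | 0 => (N : ℝ)⁻¹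
  | 1 => 1
  | _ + 2 => β

lemma edgeWeight_succ (β : ℝ) (k : ℕ) :
    edgeWeight N β (k + 1) = edgeWeight N β k * stepWeight N β k := by
  match k with
  | 0 => simp [edgeWeight, stepWeight]
  | 1 => simp [edgeWeight, stepWeight]
  | k + 2 => simp [edgeWeight, stepWeight, pow_succ, mul_assoc]

/-- The weight of a walk with traversal counts `n`. -/
def walkWeight (β : ℝ) (n : Idx N → ℕ) : ℝ := ∏ p, edgeWeight N β (n p)

lemma edgeWeight_nonneg {β : ℝ} (hβ : 0 ≤ β) (k : ℕ) : 0 ≤ edgeWeight N β k := by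
  match k with
  | 0 => simp [edgeWeight]
  | 1 => simp [edgeWeight]
  | k + 2 => simp only [edgeWeight]; positivity

lemma walkWeight_nonneg {β : ℝ} (hβ : 0 ≤ β) (n : Idx N → ℕ) : 0 ≤ walkWeight β n :=
  Finset.prod_nonneg fun _ _ => edgeWeight_nonneg hβ _

lemma walkWeight_bump (β : ℝ) (n : Idx N → ℕ) (p : Idx N) :
    walkWeight β (bump n p) = walkWeight β n * stepWeight N β (n p) := by
  unfold walkWeight
  rw [← Finset.mul_prod_erase _ _ (Finset.mem_univ p),
    ← Finset.mul_prod_erase _ (fun q => edgeWeight N β (n q)) (Finset.mem_univ p), bump_self,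
    edgeWeight_succ]
  have : ∏ x ∈ Finset.univ.erase p, edgeWeight N β (bump n p x) =
      ∏ x ∈ Finset.univ.erase p, edgeWeight N β (n x) :=
    Finset.prod_congr rfl fun q hq => by rw [bump_of_ne n (Finset.ne_of_mem_erase hq)]
  rw [this]; ring

/-- The total weight of the continuations by `r` steps of a walk with traversal counts `n` that
sits at `c`. -/
def walkSum (β : ℝ) : ℕ → (Idx N → ℕ) → Fin N → ℝ
  | 0, n, _ => walkWeight β n
  | r + 1, n, c => ∑ y ∈ Finset.univ.erase c, walkSum β r (bump n (idx c y)) y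

/-- One step of a walk: the summand `2` comes from the step to a new vertex and the step along the
unique edge that was traversed exactly once. All other steps are of lower order, the potential
paying for the choice between several edges that were traversed exactly once. -/
lemma sum_step_le {β : ℝ} (hβ : 0 ≤ β) {K : ℕ} (hK : 1 ≤ K) (n : Idx N → ℕ) (c : Fin N)
    (hv : (visited n).card ≤ K) :
    ∑ y ∈ Finset.univ.erase c, walkWeight β (bump n (idx c y)) *
        (K : ℝ) ^ pot (bump n (idx c y)) y ≤
      (2 + (K : ℝ) ^ 3 / N + (K : ℝ) ^ 2 * β) * (walkWeight β n * (K : ℝ) ^ pot n c) := by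
  have hN : 0 < N := c.pos
  have hN' : (0 : ℝ) < N := by exact_mod_cast hN
  have hK1 : (1 : ℝ) ≤ K := by exact_mod_cast hK
  have hK0 : (0 : ℝ) < K := by linarith
  -- the loss of potential on a step along one of several edges that were traversed exactly once
  set s1 : ℝ := if openDeg n c ≤ 1 then 1 else (K : ℝ)⁻¹ with hs1
  have hs1n : 0 ≤ s1 := by rw [hs1]; split_ifs <;> positivity
  set G : ℝ := (K : ℝ) ^ pot n c with hG
  have hG0 : 0 < G := by positivity
  have hterm : ∀ y ∈ Finset.univ.erase c, stepWeight N β (n (idx c y)) *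
      (K : ℝ) ^ pot (bump n (idx c y)) y ≤ ((N : ℝ)⁻¹ +
        (if y ∈ visited n then (K : ℝ) ^ 2 / N + K * β else 0) +
        s1 * (if n (idx c y) = 1 then 1 else 0)) * G := by
    intro y hy
    have hyc := Finset.ne_of_mem_erase hy
    obtain ⟨p0, p1, p2⟩ := pot_bump n hyc
    have hmem : n (idx c y) ≠ 0 → y ∈ visited n := fun h => by
      simp only [visited, Finset.mem_filter, Finset.mem_univ, true_and]
      exact ⟨c, hyc.symm, by rwa [idx_comm]⟩
    have hvn : 0 ≤ if y ∈ visited n then (K : ℝ) ^ 2 / N + K * β else 0 := by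
      split_ifs <;> positivity
    have hNi : 0 ≤ (N : ℝ)⁻¹ := by positivity
    match hk : n (idx c y) with
    -- a new edge, to a visited or to a new vertex
    | 0 =>
      obtain ⟨q1, q2⟩ := p0 hk
      simp only [stepWeight]
      by_cases hyv : y ∈ visited n
      · have : (K : ℝ) ^ pot (bump n (idx c y)) y ≤ G * K ^ 2 := by
          rw [hG, ← pow_add]; exact pow_le_pow_right₀ hK1 q1
        rw [if_pos hyv]
        calc (N : ℝ)⁻¹ * (K : ℝ) ^ pot (bump n (idx c y)) y ≤ (N : ℝ)⁻¹ * (G * K ^ 2) := by gcongr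
          _ = ((K : ℝ) ^ 2 / N) * G := by field_simp
          _ ≤ _ := by
            apply mul_le_mul_of_nonneg_right _ hG0.le
            have : 0 ≤ K * β := by positivity
            simp
            linarith
      · have : (K : ℝ) ^ pot (bump n (idx c y)) y ≤ G := pow_le_pow_right₀ hK1 (q2 hyv)
        rw [if_neg hyv]
        simp only [zero_ne_one, if_false, mul_zero, add_zero]
        gcongr
    -- an edge that was traversed exactly once
    | 1 =>
      obtain ⟨q1, q2⟩ := p1 hk
      simp only [stepWeight, one_mul, if_true, mul_one]
      have : (K : ℝ) ^ pot (bump n (idx c y)) y ≤ s1 * G := by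
        by_cases hd : openDeg n c ≤ 1
        · rw [hs1, if_pos hd, one_mul]; exact pow_le_pow_right₀ hK1 q1
        · rw [hs1, if_neg hd, le_inv_mul_iff₀ hK0, ← pow_succ']
          exact pow_le_pow_right₀ hK1 (q2 (by omega))
      nlinarith [mul_nonneg (add_nonneg hNi hvn) hG0.le]
    -- an edge that was traversed more often
    | k + 2 =>
      have q1 := p2 (by omega)
      have hyv := hmem (by omega)
      rw [if_pos hyv]
      simp only [stepWeight]
      have : (K : ℝ) ^ pot (bump n (idx c y)) y ≤ G * K := by
        rw [hG, ← pow_succ]; exact pow_le_pow_right₀ hK1 q1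
      calc β * (K : ℝ) ^ pot (bump n (idx c y)) y ≤ β * (G * K) := by gcongr
        _ = (K * β) * G := by ring
        _ ≤ _ := by
          apply mul_le_mul_of_nonneg_right _ hG0.le
          have : 0 ≤ (K : ℝ) ^ 2 / N := by positivity
          simp
          linarith
  have hsum : ∑ y ∈ Finset.univ.erase c, ((N : ℝ)⁻¹ +
        (if y ∈ visited n then (K : ℝ) ^ 2 / N + K * β else 0) +
        s1 * (if n (idx c y) = 1 then 1 else 0)) ≤
      2 + (K : ℝ) ^ 3 / N + (K : ℝ) ^ 2 * β := by
    rw [Finset.sum_add_distrib, Finset.sum_add_distrib, ← Finset.mul_sum]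
    have b1 : ∑ y ∈ Finset.univ.erase c, (N : ℝ)⁻¹ ≤ 1 := by
      refine (Finset.sum_le_univ_sum_of_nonneg fun _ => by positivity).trans ?_
      simp [hN'.ne']
    have b2 : ∑ y ∈ Finset.univ.erase c,
        (if y ∈ visited n then (K : ℝ) ^ 2 / N + K * β else 0) ≤
        (K : ℝ) ^ 3 / N + (K : ℝ) ^ 2 * β := by
      refine (Finset.sum_le_univ_sum_of_nonneg fun _ => by split_ifs <;> positivity).trans ?_
      rw [← Finset.sum_filter, Finset.sum_const, nsmul_eq_mul]
      have : ((Finset.univ.filter (· ∈ visited n)).card : ℝ) ≤ K := by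
        rw [Finset.filter_univ_mem]; exact_mod_cast hv
      calc _ ≤ (K : ℝ) * ((K : ℝ) ^ 2 / N + K * β) := by gcongr
        _ = _ := by ring
    -- there are at most `K` edges to choose from, which the factor `K⁻¹` in `s1` compensates
    have b3 : s1 * ∑ y ∈ Finset.univ.erase c, (if n (idx c y) = 1 then (1 : ℝ) else 0) ≤ 1 := by
      have e : ∑ y ∈ Finset.univ.erase c, (if n (idx c y) = 1 then (1 : ℝ) else 0) =
          (openDeg n c : ℝ) := by unfold openDeg; push_cast; rfl
      rw [e, hs1]
      split_ifs with hd
      · rw [one_mul]; exact_mod_cast hd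
      · rw [inv_mul_le_iff₀ hK0, mul_one]
        exact_mod_cast (openDeg_le_card_visited n c).trans hv
    linarith
  have hW := walkWeight_nonneg hβ n
  calc ∑ y ∈ Finset.univ.erase c, walkWeight β (bump n (idx c y)) *
        (K : ℝ) ^ pot (bump n (idx c y)) y
      = ∑ y ∈ Finset.univ.erase c, walkWeight β n * (stepWeight N β (n (idx c y)) *
        (K : ℝ) ^ pot (bump n (idx c y)) y) :=
        Finset.sum_congr rfl fun y _ => by rw [walkWeight_bump, mul_assoc]
    _ ≤ ∑ y ∈ Finset.univ.erase c, walkWeight β n * (((N : ℝ)⁻¹ +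
        (if y ∈ visited n then (K : ℝ) ^ 2 / N + K * β else 0) +
        s1 * (if n (idx c y) = 1 then 1 else 0)) * G) :=
        Finset.sum_le_sum fun y hy => mul_le_mul_of_nonneg_left (hterm y hy) hW
    _ = walkWeight β n * ((∑ y ∈ Finset.univ.erase c, ((N : ℝ)⁻¹ +
        (if y ∈ visited n then (K : ℝ) ^ 2 / N + K * β else 0) +
        s1 * (if n (idx c y) = 1 then 1 else 0))) * G) := by
        rw [← Finset.mul_sum, Finset.sum_mul]
    _ ≤ walkWeight β n * ((2 + (K : ℝ) ^ 3 / N + (K : ℝ) ^ 2 * β) * G) := by gcongr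
    _ = _ := by ring

lemma visited_bump_subset (n : Idx N → ℕ) (c y : Fin N) :
    visited (bump n (idx c y)) ⊆ insert y (insert c (visited n)) := by
  intro x hx
  simp only [visited, Finset.mem_filter, Finset.mem_univ, true_and, Finset.mem_insert] at hx ⊢
  obtain ⟨z, hz, hn⟩ := hx
  by_cases h : idx x z = idx c y
  · rw [idx_eq_iff] at h
    rcases h with ⟨h1, -⟩ | ⟨h1, -⟩
    · exact Or.inr (Or.inl h1)
    · exact Or.inl h1
  · rw [bump_of_ne n h] at hn
    exact Or.inr (Or.inr ⟨z, hz, hn⟩)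

/-- Iterating the one-step bound; `K` bounds the number of vertices that the walk can meet. -/
lemma walkSum_le {β : ℝ} (hβ : 0 ≤ β) {K : ℕ} (r : ℕ) (n : Idx N → ℕ) (c : Fin N)
    (hv : (insert c (visited n)).card + r ≤ K) :
    walkSum β r n c ≤ (2 + (K : ℝ) ^ 3 / N + (K : ℝ) ^ 2 * β) ^ r *
      (walkWeight β n * (K : ℝ) ^ pot n c) := by
  have hK1 : 1 ≤ K := by
    have : 0 < (insert c (visited n)).card := Finset.card_pos.mpr ⟨c, Finset.mem_insert_self _ _⟩
    omega
  have hK1' : (1 : ℝ) ≤ K := by exact_mod_cast hK1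
  induction r generalizing n c with
  | zero =>
    simp only [walkSum, pow_zero, one_mul]
    exact le_mul_of_one_le_right (walkWeight_nonneg hβ n) (one_le_pow₀ hK1')
  | succ r ih =>
    simp only [walkSum]
    set q : ℝ := 2 + (K : ℝ) ^ 3 / N + (K : ℝ) ^ 2 * β
    have hq : 0 ≤ q := by positivity
    calc ∑ y ∈ Finset.univ.erase c, walkSum β r (bump n (idx c y)) y
        ≤ ∑ y ∈ Finset.univ.erase c, q ^ r * (walkWeight β (bump n (idx c y)) *
          (K : ℝ) ^ pot (bump n (idx c y)) y) := by
          refine Finset.sum_le_sum fun y _ => ih _ _ ?_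
          have h1 : insert y (visited (bump n (idx c y))) ⊆ insert y (insert c (visited n)) :=
            Finset.insert_subset (Finset.mem_insert_self _ _) (visited_bump_subset n c y)
          have h2 := (Finset.card_le_card h1).trans (Finset.card_insert_le _ _)
          omega
      _ = q ^ r * ∑ y ∈ Finset.univ.erase c, (walkWeight β (bump n (idx c y)) *
          (K : ℝ) ^ pot (bump n (idx c y)) y) := by rw [Finset.mul_sum]
      _ ≤ q ^ r * (q * (walkWeight β n * (K : ℝ) ^ pot n c)) := by
          gcongr
          refine sum_step_le hβ hK1 n c ?_
          have := Finset.card_le_card (Finset.subset_insert c (visited n))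
          omega
      _ = _ := by ring

end TwoResolvent
end

noncomputable section
namespace TwoResolvent
open scoped ComplexOrder Matrix Matrix.Norms.L2Operator

variable {N : ℕ}

/-! ### Random Hermitian matrices with bounded entries -/

/-- The Hermitian matrix with the given entries on and above the diagonal; of a diagonal entry
only the real part is used. -/
def wmat (u : Idx N → ℂ) : Matrix (Fin N) (Fin N) ℂ :=
  Matrix.of fun i j => if i < j then u (idx i j) else
    if j < i then (starRingEnd ℂ) (u (idx i j)) else ((u (idx i j)).re : ℂ)

/-- The off-diagonal part of `wmat u`. -/
def woff (u : Idx N → ℂ) : Matrix (Fin N) (Fin N) ℂ :=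
  Matrix.of fun i j => if i < j then u (idx i j) else
    if j < i then (starRingEnd ℂ) (u (idx i j)) else 0

lemma wmat_isHermitian (u : Idx N → ℂ) : (wmat u).IsHermitian := by
  ext i j
  rw [Matrix.conjTranspose_apply]
  simp only [wmat, Matrix.of_apply, idx_comm j i]
  rcases lt_trichotomy i j with h | h | h
  · simp [h, h.not_gt]
  · subst h; simp
  · simp [h, h.not_gt]

lemma woff_isHermitian (u : Idx N → ℂ) : (woff u).IsHermitian := by
  ext i j
  rw [Matrix.conjTranspose_apply]
  simp only [woff, Matrix.of_apply, idx_comm j i]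
  rcases lt_trichotomy i j with h | h | h
  · simp [h, h.not_gt]
  · subst h; simp
  · simp [h, h.not_gt]

lemma wmat_eq (u : Idx N → ℂ) :
    wmat u = woff u + Matrix.diagonal fun i => ((u (idx i i)).re : ℂ) := by
  ext i j
  simp only [wmat, woff, Matrix.of_apply, Matrix.add_apply]
  rcases lt_trichotomy i j with h | h | h
  · simp [h, h.ne]
  · subst h; simp
  · simp [h, h.ne', h.not_gt]

/-- Truncation of a complex number at size `β`. -/
def clip (β : ℝ) (x : ℂ) : ℂ := if ‖x‖ ≤ β then x else 0

lemma measurable_clip (β : ℝ) : Measurable (clip β) := by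
  unfold clip
  exact Measurable.ite (measurableSet_le measurable_norm measurable_const) measurable_id
    measurable_const

lemma norm_clip_le {β : ℝ} (hβ : 0 ≤ β) (x : ℂ) : ‖clip β x‖ ≤ β := by
  unfold clip; split_ifs with h
  · exact h
  · simpa using hβ

/-- Truncation of all entries. -/
def clipAll (β : ℝ) (x : Idx N → ℂ) : Idx N → ℂ := fun p => clip β (x p)

lemma measurable_clipAll (β : ℝ) : Measurable (clipAll β : (Idx N → ℂ) → (Idx N → ℂ)) :=
  measurable_pi_lambda _ fun p => (measurable_clip β).comp (measurable_pi_apply p)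

/-- The truncated random matrix. -/
def tmat (β : ℝ) (x : Idx N → ℂ) : Matrix (Fin N) (Fin N) ℂ := wmat (clipAll β x)

lemma tmat_isHermitian (β : ℝ) (x : Idx N → ℂ) : (tmat β x).IsHermitian := wmat_isHermitian _

/-- Laws `ν p` of the entries whose truncations at `β` are almost centered, and, off the
diagonal, almost have variance `N⁻¹`. -/
structure EntryBounds (N : ℕ) (β : ℝ) (ν : Idx N → Measure ℂ) : Prop where
  mean : ∀ p, ‖∫ y, clip β y ∂(ν p)‖ ≤ ((N : ℝ) ^ 2)⁻¹
  var_le : ∀ p : Idx N, p.1.1 ≠ p.1.2 → ∫ y, ‖clip β y‖ ^ 2 ∂(ν p) ≤ (N : ℝ)⁻¹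
  le_var : ∀ p : Idx N, p.1.1 ≠ p.1.2 →
    (N : ℝ)⁻¹ - ((N : ℝ) ^ 2)⁻¹ ≤ ∫ y, ‖clip β y‖ ^ 2 ∂(ν p)

/-- A continuous function of a bounded measurable quantity is measurable and bounded. -/
lemma integrable_comp_of_isCompact {X Y E : Type*} [MeasurableSpace X] [TopologicalSpace Y]
    [MeasurableSpace Y] [BorelSpace Y] [NormedAddCommGroup E] [MeasurableSpace E] [BorelSpace E]
    [SecondCountableTopology E] {m : Measure X} [IsFiniteMeasure m] {g : X → Y}
    (hg : Measurable g) {K : Set Y} (hK : IsCompact K) (hgK : ∀ x, g x ∈ K) {F : Y → E}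
    (hF : Continuous F) : Integrable (fun x => F (g x)) m := by
  obtain ⟨C, hC⟩ := hK.exists_bound_of_continuousOn hF.continuousOn
  exact integrable_of_bdd (hF.measurable.comp hg) C fun x => hC _ (hgK x)

lemma integrable_clipAll {E : Type*} [NormedAddCommGroup E] [MeasurableSpace E] [BorelSpace E]
    [SecondCountableTopology E] {β : ℝ} (hβ : 0 ≤ β) {m : Measure (Idx N → ℂ)} [IsFiniteMeasure m]
    {F : (Idx N → ℂ) → E} (hF : Continuous F) : Integrable (fun x => F (clipAll β x)) m := by
  refine integrable_comp_of_isCompact (measurable_clipAll β)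
    (isCompact_univ_pi fun _ : Idx N => isCompact_closedBall (0 : ℂ) β) (fun x p _ => ?_) hF
  rw [mem_closedBall_zero_iff]
  exact norm_clip_le hβ (x p)

lemma continuous_wmat : Continuous (wmat : (Idx N → ℂ) → Matrix (Fin N) (Fin N) ℂ) := by
  refine continuous_pi fun i => continuous_pi fun j => ?_
  show Continuous fun u : Idx N → ℂ => if i < j then u (idx i j) else
    if j < i then (starRingEnd ℂ) (u (idx i j)) else ((u (idx i j)).re : ℂ)
  split_ifs
  · fun_prop
  · exact Complex.continuous_conj.comp (continuous_apply _)
  · exact Complex.continuous_ofReal.comp (Complex.continuous_re.comp (continuous_apply _))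

lemma continuous_woff : Continuous (woff : (Idx N → ℂ) → Matrix (Fin N) (Fin N) ℂ) := by
  refine continuous_pi fun i => continuous_pi fun j => ?_
  show Continuous fun u : Idx N → ℂ => if i < j then u (idx i j) else
    if j < i then (starRingEnd ℂ) (u (idx i j)) else 0
  split_ifs
  · fun_prop
  · exact Complex.continuous_conj.comp (continuous_apply _)
  · exact continuous_const

/-- The monomial `∏ u_p^{a_p} conj(u_p)^{b_p}`. -/
def mono (a b : Idx N → ℕ) (u : Idx N → ℂ) : ℂ :=
  ∏ p, (u p ^ a p * (starRingEnd ℂ) (u p) ^ b p)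

lemma continuous_mono (a b : Idx N → ℕ) : Continuous (mono a b) := by
  unfold mono
  refine continuous_finsetProd _ fun p _ => ?_
  exact ((continuous_apply p).pow _).mul ((Complex.continuous_conj.comp (continuous_apply p)).pow _)

lemma mono_bump_left (a b : Idx N → ℕ) (u : Idx N → ℂ) (p : Idx N) :
    mono (bump a p) b u = mono a b u * u p := by
  unfold mono
  rw [← Finset.mul_prod_erase _ _ (Finset.mem_univ p),
    ← Finset.mul_prod_erase _ (fun q => u q ^ a q * (starRingEnd ℂ) (u q) ^ b q)
      (Finset.mem_univ p), bump_self]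
  have : ∏ x ∈ Finset.univ.erase p, (u x ^ bump a p x * (starRingEnd ℂ) (u x) ^ b x) =
      ∏ x ∈ Finset.univ.erase p, (u x ^ a x * (starRingEnd ℂ) (u x) ^ b x) :=
    Finset.prod_congr rfl fun q hq => by rw [bump_of_ne a (Finset.ne_of_mem_erase hq)]
  rw [this]; ring

lemma mono_bump_right (a b : Idx N → ℕ) (u : Idx N → ℂ) (p : Idx N) :
    mono a (bump b p) u = mono a b u * (starRingEnd ℂ) (u p) := by
  unfold mono
  rw [← Finset.mul_prod_erase _ _ (Finset.mem_univ p),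
    ← Finset.mul_prod_erase _ (fun q => u q ^ a q * (starRingEnd ℂ) (u q) ^ b q)
      (Finset.mem_univ p), bump_self]
  have : ∏ x ∈ Finset.univ.erase p, (u x ^ a x * (starRingEnd ℂ) (u x) ^ bump b p x) =
      ∏ x ∈ Finset.univ.erase p, (u x ^ a x * (starRingEnd ℂ) (u x) ^ b x) :=
    Finset.prod_congr rfl fun q hq => by rw [bump_of_ne b (Finset.ne_of_mem_erase hq)]
  rw [this]; ring

lemma bump_add_left (a b : Idx N → ℕ) (p : Idx N) : bump a p + b = bump (a + b) p := by
  ext q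
  by_cases h : q = p
  · subst h; simp [bump_self]; ring
  · simp [bump_of_ne _ h]

lemma bump_add_right (a b : Idx N → ℕ) (p : Idx N) : a + bump b p = bump (a + b) p := by
  rw [add_comm, bump_add_left, add_comm]

section Walks

variable {β : ℝ} {ν : Idx N → Measure ℂ} [∀ p, IsProbabilityMeasure (ν p)]

/-- A joint moment of a truncated off-diagonal entry and its conjugate is at most the weight of
an edge of the same multiplicity. -/
lemma norm_integral_pow_le (hN : 0 < N) (hβ : 0 ≤ β) (h : EntryBounds N β ν) {p : Idx N}
    (hp : p.1.1 ≠ p.1.2) (a b : ℕ) :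
    ‖∫ y, clip β y ^ a * (starRingEnd ℂ) (clip β y) ^ b ∂(ν p)‖ ≤ edgeWeight N β (a + b) := by
  have hN1 : (1 : ℝ) ≤ N := by exact_mod_cast hN
  have hmean : ‖∫ y, clip β y ∂(ν p)‖ ≤ (N : ℝ)⁻¹ := by
    refine (h.mean p).trans (inv_anti₀ (by linarith) ?_)
    nlinarith
  have hm : ∀ n : ℕ, Integrable (fun y => ‖clip β y‖ ^ n) (ν p) := fun n =>
    integrable_of_bdd ((measurable_clip β).norm.pow_const n) (β ^ n) fun x => by
      rw [norm_pow, norm_norm]; exact pow_le_pow_left₀ (norm_nonneg _) (norm_clip_le hβ x) n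
  match hab : a + b with
  | 0 =>
    have : a = 0 ∧ b = 0 := by omega
    simp [this.1, this.2, edgeWeight]
  | 1 =>
    simp only [edgeWeight]
    rcases (by omega : (a = 1 ∧ b = 0) ∨ (a = 0 ∧ b = 1)) with ⟨rfl, rfl⟩ | ⟨rfl, rfl⟩
    · simpa using hmean
    · simp only [pow_zero, one_mul, pow_one]
      rw [integral_conj, RCLike.norm_conj]; exact hmean
  | k + 2 =>
    simp only [edgeWeight]
    refine (norm_integral_le_integral_norm _).trans ?_
    calc ∫ y, ‖clip β y ^ a * (starRingEnd ℂ) (clip β y) ^ b‖ ∂(ν p)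
        = ∫ y, ‖clip β y‖ ^ (k + 2) ∂(ν p) := by
          congr 1; ext y
          rw [norm_mul, norm_pow, norm_pow, RCLike.norm_conj, ← pow_add, hab]
      _ ≤ ∫ y, ‖clip β y‖ ^ 2 * β ^ k ∂(ν p) := by
          refine integral_mono (hm _) ((hm 2).mul_const _) fun y => ?_
          simp only
          rw [pow_add, mul_comm]
          gcongr
          exact norm_clip_le hβ y
      _ = (∫ y, ‖clip β y‖ ^ 2 ∂(ν p)) * β ^ k := integral_mul_const _ _
      _ ≤ _ := by gcongr; exact h.var_le p hp

/-- Independence bounds the expectation of a monomial in the off-diagonal entries. -/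
lemma norm_integral_mono_le (hN : 0 < N) (hβ : 0 ≤ β) (h : EntryBounds N β ν)
    {a b : Idx N → ℕ} (hd : ∀ p : Idx N, p.1.1 = p.1.2 → a p = 0 ∧ b p = 0) :
    ‖∫ x, mono a b (clipAll β x) ∂(Measure.pi ν)‖ ≤ walkWeight β (a + b) := by
  unfold mono clipAll walkWeight
  rw [integral_fintype_prod_eq_prod (μ := ν)
    (f := fun p y => clip β y ^ a p * (starRingEnd ℂ) (clip β y) ^ b p), norm_prod]
  refine Finset.prod_le_prod (fun _ _ => norm_nonneg _) fun p _ => ?_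
  by_cases hp : p.1.1 = p.1.2
  · obtain ⟨h1, h2⟩ := hd p hp
    simp [h1, h2, edgeWeight]
  · exact norm_integral_pow_le hN hβ h hp _ _

lemma idx_ne {c y : Fin N} (h : y ≠ c) : (idx c y).1.1 ≠ (idx c y).1.2 := by
  simp only [idx, Ne, Fin.ext_iff, Fin.coe_min, Fin.coe_max]
  have : (y : ℕ) ≠ c := fun e => h (Fin.ext e)
  omega

/-- Expanding a power of the matrix from row `c` into walks, with the entries along the steps
that were already taken collected in a monomial, and bounding the expectation of each walk by
its weight. All end points are summed over, since the bound does not need the walks to be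
closed. -/
lemma sum_norm_integral_walk_le (hN : 0 < N) (hβ : 0 ≤ β) (h : EntryBounds N β ν) (r : ℕ) :
    ∀ (a b : Idx N → ℕ), (∀ p : Idx N, p.1.1 = p.1.2 → a p = 0 ∧ b p = 0) → ∀ c : Fin N,
    ∑ d, ‖∫ x, mono a b (clipAll β x) * (woff (clipAll β x) ^ r) c d ∂(Measure.pi ν)‖ ≤
      walkSum β r (a + b) c := by
  induction r with
  | zero =>
    intro a b hd c
    rw [Finset.sum_eq_single c]
    · simpa [walkSum] using norm_integral_mono_le hN hβ h hd
    · intro d _ hdc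
      simp [Matrix.one_apply_ne hdc.symm]
    · simp
  | succ r ih =>
    intro a b hd c
    have hcont : ∀ (a b : Idx N → ℕ) (y d : Fin N), Continuous fun u : Idx N → ℂ =>
        mono a b u * (woff u ^ r) y d := fun a b y d =>
      (continuous_mono a b).mul ((continuous_woff.pow r).matrix_elem y d)
    -- a step from `c` to `y` multiplies the monomial by the entry or by its conjugate
    have key : ∀ y, y ≠ c → ∃ a' b' : Idx N → ℕ, a' + b' = bump (a + b) (idx c y) ∧
        (∀ p : Idx N, p.1.1 = p.1.2 → a' p = 0 ∧ b' p = 0) ∧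
        ∀ u v, mono a b u * (woff u c y * v) = mono a' b' u * v := by
      intro y hy
      have hne : ∀ p : Idx N, p.1.1 = p.1.2 → p ≠ idx c y := fun p hp e => by
        subst e; exact idx_ne hy hp
      rcases lt_or_gt_of_ne hy with hlt | hlt
      · refine ⟨a, bump b (idx c y), bump_add_right _ _ _, fun p hp => ?_, fun u v => ?_⟩
        · rw [bump_of_ne _ (hne p hp)]; exact hd p hp
        · rw [mono_bump_right]
          simp only [woff, Matrix.of_apply, hlt, hlt.not_gt, if_true, if_false]
          ring
      · refine ⟨bump a (idx c y), b, bump_add_left _ _ _, fun p hp => ?_, fun u v => ?_⟩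
        · rw [bump_of_ne _ (hne p hp)]; exact hd p hp
        · rw [mono_bump_left]
          simp only [woff, Matrix.of_apply, hlt, if_true]
          ring
    simp only [walkSum]
    have hint : ∀ d y, Integrable (fun x => mono a b (clipAll β x) *
        (woff (clipAll β x) c y * (woff (clipAll β x) ^ r) y d)) (Measure.pi ν) := fun d y => by
      refine integrable_clipAll hβ (F := fun u => mono a b u * (woff u c y * (woff u ^ r) y d)) ?_
      exact (continuous_mono a b).mul ((continuous_woff.matrix_elem c y).mul
        ((continuous_woff.pow r).matrix_elem y d))
    have e1 : ∀ d, ‖∫ x, mono a b (clipAll β x) * (woff (clipAll β x) ^ (r + 1)) c d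
        ∂(Measure.pi ν)‖ ≤ ∑ y ∈ Finset.univ.erase c, ‖∫ x, mono a b (clipAll β x) *
          (woff (clipAll β x) c y * (woff (clipAll β x) ^ r) y d) ∂(Measure.pi ν)‖ := by
      intro d
      have e2 : ∀ x, mono a b (clipAll β x) * (woff (clipAll β x) ^ (r + 1)) c d =
          ∑ y ∈ Finset.univ.erase c, mono a b (clipAll β x) *
          (woff (clipAll β x) c y * (woff (clipAll β x) ^ r) y d) := by
        intro x
        rw [pow_succ', Matrix.mul_apply, Finset.mul_sum,
          ← Finset.add_sum_erase _ _ (Finset.mem_univ c)]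
        simp [woff]
      simp only [e2]
      rw [integral_finsetSum _ fun y _ => hint d y]
      exact norm_sum_le _ _
    refine (Finset.sum_le_sum fun d _ => e1 d).trans ?_
    rw [Finset.sum_comm]
    refine Finset.sum_le_sum fun y hy => ?_
    obtain ⟨a', b', hab, hd', hu⟩ := key y (Finset.ne_of_mem_erase hy)
    rw [← hab]
    refine le_trans (le_of_eq ?_) (ih a' b' hd' y)
    refine Finset.sum_congr rfl fun d _ => ?_
    simp only [hu]


/-- The trace of a power of the off-diagonal part, in expectation. -/
lemma norm_integral_trace_le (hN : 0 < N) (hβ : 0 ≤ β) (h : EntryBounds N β ν) (m : ℕ) :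
    ‖∫ x, (woff (clipAll β x) ^ m).trace ∂(Measure.pi ν)‖ ≤
      N * (2 + ((m + 1 : ℕ) : ℝ) ^ 3 / N + ((m + 1 : ℕ) : ℝ) ^ 2 * β) ^ m := by
  have hint : ∀ c, Integrable (fun x => (woff (clipAll β x) ^ m) c c) (Measure.pi ν) := fun c =>
    integrable_clipAll hβ (F := fun u => (woff u ^ m) c c)
      ((continuous_woff.pow m).matrix_elem c c)
  have h1 : ∀ c, ‖∫ x, (woff (clipAll β x) ^ m) c c ∂(Measure.pi ν)‖ ≤
      (2 + ((m + 1 : ℕ) : ℝ) ^ 3 / N + ((m + 1 : ℕ) : ℝ) ^ 2 * β) ^ m := by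
    intro c
    have h2 := sum_norm_integral_walk_le hN hβ h m 0 0 (fun _ _ => ⟨rfl, rfl⟩) c
    have h3 := Finset.single_le_sum (f := fun d => ‖∫ x, mono 0 0 (clipAll β x) *
      (woff (clipAll β x) ^ m) c d ∂(Measure.pi ν)‖) (fun _ _ => norm_nonneg _) (Finset.mem_univ c)
    have h4 := walkSum_le (N := N) hβ (K := m + 1) m (0 + 0) c (by
      have : visited (0 + 0 : Idx N → ℕ) = ∅ := by simp [visited]
      rw [this]; simp; omega)
    have h5 : walkWeight β (0 + 0 : Idx N → ℕ) = 1 := by simp [walkWeight, edgeWeight]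
    have h6 : pot (0 + 0 : Idx N → ℕ) c = 0 := by simp [pot, openDeg]
    rw [h5, h6, pow_zero, mul_one, mul_one] at h4
    have h7 : ∀ u, mono (0 : Idx N → ℕ) 0 u = 1 := fun u => by simp [mono]
    simp only [h7, one_mul] at h3 h2
    exact h3.trans (h2.trans h4)
  simp only [Matrix.trace, Matrix.diag_apply]
  rw [integral_finsetSum _ fun c _ => hint c]
  refine (norm_sum_le _ _).trans ((Finset.sum_le_sum fun c _ => h1 c).trans ?_)
  simp

end Walks

lemma trace_mul_conjTranspose (A : Matrix (Fin N) (Fin N) ℂ) :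
    (A * Aᴴ).trace = ((∑ i, ∑ j, ‖A i j‖ ^ 2 : ℝ) : ℂ) := by
  unfold Matrix.trace
  push_cast
  refine Finset.sum_congr rfl fun i _ => ?_
  rw [Matrix.diag_apply, Matrix.mul_apply]
  refine Finset.sum_congr rfl fun j _ => ?_
  rw [Matrix.conjTranspose_apply, Complex.star_def, Complex.mul_conj, Complex.normSq_eq_norm_sq]
  push_cast; rfl

/-- The operator norm is at most the Hilbert–Schmidt norm. -/
lemma norm_sq_le_sum_sq (A : Matrix (Fin N) (Fin N) ℂ) : ‖A‖ ^ 2 ≤ ∑ i, ∑ j, ‖A i j‖ ^ 2 := by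
  have h0 : 0 ≤ ∑ i, ∑ j, ‖A i j‖ ^ 2 := by positivity
  have h1 : ‖A‖ ≤ √(∑ i, ∑ j, ‖A i j‖ ^ 2) := by
    rw [Matrix.cstar_norm_def]
    refine ContinuousLinearMap.opNorm_le_bound _ (Real.sqrt_nonneg _) fun v => ?_
    rw [← abs_of_nonneg (norm_nonneg v), ← Real.sqrt_sq_eq_abs, ← Real.sqrt_mul h0]
    refine Real.le_sqrt_of_sq_le ?_
    rw [EuclideanSpace.norm_sq_eq, EuclideanSpace.norm_sq_eq, Finset.sum_mul]
    refine Finset.sum_le_sum fun i _ => ?_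
    have e : (Matrix.toEuclideanCLM (n := Fin N) (𝕜 := ℂ) A v) i = ∑ j, A i j * v j := rfl
    rw [e]
    have h2 : ‖∑ j, A i j * v j‖ ≤ ∑ j, ‖A i j‖ * ‖v j‖ :=
      (norm_sum_le _ _).trans (Finset.sum_le_sum fun j _ => (norm_mul _ _).le)
    exact (pow_le_pow_left₀ (norm_nonneg _) h2 2).trans (Finset.sum_mul_sq_le_sq_mul_sq _ _ _)
  calc ‖A‖ ^ 2 ≤ (√(∑ i, ∑ j, ‖A i j‖ ^ 2)) ^ 2 := pow_le_pow_left₀ (norm_nonneg _) h1 2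
    _ = _ := Real.sq_sqrt h0

lemma norm_pow_le_trace {A : Matrix (Fin N) (Fin N) ℂ} (hA : A.IsHermitian) (s : ℕ) :
    ‖A‖ ^ 2 ^ (s + 1) ≤ (A ^ 2 ^ (s + 1)).trace.re := by
  -- the C*-identity, iterated
  have h1 : ‖A ^ 2 ^ s‖ = ‖A‖ ^ 2 ^ s := by
    have h2 := IsSelfAdjoint.nnnorm_pow_two_pow (show IsSelfAdjoint A from hA) s
    have h3 := congrArg NNReal.toReal h2
    simpa using h3
  have h4 : A ^ 2 ^ (s + 1) = A ^ 2 ^ s * (A ^ 2 ^ s)ᴴ := by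
    rw [Matrix.conjTranspose_pow, hA.eq, ← pow_add]; congr 1; ring
  rw [h4, trace_mul_conjTranspose, Complex.ofReal_re, pow_succ, pow_mul, ← h1]
  exact norm_sq_le_sum_sq _

section Walks

variable {β : ℝ} {ν : Idx N → Measure ℂ} [∀ p, IsProbabilityMeasure (ν p)]

/-- The tail of the norm of the off-diagonal part, by Markov's inequality for the trace of a
high even power. -/
lemma measure_norm_woff_ge_le (hN : 0 < N) (hβ : 0 ≤ β) (h : EntryBounds N β ν) (s : ℕ) {ρ : ℝ}
    (hρ : 0 < ρ) :
    Measure.pi ν {x | ρ ≤ ‖woff (clipAll β x)‖} ≤ ENNReal.ofReal (N * ((2 +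
      ((2 ^ (s + 1) + 1 : ℕ) : ℝ) ^ 3 / N + ((2 ^ (s + 1) + 1 : ℕ) : ℝ) ^ 2 * β) / ρ)
        ^ 2 ^ (s + 1)) := by
  set m : ℕ := 2 ^ (s + 1) with hm
  have hcont : Continuous fun u : Idx N → ℂ => (woff u ^ m).trace :=
    (continuous_woff.pow m).matrix_trace
  have hint : Integrable (fun x => (woff (clipAll β x) ^ m).trace) (Measure.pi ν) :=
    integrable_clipAll hβ hcont
  have hint' : Integrable (fun x => ‖woff (clipAll β x)‖ ^ m) (Measure.pi ν) :=
    integrable_clipAll hβ (F := fun u => ‖woff u‖ ^ m) (continuous_woff.norm.pow m)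
  have h1 := norm_integral_trace_le (ν := ν) hN hβ h m
  have h2 : ∫ x, ‖woff (clipAll β x)‖ ^ m ∂(Measure.pi ν) ≤
      ‖∫ x, (woff (clipAll β x) ^ m).trace ∂(Measure.pi ν)‖ := by
    refine le_trans ?_ (Complex.re_le_norm _)
    have e : (∫ x, (woff (clipAll β x) ^ m).trace ∂(Measure.pi ν)).re =
        ∫ x, ((woff (clipAll β x) ^ m).trace).re ∂(Measure.pi ν) :=
      (integral_re hint).symm
    rw [e]
    exact integral_mono hint' hint.re fun x => norm_pow_le_trace (woff_isHermitian _) s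
  have hmk := mul_meas_ge_le_integral_of_nonneg (μ := Measure.pi ν)
    (f := fun x => ‖woff (clipAll β x)‖ ^ m) (Eventually.of_forall fun _ => by positivity) hint'
    (ρ ^ m)
  have hsub : {x : Idx N → ℂ | ρ ≤ ‖woff (clipAll β x)‖} ⊆
      {x | ρ ^ m ≤ ‖woff (clipAll β x)‖ ^ m} := fun x hx => pow_le_pow_left₀ hρ.le hx m
  refine (measure_mono hsub).trans ?_
  rw [ENNReal.le_ofReal_iff_toReal_le (measure_ne_top _ _) (by positivity), div_pow,
    ← mul_div_assoc, le_div_iff₀ (by positivity), mul_comm]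
  exact hmk.trans (h2.trans h1)

/-- The tail of the norm of the truncated random matrix. -/
lemma measure_norm_tmat_ge_le (hN : 0 < N) (hβ : 0 ≤ β) (h : EntryBounds N β ν) (s : ℕ) {ρ : ℝ}
    (hρ : 0 < ρ) :
    Measure.pi ν {x | ρ + β ≤ ‖tmat β x‖} ≤ ENNReal.ofReal (N * ((2 +
      ((2 ^ (s + 1) + 1 : ℕ) : ℝ) ^ 3 / N + ((2 ^ (s + 1) + 1 : ℕ) : ℝ) ^ 2 * β) / ρ)
        ^ 2 ^ (s + 1)) := by
  refine (measure_mono fun x hx => ?_).trans (measure_norm_woff_ge_le hN hβ h s hρ)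
  have h1 : ‖tmat β x‖ ≤ ‖woff (clipAll β x)‖ + β := by
    unfold tmat
    rw [wmat_eq]
    refine (norm_add_le _ _).trans ?_
    gcongr
    rw [Matrix.l2_opNorm_diagonal, pi_norm_le_iff_of_nonneg hβ]
    intro i
    rw [Complex.norm_real]
    exact (Complex.abs_re_le_norm _).trans (norm_clip_le hβ _)
  have h2 : ρ + β ≤ ‖tmat β x‖ := hx
  show ρ ≤ _
  linarith

end Walks

end TwoResolvent
end

noncomputable section
namespace TwoResolvent
open scoped ComplexOrder Matrix Matrix.Norms.L2Operator

variable {N : ℕ}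

/-! ### Perturbation of a single entry -/

lemma wmat_update_of_ne {i j : Fin N} (h : i ≠ j) (u u' : Idx N → ℂ) :
    wmat (Function.update u (idx i j) (u' (idx i j))) - wmat u =
      Matrix.single i j (wmat u' i j - wmat u i j) +
        Matrix.single j i ((starRingEnd ℂ) (wmat u' i j - wmat u i j)) := by
  ext k l
  rw [Matrix.sub_apply, Matrix.add_apply, Matrix.single_apply, Matrix.single_apply]
  by_cases h1 : i = k ∧ j = l
  · obtain ⟨rfl, rfl⟩ := h1
    rcases lt_or_gt_of_ne h with hlt | hlt
    · simp [wmat, hlt, h, h.symm]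
    · simp [wmat, hlt, h, h.symm, hlt.not_gt]
  · by_cases h2 : j = k ∧ i = l
    · obtain ⟨rfl, rfl⟩ := h2
      rcases lt_or_gt_of_ne h with hlt | hlt
      · simp [wmat, hlt, h, h.symm, hlt.not_gt, idx_comm j i]
      · simp [wmat, hlt, h, h.symm, hlt.not_gt, idx_comm j i]
    · have h3 : idx k l ≠ idx i j := by
        rw [Ne, idx_eq_iff]
        rintro (⟨a, b⟩ | ⟨a, b⟩)
        · exact h1 ⟨a.symm, b.symm⟩
        · exact h2 ⟨a.symm, b.symm⟩
      simp [wmat, h1, h2, Function.update_of_ne h3]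

lemma wmat_update_self (i : Fin N) (u u' : Idx N → ℂ) :
    wmat (Function.update u (idx i i) (u' (idx i i))) - wmat u =
      Matrix.single i i (wmat u' i i - wmat u i i) := by
  ext k l
  rw [Matrix.sub_apply, Matrix.single_apply]
  by_cases h1 : i = k ∧ i = l
  · obtain ⟨rfl, rfl⟩ := h1
    simp [wmat]
  · have h3 : idx k l ≠ idx i i := by
      rw [Ne, idx_eq_iff]
      rintro (⟨a, b⟩ | ⟨a, b⟩)
      · exact h1 ⟨a.symm, b.symm⟩
      · exact h1 ⟨a.symm, b.symm⟩
    simp [wmat, h1, Function.update_of_ne h3]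

lemma idx_coe (p : Idx N) : idx p.1.1 p.1.2 = p := by
  unfold idx
  ext
  · simp [min_eq_left p.2]
  · simp [max_eq_right p.2]

lemma norm_wmat_apply_le {u : Idx N → ℂ} {β : ℝ} (hu : ∀ p, ‖u p‖ ≤ β) (i j : Fin N) :
    ‖wmat u i j‖ ≤ β := by
  simp only [wmat, Matrix.of_apply]
  split_ifs
  · exact hu _
  · rw [RCLike.norm_conj]; exact hu _
  · rw [Complex.norm_real]; exact (Complex.abs_re_le_norm _).trans (hu _)

lemma exists_wmat_update {u u' : Idx N → ℂ} {β : ℝ} (hu : ∀ p, ‖u p‖ ≤ β) (hu' : ∀ p, ‖u' p‖ ≤ β)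
    (p : Idx N) : ∃ a b : ℂ, ‖a‖ ≤ 2 * β ∧ ‖b‖ ≤ 2 * β ∧
      wmat (Function.update u p (u' p)) - wmat u =
        Matrix.single p.1.1 p.1.2 a + Matrix.single p.1.2 p.1.1 b := by
  have hβ : 0 ≤ β := (norm_nonneg _).trans (hu p)
  have hd : ∀ i j, ‖wmat u' i j - wmat u i j‖ ≤ 2 * β := fun i j =>
    (norm_sub_le _ _).trans (by linarith [norm_wmat_apply_le hu i j, norm_wmat_apply_le hu' i j])
  by_cases h : p.1.1 = p.1.2
  · refine ⟨wmat u' p.1.1 p.1.1 - wmat u p.1.1 p.1.1, 0, hd _ _, by simpa using hβ, ?_⟩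
    have := wmat_update_self p.1.1 u u'
    have e : idx p.1.1 p.1.1 = p := by conv_rhs => rw [← idx_coe p, ← h]
    rw [e] at this
    rw [this, ← h]; simp
  · refine ⟨wmat u' p.1.1 p.1.2 - wmat u p.1.1 p.1.2,
      (starRingEnd ℂ) (wmat u' p.1.1 p.1.2 - wmat u p.1.1 p.1.2), hd _ _, ?_, ?_⟩
    · rw [RCLike.norm_conj]; exact hd _ _
    · have := wmat_update_of_ne h u u'
      rwa [idx_coe] at this

/-- Two families of matrices that depend on a Hermitian matrix `wmat u` like resolvents do; the
second family may instead be constant, which is the case `s = 0`. -/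
structure IsResPair (Λ : ℝ) (s : ℂ) (P Q : (Idx N → ℂ) → Matrix (Fin N) (Fin N) ℂ) : Prop where
  contP : Continuous P
  contQ : Continuous Q
  one_le : 1 ≤ Λ
  norm_s : ‖s‖ ≤ 1
  normP : ∀ u, ‖P u‖ ≤ Λ
  normQ : ∀ u, ‖Q u‖ ≤ Λ
  hP : ∀ u v, P v - P u = -(P u * (wmat v - wmat u) * P v)
  hQ : ∀ u v, Q v - Q u = -(s • (Q u * (wmat v - wmat u) * Q v))

variable {Λ : ℝ} {s : ℂ} {P Q : (Idx N → ℂ) → Matrix (Fin N) (Fin N) ℂ}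

lemma IsResPair.sub_eq (h : IsResPair Λ s P Q) (u v : Idx N → ℂ) :
    P v * Q v - P u * Q u = -(P u * (wmat v - wmat u) * (P v * Q v)) -
      s • (P u * Q u * (wmat v - wmat u) * Q v) := by
  have h1 : P v * Q v - P u * Q u = (P v - P u) * Q v + P u * (Q v - Q u) := by noncomm_ring
  rw [h1, h.hP u v, h.hQ u v]
  simp only [neg_mul, mul_neg, mul_smul_comm, mul_assoc]
  abel

/-- The exact second-order expansion of a product of two resolvents. -/
lemma IsResPair.expand (h : IsResPair Λ s P Q) (u v : Idx N → ℂ) :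
    P v * Q v = P u * Q u - P u * (wmat v - wmat u) * (P u * Q u) -
      s • (P u * Q u * (wmat v - wmat u) * Q u) +
      (P u * (wmat v - wmat u) * P u * (wmat v - wmat u) * (P v * Q v) +
       s • (P u * (wmat v - wmat u) * (P u * Q u) * (wmat v - wmat u) * Q v) +
       (s * s) • (P u * Q u * (wmat v - wmat u) * Q u * (wmat v - wmat u) * Q v)) := by
  have h1 := h.sub_eq u v
  have h2 := h.hQ u v
  generalize wmat v - wmat u = Δ at h1 h2 ⊢
  have e1 : P v * Q v = P u * Q u - P u * Δ * (P v * Q v) - s • (P u * Q u * Δ * Q v) := by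
    rw [sub_eq_iff_eq_add] at h1
    refine h1.trans ?_
    abel
  have e2 : Q v = Q u - s • (Q u * Δ * Q v) := by
    rw [sub_eq_iff_eq_add] at h2
    refine h2.trans ?_
    abel
  have e3 : P u * Δ * (P v * Q v) = P u * Δ * (P u * Q u) - P u * Δ * P u * Δ * (P v * Q v) -
      s • (P u * Δ * (P u * Q u) * Δ * Q v) := by
    refine (congrArg (fun X => P u * Δ * X) e1).trans ?_
    simp only [mul_sub, mul_smul_comm, mul_assoc]
  have e4 : P u * Q u * Δ * Q v = P u * Q u * Δ * Q u -
      s • (P u * Q u * Δ * Q u * Δ * Q v) := by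
    refine (congrArg (fun X => P u * Q u * Δ * X) e2).trans ?_
    simp only [mul_sub, mul_smul_comm, mul_assoc]
  refine e1.trans ?_
  rw [e3, e4]
  simp only [smul_sub, smul_smul]
  abel

lemma mul_single_mul_apply (X Y : Matrix (Fin N) (Fin N) ℂ) (i j k l : Fin N) (a : ℂ) :
    (X * Matrix.single i j a * Y) k l = X k i * a * Y j l := by
  rw [Matrix.mul_apply, Finset.sum_eq_single j]
  · rw [Matrix.mul_single_apply_same]
  · intro b _ hb
    rw [Matrix.mul_single_apply_of_ne _ _ _ _ _ hb, zero_mul]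
  · simp

lemma trace_single_mul (Y : Matrix (Fin N) (Fin N) ℂ) (i j : Fin N) (a : ℂ) :
    (Matrix.single i j a * Y).trace = a * Y j i := by
  have h := Matrix.trace_single_mul i j a Y
  simpa using h

lemma norm_single_add_single_le (i j : Fin N) {a b : ℂ} {t : ℝ} (ha : ‖a‖ ≤ t) (hb : ‖b‖ ≤ t) :
    ‖Matrix.single i j a + Matrix.single j i b‖ ≤ 2 * t := by
  have h1 : ∀ (i j : Fin N) (a : ℂ), ‖Matrix.single i j a‖ ≤ ‖a‖ := by
    intro i j a
    have h := norm_sq_le_sum_sq (Matrix.single i j a)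
    have e : ∑ k, ∑ l, ‖(Matrix.single i j a) k l‖ ^ 2 = ‖a‖ ^ 2 := by
      rw [Finset.sum_eq_single i]
      · rw [Finset.sum_eq_single j]
        · simp
        · intro l _ hl; simp [hl.symm]
        · simp
      · intro k _ hk
        refine Finset.sum_eq_zero fun l _ => ?_
        simp [hk.symm]
      · simp
    rw [e] at h
    exact (abs_le_of_sq_le_sq' h (norm_nonneg _)).2
  refine (norm_add_le _ _).trans ?_
  linarith [h1 i j a, h1 j i b]

lemma norm_trace_delta_le (Y : Matrix (Fin N) (Fin N) ℂ) (i j : Fin N) {a b : ℂ} {t : ℝ}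
    (ha : ‖a‖ ≤ t) (hb : ‖b‖ ≤ t) :
    ‖((Matrix.single i j a + Matrix.single j i b) * Y).trace‖ ≤ t * (‖Y i j‖ + ‖Y j i‖) := by
  rw [add_mul, Matrix.trace_add, trace_single_mul, trace_single_mul]
  refine (norm_add_le _ _).trans ?_
  rw [norm_mul, norm_mul, mul_add, add_comm]
  gcongr

lemma IsResPair.norm_PQ (h : IsResPair Λ s P Q) (u : Idx N → ℂ) : ‖P u * Q u‖ ≤ Λ ^ 2 := by
  rw [sq]
  exact (norm_mul_le _ _).trans (mul_le_mul (h.normP u) (h.normQ u) (norm_nonneg _)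
    (zero_le_one.trans h.one_le))

/-- The increment of `Tr (P Q)` when a single entry is resampled. -/
lemma IsResPair.norm_trace_sub_le (h : IsResPair Λ s P Q) {u u' : Idx N → ℂ} {β : ℝ}
    (hu : ∀ p, ‖u p‖ ≤ β) (hu' : ∀ p, ‖u' p‖ ≤ β) (p : Idx N) :
    ‖(P (Function.update u p (u' p)) * Q (Function.update u p (u' p))).trace -
      (P u * Q u).trace‖ ≤
      2 * β * (‖(P u * Q u * P u + s • (Q u * P u * Q u)) p.1.1 p.1.2‖ +
        ‖(P u * Q u * P u + s • (Q u * P u * Q u)) p.1.2 p.1.1‖) + 48 * β ^ 2 * Λ ^ 4 := by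
  obtain ⟨a, b, ha, hb, hΔ⟩ := exists_wmat_update hu hu' p
  have hβ : 0 ≤ β := (norm_nonneg _).trans (hu p)
  have hΛ : 0 ≤ Λ := zero_le_one.trans h.one_le
  set v := Function.update u p (u' p)
  set Y := P u * Q u * P u + s • (Q u * P u * Q u)
  set Δ := wmat v - wmat u
  have hΔn : ‖Δ‖ ≤ 2 * (2 * β) := by rw [hΔ]; exact norm_single_add_single_le _ _ ha hb
  have htr : ∀ Y : Matrix (Fin N) (Fin N) ℂ, ‖(Δ * Y).trace‖ ≤
      2 * β * (‖Y p.1.1 p.1.2‖ + ‖Y p.1.2 p.1.1‖) := fun Y => by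
    rw [hΔ]; exact norm_trace_delta_le Y _ _ ha hb
  have htr2 : ∀ Y Z : Matrix (Fin N) (Fin N) ℂ, ∀ c d : ℝ, ‖Y‖ ≤ c → ‖Z‖ ≤ d →
      ‖(Δ * (Y * Δ * Z)).trace‖ ≤ 16 * β ^ 2 * (c * d) := fun Y Z c d hc hd => by
    refine (htr _).trans ?_
    have hc0 := (norm_nonneg _).trans hc
    have hd0 := (norm_nonneg _).trans hd
    have h1 : ‖Y * Δ * Z‖ ≤ c * (2 * (2 * β)) * d := by
      refine (norm_mul_le _ _).trans ?_
      gcongr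
      exact (norm_mul_le _ _).trans (by gcongr)
    have h2 := (norm_entry_le (Y * Δ * Z) p.1.1 p.1.2).trans h1
    have h3 := (norm_entry_le (Y * Δ * Z) p.1.2 p.1.1).trans h1
    calc 2 * β * (‖(Y * Δ * Z) p.1.1 p.1.2‖ + ‖(Y * Δ * Z) p.1.2 p.1.1‖)
        ≤ 2 * β * (c * (2 * (2 * β)) * d + c * (2 * (2 * β)) * d) := by gcongr
      _ = _ := by ring
  have hcyc : ∀ X Z : Matrix (Fin N) (Fin N) ℂ, (X * Δ * Z).trace = (Δ * (Z * X)).trace :=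
    fun X Z => by rw [mul_assoc, Matrix.trace_mul_comm, mul_assoc]
  -- the first-order term and the three second-order terms of the expansion, cyclically permuted
  have e : (P v * Q v).trace - (P u * Q u).trace = -(Δ * Y).trace +
      ((Δ * (P u * Δ * (P v * Q v * P u))).trace +
       s * (Δ * (P u * Q u * Δ * (Q v * P u))).trace +
       (s * s) * (Δ * (Q u * Δ * (Q v * (P u * Q u)))).trace) := by
    rw [h.expand u v]
    simp only [Matrix.trace_add, Matrix.trace_sub, Matrix.trace_smul, smul_eq_mul, Y, mul_add,
      mul_smul_comm]
    have e1 : (P u * Δ * (P u * Q u)).trace = (Δ * (P u * Q u * P u)).trace := hcyc _ _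
    have e2 : (P u * Q u * Δ * Q u).trace = (Δ * (Q u * P u * Q u)).trace := by
      rw [hcyc, mul_assoc (Q u)]
    have e3 : (P u * Δ * P u * Δ * (P v * Q v)).trace =
        (Δ * (P u * Δ * (P v * Q v * P u))).trace := by
      have := hcyc (P u) (P u * Δ * (P v * Q v))
      simp only [mul_assoc] at this ⊢
      exact this
    have e4 : (P u * Δ * (P u * Q u) * Δ * Q v).trace =
        (Δ * (P u * Q u * Δ * (Q v * P u))).trace := by
      have := hcyc (P u) (P u * Q u * Δ * Q v)
      simp only [mul_assoc] at this ⊢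
      exact this
    have e5 : (P u * Q u * Δ * Q u * Δ * Q v).trace =
        (Δ * (Q u * Δ * (Q v * (P u * Q u)))).trace := by
      have := hcyc (P u * Q u) (Q u * Δ * Q v)
      simp only [mul_assoc] at this ⊢
      exact this
    rw [← h.expand u v, e1, e2, e3, e4, e5]
    ring
  have hs := h.norm_s
  have hss : ‖s * s‖ ≤ 1 := by rw [norm_mul]; nlinarith [norm_nonneg s]
  have nPQ := h.norm_PQ
  have b1 : ‖(Δ * (P u * Δ * (P v * Q v * P u))).trace‖ ≤ 16 * β ^ 2 * Λ ^ 4 := by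
    refine (htr2 _ _ Λ (Λ ^ 2 * Λ) (h.normP u) ?_).trans (le_of_eq (by ring))
    exact (norm_mul_le _ _).trans (mul_le_mul (nPQ v) (h.normP u) (norm_nonneg _) (by positivity))
  have b2 : ‖(Δ * (P u * Q u * Δ * (Q v * P u))).trace‖ ≤ 16 * β ^ 2 * Λ ^ 4 := by
    refine (htr2 _ _ (Λ ^ 2) (Λ * Λ) (nPQ u) ?_).trans (le_of_eq (by ring))
    exact (norm_mul_le _ _).trans (mul_le_mul (h.normQ v) (h.normP u) (norm_nonneg _) hΛ)
  have b3 : ‖(Δ * (Q u * Δ * (Q v * (P u * Q u)))).trace‖ ≤ 16 * β ^ 2 * Λ ^ 4 := by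
    refine (htr2 _ _ Λ (Λ * Λ ^ 2) (h.normQ u) ?_).trans (le_of_eq (by ring))
    exact (norm_mul_le _ _).trans (mul_le_mul (h.normQ v) (nPQ u) (norm_nonneg _) hΛ)
  rw [e]
  refine (norm_add_le _ _).trans ?_
  rw [norm_neg]
  refine add_le_add (htr Y) ?_
  refine (norm_add_le _ _).trans ?_
  have c2 : ‖s * (Δ * (P u * Q u * Δ * (Q v * P u))).trace‖ ≤ 16 * β ^ 2 * Λ ^ 4 := by
    rw [norm_mul]
    exact (mul_le_of_le_one_left (norm_nonneg _) hs).trans b2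
  have c3 : ‖s * s * (Δ * (Q u * Δ * (Q v * (P u * Q u)))).trace‖ ≤ 16 * β ^ 2 * Λ ^ 4 := by
    rw [norm_mul]
    exact (mul_le_of_le_one_left (norm_nonneg _) hss).trans b3
  have := norm_add_le (Δ * (P u * Δ * (P v * Q v * P u))).trace
    (s * (Δ * (P u * Q u * Δ * (Q v * P u))).trace)
  linarith

lemma sum_idx_le (f : Fin N → Fin N → ℝ) (hf : ∀ i j, 0 ≤ f i j) :
    ∑ p : Idx N, f p.1.1 p.1.2 ≤ ∑ i, ∑ j, f i j := by
  rw [← Fintype.sum_prod_type']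
  have e : ∑ p : Idx N, f p.1.1 p.1.2 =
      ∑ q ∈ Finset.univ.map (Function.Embedding.subtype fun p : Fin N × Fin N => p.1 ≤ p.2),
        f q.1 q.2 := by rw [Finset.sum_map]; rfl
  rw [e]
  exact Finset.sum_le_sum_of_subset_of_nonneg (Finset.subset_univ _) fun q _ _ => hf _ _

/-- The sum of the squared increments of `Tr (P Q)` under resampling is of order one: the
first-order increment at `(i, j)` is an entry of a bounded matrix `Y` times an entry of size
`β ~ N^{-1/2}`, and `∑ |Y i j|² ≤ N ‖Y‖²`. -/
lemma IsResPair.sum_sq_trace_sub_le (h : IsResPair Λ s P Q) {u u' : Idx N → ℂ} {β : ℝ}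
    (hβN : N * β ^ 2 ≤ Λ ^ 2) (hu : ∀ p, ‖u p‖ ≤ β) (hu' : ∀ p, ‖u' p‖ ≤ β) :
    ∑ p, ‖(P (Function.update u p (u' p)) * Q (Function.update u p (u' p))).trace -
      (P u * Q u).trace‖ ^ 2 ≤ 7200 * Λ ^ 12 := by
  have hΛ := h.one_le
  have hΛ0 : 0 ≤ Λ := zero_le_one.trans hΛ
  set Y := P u * Q u * P u + s • (Q u * P u * Q u) with hY
  have hYn : ‖Y‖ ≤ 2 * Λ ^ 3 := by
    have h1 : ‖P u * Q u * P u‖ ≤ Λ ^ 2 * Λ :=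
      (norm_mul_le _ _).trans (mul_le_mul (h.norm_PQ u) (h.normP u) (norm_nonneg _) (by positivity))
    have h2 : ‖Q u * P u * Q u‖ ≤ Λ * Λ ^ 2 := by
      rw [mul_assoc]
      exact (norm_mul_le _ _).trans (mul_le_mul (h.normQ u) (h.norm_PQ u) (norm_nonneg _) hΛ0)
    have h3 : ‖s • (Q u * P u * Q u)‖ ≤ Λ * Λ ^ 2 := by
      rw [norm_smul]
      exact (mul_le_of_le_one_left (norm_nonneg _) h.norm_s).trans h2
    calc ‖Y‖ ≤ Λ ^ 2 * Λ + Λ * Λ ^ 2 := (norm_add_le _ _).trans (add_le_add h1 h3)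
      _ = _ := by ring
  have hS : ∑ i, ∑ j, ‖Y i j‖ ^ 2 ≤ N * (4 * Λ ^ 6) := by
    refine (sum_sq_le Y).trans ?_
    have : ‖Y‖ ^ 2 ≤ (2 * Λ ^ 3) ^ 2 := pow_le_pow_left₀ (norm_nonneg _) hYn 2
    calc (N : ℝ) * ‖Y‖ ^ 2 ≤ N * (2 * Λ ^ 3) ^ 2 := by gcongr
      _ = _ := by ring
  have key : ∀ p : Idx N, ‖(P (Function.update u p (u' p)) * Q (Function.update u p (u' p))).trace -
      (P u * Q u).trace‖ ^ 2 ≤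
      (12 * β ^ 2 * (‖Y p.1.1 p.1.2‖ ^ 2 + ‖Y p.1.2 p.1.1‖ ^ 2) + 6912 * β ^ 4 * Λ ^ 8) := by
    intro p
    refine (pow_le_pow_left₀ (norm_nonneg _) (h.norm_trace_sub_le hu hu' p) 2).trans ?_
    rw [← hY]
    nlinarith [sq_nonneg (2 * β * ‖Y p.1.1 p.1.2‖ - 2 * β * ‖Y p.1.2 p.1.1‖),
      sq_nonneg (2 * β * ‖Y p.1.1 p.1.2‖ - 48 * β ^ 2 * Λ ^ 4),
      sq_nonneg (2 * β * ‖Y p.1.2 p.1.1‖ - 48 * β ^ 2 * Λ ^ 4)]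
  refine (Finset.sum_le_sum fun p _ => key p).trans ?_
  refine (sum_idx_le (fun i j => 12 * β ^ 2 * (‖Y i j‖ ^ 2 + ‖Y j i‖ ^ 2) + 6912 * β ^ 4 * Λ ^ 8)
    fun i j => by positivity).trans ?_
  have e : ∑ i : Fin N, ∑ j : Fin N, (12 * β ^ 2 * (‖Y i j‖ ^ 2 + ‖Y j i‖ ^ 2) +
      6912 * β ^ 4 * Λ ^ 8) = 24 * β ^ 2 * (∑ i, ∑ j, ‖Y i j‖ ^ 2) +
      N ^ 2 * (6912 * β ^ 4 * Λ ^ 8) := by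
    simp only [Finset.sum_add_distrib, ← Finset.mul_sum]
    rw [Finset.sum_comm (f := fun i j => ‖Y j i‖ ^ 2)]
    simp
    ring
  rw [e]
  calc 24 * β ^ 2 * (∑ i, ∑ j, ‖Y i j‖ ^ 2) + N ^ 2 * (6912 * β ^ 4 * Λ ^ 8)
      ≤ 24 * β ^ 2 * (N * (4 * Λ ^ 6)) + N ^ 2 * (6912 * β ^ 4 * Λ ^ 8) := by gcongr
    _ = 96 * Λ ^ 6 * (N * β ^ 2) + 6912 * Λ ^ 8 * (N * β ^ 2) ^ 2 := by ring
    _ ≤ 96 * Λ ^ 6 * Λ ^ 2 + 6912 * Λ ^ 8 * (Λ ^ 2) ^ 2 := by gcongr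
    _ = 96 * Λ ^ 8 + 6912 * Λ ^ 12 := by ring
    _ ≤ 96 * Λ ^ 12 + 6912 * Λ ^ 12 := by gcongr; norm_num
    _ ≤ 7200 * Λ ^ 12 := by nlinarith [pow_nonneg hΛ0 12]

end TwoResolvent
end

noncomputable section
namespace TwoResolvent
open scoped ComplexOrder Matrix Matrix.Norms.L2Operator

variable {N : ℕ}

/-! ### Cumulant expansion to second order -/

section Expansion

variable {Λ : ℝ} {s : ℂ} {P Q : (Idx N → ℂ) → Matrix (Fin N) (Fin N) ℂ}
  {A : Matrix (Fin N) (Fin N) ℂ} {u u' : Idx N → ℂ} {β : ℝ}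

lemma norm_wmat_update_sub_le (hu : ∀ p, ‖u p‖ ≤ β) (hu' : ∀ p, ‖u' p‖ ≤ β) (p : Idx N) :
    ‖wmat (Function.update u p (u' p)) - wmat u‖ ≤ 4 * β := by
  obtain ⟨a, b, ha, hb, h⟩ := exists_wmat_update hu hu' p
  rw [h]
  exact (norm_single_add_single_le _ _ ha hb).trans (le_of_eq (by ring))

lemma norm_mul_mul_le {X Y Z : Matrix (Fin N) (Fin N) ℂ} {a b c : ℝ} (hX : ‖X‖ ≤ a) (hY : ‖Y‖ ≤ b)
    (hZ : ‖Z‖ ≤ c) : ‖X * Y * Z‖ ≤ a * b * c := by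
  have ha := (norm_nonneg _).trans hX
  have hb := (norm_nonneg _).trans hY
  refine (norm_mul_le _ _).trans (mul_le_mul ((norm_mul_le _ _).trans ?_) hZ (norm_nonneg _)
    (mul_nonneg ha hb))
  exact mul_le_mul hX hY (norm_nonneg _) ha

/-- The entry `(j, i)` of `X Δ Y Δ Z` for a perturbation `Δ` of the entries `(i, j)` and `(j, i)`:
each term has a factor that is an off-diagonal entry. -/
lemma norm_mul_single_mul_single_apply_le {X Y Z : Matrix (Fin N) (Fin N) ℂ} {c t : ℝ}
    (hX : ‖X‖ ≤ c) (hY : ‖Y‖ ≤ c) (hZ : ‖Z‖ ≤ c) (i j : Fin N) {a b : ℂ} (ha : ‖a‖ ≤ t)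
    (hb : ‖b‖ ≤ t) :
    ‖(X * (Matrix.single i j a + Matrix.single j i b) * Y *
      (Matrix.single i j a + Matrix.single j i b) * Z) j i‖ ≤
      t ^ 2 * c ^ 2 * (2 * ‖X j i‖ + ‖Y i j‖ + ‖Z j i‖) := by
  have hc : 0 ≤ c := (norm_nonneg _).trans hX
  have ht : 0 ≤ t := (norm_nonneg _).trans ha
  have eX : ∀ k l, ‖X k l‖ ≤ c := fun k l => (norm_entry_le X k l).trans hX
  have eY : ∀ k l, ‖Y k l‖ ≤ c := fun k l => (norm_entry_le Y k l).trans hY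
  have eZ : ∀ k l, ‖Z k l‖ ≤ c := fun k l => (norm_entry_le Z k l).trans hZ
  have e : (X * (Matrix.single i j a + Matrix.single j i b) * Y *
      (Matrix.single i j a + Matrix.single j i b) * Z) j i =
      X j i * a * Y j i * a * Z j i + X j i * a * Y j j * b * Z i i +
      X j j * b * Y i i * a * Z j i + X j j * b * Y i j * b * Z i i := by
    simp only [mul_add, add_mul, Matrix.add_apply, mul_single_mul_apply]
    ring
  have gen : ∀ (x y z a b : ℂ), ‖a‖ ≤ t → ‖b‖ ≤ t → ‖x * a * y * b * z‖ ≤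
      t ^ 2 * (‖x‖ * ‖y‖ * ‖z‖) := by
    intro x y z a b ha hb
    simp only [norm_mul]
    calc ‖x‖ * ‖a‖ * ‖y‖ * ‖b‖ * ‖z‖ ≤ ‖x‖ * t * ‖y‖ * t * ‖z‖ := by gcongr
      _ = _ := by ring
  rw [e]
  have h1 : ‖X j i‖ * ‖Y j i‖ * ‖Z j i‖ ≤ ‖X j i‖ * c * c := by
    gcongr; exacts [eY _ _, eZ _ _]
  have h2 : ‖X j i‖ * ‖Y j j‖ * ‖Z i i‖ ≤ ‖X j i‖ * c * c := by
    gcongr; exacts [eY _ _, eZ _ _]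
  have h3 : ‖X j j‖ * ‖Y i i‖ * ‖Z j i‖ ≤ c * c * ‖Z j i‖ := by
    gcongr; exacts [eX _ _, eY _ _]
  have h4 : ‖X j j‖ * ‖Y i j‖ * ‖Z i i‖ ≤ c * ‖Y i j‖ * c := by
    gcongr; exacts [eX _ _, eZ _ _]
  calc _ ≤ t ^ 2 * (‖X j i‖ * ‖Y j i‖ * ‖Z j i‖) + t ^ 2 * (‖X j i‖ * ‖Y j j‖ * ‖Z i i‖) +
      t ^ 2 * (‖X j j‖ * ‖Y i i‖ * ‖Z j i‖) + t ^ 2 * (‖X j j‖ * ‖Y i j‖ * ‖Z i i‖) := by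
        refine (norm_add_le _ _).trans (add_le_add ((norm_add_le _ _).trans (add_le_add
          ((norm_add_le _ _).trans (add_le_add ?_ ?_)) ?_)) ?_)
        exacts [gen _ _ _ _ _ ha ha, gen _ _ _ _ _ ha hb, gen _ _ _ _ _ hb ha,
          gen _ _ _ _ _ hb hb]
    _ ≤ t ^ 2 * (‖X j i‖ * c * c) + t ^ 2 * (‖X j i‖ * c * c) +
      t ^ 2 * (c * c * ‖Z j i‖) + t ^ 2 * (c * ‖Y i j‖ * c) := by gcongr
    _ = _ := by ring

/-- The norm bounds for the products that occur in the expansion. -/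
lemma IsResPair.norm_bounds (h : IsResPair Λ s P Q) (hA : ‖A‖ ≤ Λ ^ 2) (u : Idx N → ℂ) :
    ‖P u‖ ≤ Λ ^ 4 ∧ ‖Q u‖ ≤ Λ ^ 4 ∧ ‖P u * Q u‖ ≤ Λ ^ 4 ∧ ‖P u * Q u * A‖ ≤ Λ ^ 4 ∧
      ‖Q u * A‖ ≤ Λ ^ 4 := by
  have hΛ := h.one_le
  have hΛ0 : 0 ≤ Λ := zero_le_one.trans hΛ
  have l1 : Λ ≤ Λ ^ 4 := le_self_pow₀ hΛ (by norm_num)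
  have l2 : Λ ^ 2 ≤ Λ ^ 4 := pow_le_pow_right₀ hΛ (by norm_num)
  have l3 : Λ * Λ ^ 2 ≤ Λ ^ 4 := by
    rw [← pow_succ']; exact pow_le_pow_right₀ hΛ (by norm_num)
  refine ⟨(h.normP u).trans l1, (h.normQ u).trans l1, (h.norm_PQ u).trans l2, ?_, ?_⟩
  · calc ‖P u * Q u * A‖ ≤ Λ * Λ * Λ ^ 2 := norm_mul_mul_le (h.normP u) (h.normQ u) hA
      _ = _ := by ring
  · exact ((norm_mul_le _ _).trans (mul_le_mul (h.normQ u) hA (norm_nonneg _) hΛ0)).trans l3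

lemma IsResPair.norm_Q_sub_le (h : IsResPair Λ s P Q) (hA : ‖A‖ ≤ Λ ^ 2)
    (hu : ∀ p, ‖u p‖ ≤ β) (hu' : ∀ p, ‖u' p‖ ≤ β) (p : Idx N) :
    ‖Q (Function.update u p (u' p)) * A - Q u * A‖ ≤ 4 * β * Λ ^ 8 := by
  set v := Function.update u p (u' p)
  have hβ : 0 ≤ β := (norm_nonneg _).trans (hu p)
  obtain ⟨-, b2, -, -, b5⟩ := h.norm_bounds hA u
  obtain ⟨-, -, -, -, c5⟩ := h.norm_bounds hA v
  rw [← sub_mul, h.hQ u v, neg_mul, norm_neg, smul_mul_assoc, norm_smul, mul_assoc]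
  refine (mul_le_of_le_one_left (norm_nonneg _) h.norm_s).trans ?_
  exact (norm_mul_mul_le b2 (norm_wmat_update_sub_le hu hu' p) c5).trans (le_of_eq (by ring))

lemma IsResPair.norm_PQ_sub_le (h : IsResPair Λ s P Q) (hA : ‖A‖ ≤ Λ ^ 2)
    (hu : ∀ p, ‖u p‖ ≤ β) (hu' : ∀ p, ‖u' p‖ ≤ β) (p : Idx N) :
    ‖P (Function.update u p (u' p)) * Q (Function.update u p (u' p)) * A - P u * Q u * A‖ ≤
      8 * β * Λ ^ 8 := by
  set v := Function.update u p (u' p)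
  have hβ : 0 ≤ β := (norm_nonneg _).trans (hu p)
  obtain ⟨b1, b2, b3, b4, b5⟩ := h.norm_bounds hA u
  obtain ⟨c1, c2, c3, c4, c5⟩ := h.norm_bounds hA v
  have hΔ := norm_wmat_update_sub_le hu hu' p
  have e : P v * Q v * A - P u * Q u * A = -(P u * (wmat v - wmat u) * (P v * Q v * A)) -
      s • (P u * Q u * (wmat v - wmat u) * (Q v * A)) := by
    rw [← sub_mul, h.sub_eq u v]
    simp only [sub_mul, neg_mul, smul_mul_assoc, mul_assoc]
  rw [e]
  refine (norm_sub_le _ _).trans ?_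
  rw [norm_neg, norm_smul]
  have h1 := norm_mul_mul_le b1 hΔ c4
  have h2 := (mul_le_of_le_one_left (norm_nonneg (P u * Q u * (wmat v - wmat u) * (Q v * A)))
    h.norm_s).trans (norm_mul_mul_le b3 hΔ c5)
  linarith

/-- The leading term of the second-order expansion of `w_{ij} K_{ji}`, where `K = P Q A`. -/
def mainTerm (s : ℂ) (P Q : (Idx N → ℂ) → Matrix (Fin N) (Fin N) ℂ)
    (A : Matrix (Fin N) (Fin N) ℂ) (i j : Fin N) (u : Idx N → ℂ) : ℂ :=
  P u j j * (P u * Q u * A) i i + s * ((P u * Q u) j j * (Q u * A) i i)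

/-- The difference between `w'_{ij} K_{ji}`, where the entry `(i, j)` has been resampled, and the
terms of its expansion that are not small. -/
def expansionRem (s : ℂ) (P Q : (Idx N → ℂ) → Matrix (Fin N) (Fin N) ℂ)
    (A : Matrix (Fin N) (Fin N) ℂ) (i j : Fin N) (u u' : Idx N → ℂ) : ℂ :=
  wmat u' i j * (P (Function.update u (idx i j) (u' (idx i j))) *
      Q (Function.update u (idx i j) (u' (idx i j))) * A) j i -
    wmat u' i j * ((P u * Q u * A) j i +
      (starRingEnd ℂ) (wmat u i j) * mainTerm s P Q A i j u) +
    wmat u' i j * (starRingEnd ℂ) (wmat u' i j) * mainTerm s P Q A i j u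

lemma IsResPair.norm_mainTerm_le (h : IsResPair Λ s P Q) (hA : ‖A‖ ≤ Λ ^ 2) (i j : Fin N)
    (u : Idx N → ℂ) : ‖mainTerm s P Q A i j u‖ ≤ 2 * Λ ^ 8 := by
  obtain ⟨b1, b2, b3, b4, b5⟩ := h.norm_bounds hA u
  have hΛ0 : 0 ≤ Λ := zero_le_one.trans h.one_le
  have gen : ∀ X Y : Matrix (Fin N) (Fin N) ℂ, ‖X‖ ≤ Λ ^ 4 → ‖Y‖ ≤ Λ ^ 4 →
      ‖X j j * Y i i‖ ≤ Λ ^ 8 := fun X Y hX hY => by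
    rw [norm_mul]
    calc ‖X j j‖ * ‖Y i i‖ ≤ Λ ^ 4 * Λ ^ 4 :=
          mul_le_mul ((norm_entry_le _ _ _).trans hX) ((norm_entry_le _ _ _).trans hY)
            (norm_nonneg _) (by positivity)
      _ = _ := by ring
  unfold mainTerm
  refine (norm_add_le _ _).trans ?_
  have h1 := gen _ _ b1 b4
  have h2 : ‖s * ((P u * Q u) j j * (Q u * A) i i)‖ ≤ Λ ^ 8 := by
    rw [norm_mul]
    exact (mul_le_of_le_one_left (norm_nonneg _) h.norm_s).trans (gen _ _ b3 b5)
  linarith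

/-- Off the diagonal, each term of the remainder carries either two small entries of the
perturbation and two off-diagonal matrix entries, or three and one, or four and none. -/
lemma IsResPair.norm_expansionRem_offdiag_le (h : IsResPair Λ s P Q) (hA : ‖A‖ ≤ Λ ^ 2)
    (hu : ∀ p, ‖u p‖ ≤ β) (hu' : ∀ p, ‖u' p‖ ≤ β) {i j : Fin N} (hij : i ≠ j) :
    ‖expansionRem s P Q A i j u u'‖ ≤
      2 * β ^ 2 * (‖P u j i‖ * ‖(P u * Q u * A) j i‖ + ‖(P u * Q u) j i‖ * ‖(Q u * A) j i‖) +
      4 * β ^ 3 * Λ ^ 8 * (4 * ‖P u j i‖ + ‖P u i j‖ + ‖(P u * Q u * A) j i‖ +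
        ‖(P u * Q u) i j‖ + 2 * ‖(Q u * A) j i‖ + 2 * ‖(P u * Q u) j i‖ + ‖Q u i j‖) +
      64 * β ^ 4 * Λ ^ 16 := by
  have hβ : 0 ≤ β := (norm_nonneg _).trans (hu (idx i j))
  have hΛ0 : 0 ≤ Λ := zero_le_one.trans h.one_le
  have hv : wmat (Function.update u (idx i j) (u' (idx i j))) - wmat u =
      Matrix.single i j (wmat u' i j - wmat u i j) +
        Matrix.single j i ((starRingEnd ℂ) (wmat u' i j - wmat u i j)) :=
    wmat_update_of_ne hij u u'
  have hKs := h.norm_PQ_sub_le hA hu hu' (idx i j)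
  have hQs := h.norm_Q_sub_le hA hu hu' (idx i j)
  unfold expansionRem
  set v := Function.update u (idx i j) (u' (idx i j))
  set e := wmat u' i j
  set d := wmat u i j
  set δ := e - d with hδ
  have he : ‖e‖ ≤ β := norm_wmat_apply_le hu' i j
  have hδn : ‖δ‖ ≤ 2 * β := (norm_sub_le _ _).trans
    (by linarith [norm_wmat_apply_le hu i j])
  have hδn' : ‖(starRingEnd ℂ) δ‖ ≤ 2 * β := by rwa [RCLike.norm_conj]
  set Δ := wmat v - wmat u with hΔ
  obtain ⟨b1, b2, b3, b4, b5⟩ := h.norm_bounds hA u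
  obtain ⟨c1, c2, c3, c4, c5⟩ := h.norm_bounds hA v
  -- the terms that are quadratic in the perturbation
  set R := P u * Δ * P u * Δ * (P v * Q v * A) + s • (P u * Δ * (P u * Q u) * Δ * (Q v * A)) +
       (s * s) • (P u * Q u * Δ * Q u * Δ * (Q v * A)) with hR
  have e1 : P v * Q v * A = P u * Q u * A - P u * Δ * (P u * Q u * A) -
      s • (P u * Q u * Δ * (Q u * A)) + R := by
    have := congrArg (fun X => X * A) (h.expand u v)
    refine this.trans ?_
    simp only [hR, add_mul, sub_mul, smul_mul_assoc, mul_assoc, Δ]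
  have e2 : (P v * Q v * A) j i = (P u * Q u * A) j i -
      (P u j i * δ * (P u * Q u * A) j i + P u j j * (starRingEnd ℂ) δ * (P u * Q u * A) i i) -
      s * ((P u * Q u) j i * δ * (Q u * A) j i +
        (P u * Q u) j j * (starRingEnd ℂ) δ * (Q u * A) i i) + R j i := by
    rw [e1, hv]
    simp only [mul_add, add_mul, Matrix.add_apply, Matrix.sub_apply, Matrix.smul_apply,
      smul_eq_mul, mul_single_mul_apply]
  have hconj : (starRingEnd ℂ) δ = (starRingEnd ℂ) e - (starRingEnd ℂ) d := map_sub _ _ _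
  have e3 : e * (P v * Q v * A) j i - e * ((P u * Q u * A) j i +
      (starRingEnd ℂ) d * mainTerm s P Q A i j u) +
      e * (starRingEnd ℂ) e * mainTerm s P Q A i j u =
      e * R j i - e * δ * (P u j i * (P u * Q u * A) j i +
        s * ((P u * Q u) j i * (Q u * A) j i)) := by
    rw [e2, hconj]
    unfold mainTerm
    ring
  rw [e3]
  have hs := h.norm_s
  have hss : ‖s * s‖ ≤ 1 := by rw [norm_mul]; nlinarith [norm_nonneg s]
  have r1 := norm_mul_single_mul_single_apply_le b1 b1 c4 i j hδn hδn'
  have r2 := norm_mul_single_mul_single_apply_le b1 b3 c5 i j hδn hδn'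
  have r3 := norm_mul_single_mul_single_apply_le b3 b2 c5 i j hδn hδn'
  rw [← hv] at r1 r2 r3
  -- The quadratic terms contain the perturbed matrices; replacing those by the original ones
  -- costs another factor `β`.
  have z1 : ‖(P v * Q v * A) j i‖ ≤ ‖(P u * Q u * A) j i‖ + 8 * β * Λ ^ 8 := by
    have := (norm_entry_le (P v * Q v * A - P u * Q u * A) j i).trans hKs
    rw [Matrix.sub_apply] at this
    linarith [norm_le_norm_add_norm_sub' ((P v * Q v * A) j i) ((P u * Q u * A) j i)]
  have z2 : ‖(Q v * A) j i‖ ≤ ‖(Q u * A) j i‖ + 4 * β * Λ ^ 8 := by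
    have := (norm_entry_le (Q v * A - Q u * A) j i).trans hQs
    rw [Matrix.sub_apply] at this
    linarith [norm_le_norm_add_norm_sub' ((Q v * A) j i) ((Q u * A) j i)]
  have hRn : ‖R j i‖ ≤ 4 * β ^ 2 * Λ ^ 8 * ((4 * ‖P u j i‖ + ‖P u i j‖ + ‖(P u * Q u * A) j i‖ +
        ‖(P u * Q u) i j‖ + 2 * ‖(Q u * A) j i‖ + 2 * ‖(P u * Q u) j i‖ + ‖Q u i j‖) +
        16 * β * Λ ^ 8) := by
    have : R j i = (P u * Δ * P u * Δ * (P v * Q v * A)) j i +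
        s * (P u * Δ * (P u * Q u) * Δ * (Q v * A)) j i +
        s * s * (P u * Q u * Δ * Q u * Δ * (Q v * A)) j i := by
      simp [hR, Matrix.add_apply, Matrix.smul_apply]
    rw [this]
    refine (norm_add_le _ _).trans ((add_le_add (norm_add_le _ _) le_rfl).trans ?_)
    rw [norm_mul s, norm_mul (s * s)]
    have r2' := (mul_le_of_le_one_left (norm_nonneg _) hs).trans r2
    have r3' := (mul_le_of_le_one_left (norm_nonneg _) hss).trans r3
    refine (add_le_add (add_le_add r1 r2') r3').trans ?_
    have e4 : (2 * β) ^ 2 * (Λ ^ 4) ^ 2 = 4 * β ^ 2 * Λ ^ 8 := by ring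
    rw [e4, ← mul_add, ← mul_add]
    refine mul_le_mul_of_nonneg_left ?_ (by positivity)
    linarith
  refine (norm_sub_le _ _).trans ?_
  have f1 : ‖e * R j i‖ ≤ β * (4 * β ^ 2 * Λ ^ 8 * ((4 * ‖P u j i‖ + ‖P u i j‖ +
        ‖(P u * Q u * A) j i‖ +
        ‖(P u * Q u) i j‖ + 2 * ‖(Q u * A) j i‖ + 2 * ‖(P u * Q u) j i‖ + ‖Q u i j‖) +
        16 * β * Λ ^ 8)) := by
    rw [norm_mul]
    exact mul_le_mul he hRn (norm_nonneg _) hβ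
  have f2 : ‖e * δ * (P u j i * (P u * Q u * A) j i + s * ((P u * Q u) j i * (Q u * A) j i))‖ ≤
      β * (2 * β) * (‖P u j i‖ * ‖(P u * Q u * A) j i‖ +
        ‖(P u * Q u) j i‖ * ‖(Q u * A) j i‖) := by
    rw [norm_mul, norm_mul]
    refine mul_le_mul (mul_le_mul he hδn (norm_nonneg _) hβ) ?_ (norm_nonneg _) (by positivity)
    refine (norm_add_le _ _).trans ?_
    rw [norm_mul, norm_mul s, norm_mul ((P u * Q u) j i)]
    have := mul_le_of_le_one_left (mul_nonneg (norm_nonneg ((P u * Q u) j i))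
      (norm_nonneg ((Q u * A) j i))) hs
    linarith
  refine (add_le_add f1 f2).trans (le_of_eq ?_)
  ring

/-- The cruder bound that is used on the diagonal. -/
lemma IsResPair.norm_expansionRem_le (h : IsResPair Λ s P Q) (hA : ‖A‖ ≤ Λ ^ 2)
    (hu : ∀ p, ‖u p‖ ≤ β) (hu' : ∀ p, ‖u' p‖ ≤ β) (i j : Fin N) :
    ‖expansionRem s P Q A i j u u'‖ ≤ 12 * β ^ 2 * Λ ^ 8 := by
  have hβ : 0 ≤ β := (norm_nonneg _).trans (hu (idx i j))
  have hΛ0 : 0 ≤ Λ := zero_le_one.trans h.one_le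
  have he : ‖wmat u' i j‖ ≤ β := norm_wmat_apply_le hu' i j
  have hd : ‖wmat u i j‖ ≤ β := norm_wmat_apply_le hu i j
  have hG := h.norm_mainTerm_le hA i j u
  have hK := (norm_entry_le _ j i).trans (h.norm_PQ_sub_le hA hu hu' (idx i j))
  unfold expansionRem
  set v := Function.update u (idx i j) (u' (idx i j))
  set e := wmat u' i j
  set d := wmat u i j
  set G := mainTerm s P Q A i j u
  have e1 : e * (P v * Q v * A) j i - e * ((P u * Q u * A) j i + (starRingEnd ℂ) d * G) +
      e * (starRingEnd ℂ) e * G = e * ((P v * Q v * A - P u * Q u * A) j i -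
        (starRingEnd ℂ) d * G + (starRingEnd ℂ) e * G) := by
    rw [Matrix.sub_apply]; ring
  rw [e1, norm_mul]
  have h2 : ∀ x : ℂ, ‖x‖ ≤ β → ‖(starRingEnd ℂ) x * G‖ ≤ β * (2 * Λ ^ 8) := fun x hx => by
    rw [norm_mul, RCLike.norm_conj]
    exact mul_le_mul hx hG (norm_nonneg _) hβ
  have h3 : ‖(P v * Q v * A - P u * Q u * A) j i - (starRingEnd ℂ) d * G +
      (starRingEnd ℂ) e * G‖ ≤ 8 * β * Λ ^ 8 + β * (2 * Λ ^ 8) + β * (2 * Λ ^ 8) :=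
    (norm_add_le _ _).trans (add_le_add ((norm_sub_le _ _).trans (add_le_add hK (h2 d hd)))
      (h2 e he))
  calc ‖e‖ * _ ≤ β * (8 * β * Λ ^ 8 + β * (2 * Λ ^ 8) + β * (2 * Λ ^ 8)) :=
        mul_le_mul he h3 (norm_nonneg _) hβ
    _ = _ := by ring

lemma sum_sum_norm_mul_le {X Y : Matrix (Fin N) (Fin N) ℂ} {c : ℝ} (hX : ‖X‖ ≤ c) (hY : ‖Y‖ ≤ c) :
    ∑ i, ∑ j, ‖X j i‖ * ‖Y j i‖ ≤ N * c ^ 2 := by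
  have h1 := sum_sq_le X
  have h2 := sum_sq_le Y
  have h3 : ∑ i, ∑ j, ‖X j i‖ * ‖Y j i‖ ≤
      ∑ i, ∑ j, (2⁻¹ * ‖X j i‖ ^ 2 + 2⁻¹ * ‖Y j i‖ ^ 2) := by
    gcongr with i _ j _
    nlinarith [sq_nonneg (‖X j i‖ - ‖Y j i‖)]
  have h4 : ∑ i, ∑ j, (2⁻¹ * ‖X j i‖ ^ 2 + 2⁻¹ * ‖Y j i‖ ^ 2) =
      2⁻¹ * ∑ i, ∑ j, ‖X i j‖ ^ 2 + 2⁻¹ * ∑ i, ∑ j, ‖Y i j‖ ^ 2 := by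
    rw [Finset.sum_comm]
    simp only [Finset.sum_add_distrib, Finset.mul_sum]
  have h5 : (N : ℝ) * ‖X‖ ^ 2 ≤ N * c ^ 2 := by gcongr
  have h6 : (N : ℝ) * ‖Y‖ ^ 2 ≤ N * c ^ 2 := by gcongr
  linarith

/-- The remainders of the expansion sum up to a quantity of order one. -/
lemma IsResPair.norm_sum_expansionRem_le (h : IsResPair Λ s P Q) (hA : ‖A‖ ≤ Λ ^ 2)
    (hβN : N * β ^ 2 ≤ Λ ^ 2)
    (hβ : 0 ≤ β) (hu : ∀ p, ‖u p‖ ≤ β) (hu' : ∀ p, ‖u' p‖ ≤ β) :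
    ‖∑ i, ∑ j, expansionRem s P Q A i j u u'‖ ≤ 150 * Λ ^ 32 := by
  have hΛ := h.one_le
  have hΛ0 : 0 ≤ Λ := zero_le_one.trans hΛ
  obtain ⟨b1, b2, b3, b4, b5⟩ := h.norm_bounds hA u
  set K := P u * Q u * A
  set PQ := P u * Q u
  set QA := Q u * A
  have hN0 : (0 : ℝ) ≤ N := Nat.cast_nonneg N
  have key : ∀ i j, ‖expansionRem s P Q A i j u u'‖ ≤
      2 * β ^ 2 * (‖P u j i‖ * ‖K j i‖ + ‖PQ j i‖ * ‖QA j i‖) +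
      4 * β ^ 3 * Λ ^ 8 * (4 * ‖P u j i‖ + ‖P u i j‖ + ‖K j i‖ +
        ‖PQ i j‖ + 2 * ‖QA j i‖ + 2 * ‖PQ j i‖ + ‖Q u i j‖) +
      64 * β ^ 4 * Λ ^ 16 + (if i = j then 12 * β ^ 2 * Λ ^ 8 else 0) := by
    intro i j
    by_cases hij : i = j
    · rw [if_pos hij]
      refine (h.norm_expansionRem_le hA hu hu' i j).trans ?_
      exact le_add_of_nonneg_left (by positivity)
    · rw [if_neg hij, add_zero]
      exact h.norm_expansionRem_offdiag_le hA hu hu' hij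
  have hT : ∀ X : Matrix (Fin N) (Fin N) ℂ, ∑ i, ∑ j, ‖X j i‖ = ∑ i, ∑ j, ‖X i j‖ := fun X =>
    Finset.sum_comm
  have hS : ∀ X : Matrix (Fin N) (Fin N) ℂ, ‖X‖ ≤ Λ ^ 4 →
      ∑ i, ∑ j, ‖X i j‖ ≤ N * √N * Λ ^ 4 := fun X hX =>
    (sum_norm_entry_le X).trans (by gcongr)
  have s1 := sum_sum_norm_mul_le b1 b4
  have s2 := sum_sum_norm_mul_le b3 b5
  have t1 := hS _ b1
  have t2 := hS _ b2
  have t3 := hS _ b3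
  have t4 := hS _ b4
  have t5 := hS _ b5
  refine (norm_sum_le _ _).trans ((Finset.sum_le_sum fun i _ => norm_sum_le _ _).trans
    ((Finset.sum_le_sum fun i _ => Finset.sum_le_sum fun j _ => key i j).trans ?_))
  have e : ∑ i, ∑ j, (2 * β ^ 2 * (‖P u j i‖ * ‖K j i‖ + ‖PQ j i‖ * ‖QA j i‖) +
      4 * β ^ 3 * Λ ^ 8 * (4 * ‖P u j i‖ + ‖P u i j‖ + ‖K j i‖ +
        ‖PQ i j‖ + 2 * ‖QA j i‖ + 2 * ‖PQ j i‖ + ‖Q u i j‖) +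
      64 * β ^ 4 * Λ ^ 16 + (if i = j then 12 * β ^ 2 * Λ ^ 8 else 0)) =
      2 * β ^ 2 * (∑ i, ∑ j, ‖P u j i‖ * ‖K j i‖ + ∑ i, ∑ j, ‖PQ j i‖ * ‖QA j i‖) +
      4 * β ^ 3 * Λ ^ 8 * (5 * ∑ i, ∑ j, ‖P u i j‖ + ∑ i, ∑ j, ‖K i j‖ +
        3 * ∑ i, ∑ j, ‖PQ i j‖ + 2 * ∑ i, ∑ j, ‖QA i j‖ + ∑ i, ∑ j, ‖Q u i j‖) +
      64 * β ^ 4 * Λ ^ 16 * N ^ 2 + 12 * β ^ 2 * Λ ^ 8 * N := by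
    simp only [Finset.sum_add_distrib, ← Finset.mul_sum, hT, Finset.sum_ite_eq,
      Finset.mem_univ, if_true, Finset.sum_const, Finset.card_univ, Fintype.card_fin,
      nsmul_eq_mul]
    ring
  rw [e]
  -- In terms of `x = √N β ≤ Λ` all powers of `N` cancel.
  set x := √N * β
  have hx0 : 0 ≤ x := by positivity
  have hx2 : x ^ 2 = N * β ^ 2 := by rw [mul_pow, Real.sq_sqrt hN0]
  have hx : x ≤ Λ := by
    refine (abs_le_of_sq_le_sq' ?_ hΛ0).2
    rw [hx2]; exact hβN
  have hx3 : β ^ 3 * (N * √N) = x ^ 3 := by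
    have : x ^ 3 = (√N) ^ 2 * √N * β ^ 3 := by ring
    rw [this, Real.sq_sqrt hN0]; ring
  calc _ ≤ 2 * β ^ 2 * (N * (Λ ^ 4) ^ 2 + N * (Λ ^ 4) ^ 2) +
      4 * β ^ 3 * Λ ^ 8 * (5 * (N * √N * Λ ^ 4) + N * √N * Λ ^ 4 +
        3 * (N * √N * Λ ^ 4) + 2 * (N * √N * Λ ^ 4) + N * √N * Λ ^ 4) +
      64 * β ^ 4 * Λ ^ 16 * N ^ 2 + 12 * β ^ 2 * Λ ^ 8 * N := by gcongr
    _ = 16 * (N * β ^ 2) * Λ ^ 8 + 48 * (β ^ 3 * (N * √N)) * Λ ^ 12 +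
      64 * (N * β ^ 2) ^ 2 * Λ ^ 16 := by ring
    _ = 16 * x ^ 2 * Λ ^ 8 + 48 * x ^ 3 * Λ ^ 12 + 64 * (x ^ 2) ^ 2 * Λ ^ 16 := by
      rw [hx3, hx2]
    _ ≤ 16 * Λ ^ 2 * Λ ^ 8 + 48 * Λ ^ 3 * Λ ^ 12 + 64 * (Λ ^ 2) ^ 2 * Λ ^ 16 := by gcongr
    _ = 16 * Λ ^ 10 + 48 * Λ ^ 15 + 64 * Λ ^ 20 := by ring
    _ ≤ 16 * Λ ^ 32 + 48 * Λ ^ 32 + 64 * Λ ^ 32 := by gcongr <;> norm_num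
    _ ≤ 150 * Λ ^ 32 := by nlinarith [pow_nonneg hΛ0 32]

end Expansion

end TwoResolvent
end

noncomputable section
namespace TwoResolvent
open scoped ComplexOrder Matrix Matrix.Norms.L2Operator

variable {N : ℕ}

/-! ### Expectations of the terms of the expansion -/

section Expectation

variable {Λ : ℝ} {s : ℂ} {P Q : (Idx N → ℂ) → Matrix (Fin N) (Fin N) ℂ}
  {A : Matrix (Fin N) (Fin N) ℂ} {β : ℝ} {ν : Idx N → Measure ℂ} [∀ p, IsProbabilityMeasure (ν p)]

lemma norm_integral_wmat_le (hβ : 0 ≤ β) (hν : EntryBounds N β ν) (i j : Fin N) :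
    ‖∫ x, wmat (clipAll β x) i j ∂(Measure.pi ν)‖ ≤ ((N : ℝ) ^ 2)⁻¹ := by
  have hm : ‖∫ x, clipAll β x (idx i j) ∂(Measure.pi ν)‖ ≤ ((N : ℝ) ^ 2)⁻¹ := by
    have : ∫ x, clipAll β x (idx i j) ∂(Measure.pi ν) = ∫ y, clip β y ∂(ν (idx i j)) :=
      integral_comp_eval (measurable_clip β).aestronglyMeasurable
    rw [this]
    exact hν.mean _
  have hint : Integrable (fun x => clipAll β x (idx i j)) (Measure.pi ν) :=
    integrable_clipAll hβ (F := fun u => u (idx i j)) (continuous_apply _)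
  simp only [wmat, Matrix.of_apply]
  split_ifs
  · exact hm
  · rw [integral_conj, RCLike.norm_conj]; exact hm
  · have : ∫ x, (((clipAll β x (idx i j)).re : ℝ) : ℂ) ∂(Measure.pi ν) =
        ((∫ x, clipAll β x (idx i j) ∂(Measure.pi ν)).re : ℂ) := by
      have e : (∫ x, clipAll β x (idx i j) ∂(Measure.pi ν)).re =
        ∫ x, (clipAll β x (idx i j)).re ∂(Measure.pi ν) := (integral_re hint).symm
      rw [e]; exact integral_ofReal
    rw [this, Complex.norm_real]
    exact (Complex.abs_re_le_norm _).trans hm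

lemma norm_integral_wmat_sq_sub_le (hν : EntryBounds N β ν) {i j : Fin N}
    (hij : i ≠ j) :
    ‖∫ x, wmat (clipAll β x) i j * (starRingEnd ℂ) (wmat (clipAll β x) i j) ∂(Measure.pi ν) -
      (N : ℂ)⁻¹‖ ≤ ((N : ℝ) ^ 2)⁻¹ := by
  have e : ∀ x : Idx N → ℂ, wmat (clipAll β x) i j * (starRingEnd ℂ) (wmat (clipAll β x) i j) =
      ((‖clip β (x (idx i j))‖ ^ 2 : ℝ) : ℂ) := by
    intro x
    rw [Complex.mul_conj']
    rcases lt_or_gt_of_ne hij with h | h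
    · simp [wmat, h, clipAll]
    · simp [wmat, h, h.not_gt, clipAll]
  simp only [e]
  have e2 : ∫ x : Idx N → ℂ, ((‖clip β (x (idx i j))‖ ^ 2 : ℝ) : ℂ) ∂(Measure.pi ν) =
      ((∫ y, ‖clip β y‖ ^ 2 ∂(ν (idx i j)) : ℝ) : ℂ) := by
    rw [← integral_comp_eval (μ := ν) (f := fun y => ‖clip β y‖ ^ 2)
      ((measurable_clip β).norm.pow_const 2).aestronglyMeasurable]
    exact integral_ofReal
  rw [e2]
  have hp : (idx i j).1.1 ≠ (idx i j).1.2 := idx_ne hij.symm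
  have h1 := hν.var_le _ hp
  have h2 := hν.le_var _ hp
  have : (N : ℂ)⁻¹ = (((N : ℝ)⁻¹ : ℝ) : ℂ) := by push_cast; rfl
  rw [this, ← Complex.ofReal_sub, Complex.norm_real, Real.norm_eq_abs, abs_le]
  have : (0 : ℝ) ≤ ((N : ℝ) ^ 2)⁻¹ := by positivity
  constructor <;> linarith

lemma norm_clipAll_le (hβ : 0 ≤ β) (x : Idx N → ℂ) (p : Idx N) : ‖clipAll β x p‖ ≤ β :=
  norm_clip_le hβ _

lemma norm_integral_le_const {X : Type*} [MeasurableSpace X] {m : Measure X}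
    [IsProbabilityMeasure m] {f : X → ℂ} {C : ℝ} (h : ∀ x, ‖f x‖ ≤ C) : ‖∫ x, f x ∂m‖ ≤ C := by
  have := norm_integral_le_of_norm_le_const (μ := m) (f := f) (C := C) (Eventually.of_forall h)
  simpa using this

/-- The crude bound that is used on the diagonal, where the variance is not prescribed. -/
lemma norm_integral_wmat_sq_sub_le' (hβ : 0 ≤ β) (i j : Fin N) :
    ‖∫ x, wmat (clipAll β x) i j * (starRingEnd ℂ) (wmat (clipAll β x) i j) ∂(Measure.pi ν) -
      (N : ℂ)⁻¹‖ ≤ β ^ 2 + (N : ℝ)⁻¹ := by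
  refine (norm_sub_le _ _).trans (add_le_add (norm_integral_le_const fun x => ?_) ?_)
  · rw [norm_mul, RCLike.norm_conj, sq]
    have := norm_wmat_apply_le (norm_clipAll_le hβ x) i j
    exact mul_le_mul this this (norm_nonneg _) hβ
  · simp

lemma integrable_clipAll_prod {E : Type*} [NormedAddCommGroup E] [MeasurableSpace E]
    [BorelSpace E] [SecondCountableTopology E] (hβ : 0 ≤ β)
    {m : Measure ((Idx N → ℂ) × (Idx N → ℂ))} [IsFiniteMeasure m]
    {F : (Idx N → ℂ) × (Idx N → ℂ) → E} (hF : Continuous F) :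
    Integrable (fun z => F (clipAll β z.1, clipAll β z.2)) m := by
  have hK := isCompact_univ_pi fun _ : Idx N => isCompact_closedBall (0 : ℂ) β
  refine integrable_comp_of_isCompact (g := fun z : (Idx N → ℂ) × (Idx N → ℂ) =>
    (clipAll β z.1, clipAll β z.2)) (((measurable_clipAll β).comp measurable_fst).prodMk
      ((measurable_clipAll β).comp measurable_snd)) (hK.prod hK) (fun z => ?_) hF
  refine ⟨fun p _ => ?_, fun p _ => ?_⟩ <;>
  · rw [mem_closedBall_zero_iff]
    exact norm_clip_le hβ _

lemma clipAll_update (x x' : Idx N → ℂ) (p : Idx N) :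
    clipAll β (Function.update x p (x' p)) =
      Function.update (clipAll β x) p (clipAll β x' p) := by
  ext q
  by_cases h : q = p
  · subst h; simp [clipAll]
  · simp [clipAll, Function.update_of_ne h]

lemma wmat_update_apply (u u' : Idx N → ℂ) (i j : Fin N) :
    wmat (Function.update u (idx i j) (u' (idx i j))) i j = wmat u' i j := by
  simp [wmat]

lemma IsResPair.continuous_entry (h : IsResPair Λ s P Q) (i j : Fin N) :
    Continuous fun u => (P u * Q u * A) i j :=
  ((h.contP.mul h.contQ).mul continuous_const).matrix_elem i j

lemma continuous_wmat_apply (i j : Fin N) : Continuous fun u : Idx N → ℂ => wmat u i j :=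
  continuous_wmat.matrix_elem i j

lemma IsResPair.continuous_mainTerm (h : IsResPair Λ s P Q) (i j : Fin N) :
    Continuous (mainTerm s P Q A i j) := by
  unfold mainTerm
  exact ((h.contP.matrix_elem j j).mul (h.continuous_entry i i)).add
    (continuous_const.mul (((h.contP.mul h.contQ).matrix_elem j j).mul
      ((h.contQ.mul continuous_const).matrix_elem i i)))

/-- The expectation of `w_{ij} K_{ji}` does not change if the entry `(i, j)` is resampled. -/
lemma IsResPair.integral_resample (h : IsResPair Λ s P Q) (i j : Fin N) :
    ∫ x, wmat (clipAll β x) i j * (P (clipAll β x) * Q (clipAll β x) * A) j i ∂(Measure.pi ν) =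
    ∫ z, wmat (clipAll β z.2) i j *
      (P (Function.update (clipAll β z.1) (idx i j) (clipAll β z.2 (idx i j))) *
        Q (Function.update (clipAll β z.1) (idx i j) (clipAll β z.2 (idx i j))) * A) j i
      ∂((Measure.pi ν).prod (Measure.pi ν)) := by
  set f : (Idx N → ℂ) → ℂ := fun u => wmat u i j * (P u * Q u * A) j i with hf
  have hc : Continuous f := (continuous_wmat_apply i j).mul (h.continuous_entry j i)
  have h1 := integral_swapOn (ν := ν) {idx i j} (fun z => f (clipAll β z.1))
    (hc.measurable.comp ((measurable_clipAll β).comp measurable_fst))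
  have h2 : ∫ z, f (clipAll β z.1) ∂((Measure.pi ν).prod (Measure.pi ν)) =
      ∫ x, f (clipAll β x) ∂(Measure.pi ν) := by
    rw [integral_fun_fst (fun x => f (clipAll β x))]; simp
  refine (h2.symm.trans h1.symm).trans ?_
  congr 1
  ext z
  have e : (swapOn {idx i j} z).1 = Function.update z.1 (idx i j) (z.2 (idx i j)) := by
    simp [swapOn, Finset.piecewise_singleton]
  rw [e, clipAll_update, hf]
  simp only [wmat_update_apply]

/-- The expectation of the remainder. The resampled entry is independent of the original matrix,
so that the expectations of the other terms factorize. -/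
lemma IsResPair.integral_expansionRem (h : IsResPair Λ s P Q) (hβ : 0 ≤ β) (i j : Fin N) :
    ∫ z, expansionRem s P Q A i j (clipAll β z.1) (clipAll β z.2)
      ∂((Measure.pi ν).prod (Measure.pi ν)) =
    ∫ x, wmat (clipAll β x) i j * (P (clipAll β x) * Q (clipAll β x) * A) j i ∂(Measure.pi ν) -
    (∫ x, wmat (clipAll β x) i j ∂(Measure.pi ν)) *
      (∫ x, ((P (clipAll β x) * Q (clipAll β x) * A) j i +
        (starRingEnd ℂ) (wmat (clipAll β x) i j) * mainTerm s P Q A i j (clipAll β x))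
        ∂(Measure.pi ν)) +
    (∫ x, wmat (clipAll β x) i j * (starRingEnd ℂ) (wmat (clipAll β x) i j) ∂(Measure.pi ν)) *
      ∫ x, mainTerm s P Q A i j (clipAll β x) ∂(Measure.pi ν) := by
  have cw : Continuous fun z : (Idx N → ℂ) × (Idx N → ℂ) => wmat z.2 i j :=
    (continuous_wmat_apply i j).comp continuous_snd
  have cw1 : Continuous fun z : (Idx N → ℂ) × (Idx N → ℂ) => wmat z.1 i j :=
    (continuous_wmat_apply i j).comp continuous_fst
  have cup : Continuous fun z : (Idx N → ℂ) × (Idx N → ℂ) =>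
      Function.update z.1 (idx i j) (z.2 (idx i j)) :=
    continuous_fst.update _ ((continuous_apply _).comp continuous_snd)
  have cK : Continuous fun z : (Idx N → ℂ) × (Idx N → ℂ) => (P z.1 * Q z.1 * A) j i :=
    (h.continuous_entry j i).comp continuous_fst
  have cM : Continuous fun z : (Idx N → ℂ) × (Idx N → ℂ) => mainTerm s P Q A i j z.1 :=
    (h.continuous_mainTerm i j).comp continuous_fst
  have i1 := integrable_clipAll_prod (m := (Measure.pi ν).prod (Measure.pi ν)) hβ
    (cw.mul ((h.continuous_entry (A := A) j i).comp cup))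
  have i2 := integrable_clipAll_prod (m := (Measure.pi ν).prod (Measure.pi ν)) hβ
    (cw.mul (cK.add ((Complex.continuous_conj.comp cw1).mul cM)))
  have i3 := integrable_clipAll_prod (m := (Measure.pi ν).prod (Measure.pi ν)) hβ
    ((cw.mul (Complex.continuous_conj.comp cw)).mul cM)
  rw [h.integral_resample i j]
  unfold expansionRem
  refine (integral_add (i1.sub i2) i3).trans ?_
  refine congrArg₂ (· + ·) ((integral_sub i1 i2).trans (congrArg₂ (· - ·) rfl ?_)) ?_
  · have := integral_prod_mul (μ := Measure.pi ν) (ν := Measure.pi ν)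
      (fun x => ((P (clipAll β x) * Q (clipAll β x) * A) j i +
        (starRingEnd ℂ) (wmat (clipAll β x) i j) * mainTerm s P Q A i j (clipAll β x)))
      (fun x => wmat (clipAll β x) i j)
    rw [mul_comm (∫ x, wmat (clipAll β x) i j ∂(Measure.pi ν)), ← this]
    refine integral_congr_ae (Eventually.of_forall fun z => ?_)
    exact mul_comm _ _
  · have := integral_prod_mul (μ := Measure.pi ν) (ν := Measure.pi ν)
      (fun x => mainTerm s P Q A i j (clipAll β x))
      (fun x => wmat (clipAll β x) i j * (starRingEnd ℂ) (wmat (clipAll β x) i j))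
    refine Eq.trans ?_ (this.trans (mul_comm _ _))
    refine integral_congr_ae (Eventually.of_forall fun z => ?_)
    exact mul_comm _ _

lemma sum_mainTerm (u : Idx N → ℂ) :
    (N : ℂ)⁻¹ * ((N : ℂ)⁻¹ * ∑ i, ∑ j, mainTerm s P Q A i j u) =
      ntr (P u) * ntr (P u * Q u * A) + s * (ntr (P u * Q u) * ntr (Q u * A)) := by
  unfold mainTerm ntr Matrix.trace
  simp only [Finset.sum_add_distrib, ← Finset.mul_sum, ← Finset.sum_mul, Matrix.diag_apply]
  ring

lemma ntr_mul_eq_sum (X Y : Matrix (Fin N) (Fin N) ℂ) :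
    ntr (X * Y) = (N : ℂ)⁻¹ * ∑ i, ∑ j, X i j * Y j i := by
  simp [ntr, Matrix.trace, Matrix.mul_apply]

/-- The second-order cumulant expansion of `E ⟨W P Q A⟩`, before self-averaging is used. -/
lemma IsResPair.norm_integral_ntr_add_le (h : IsResPair Λ s P Q) (hA : ‖A‖ ≤ Λ ^ 2) (hN : 0 < N)
    (hβ : 0 ≤ β) (hβN : N * β ^ 2 ≤ Λ ^ 2) (hν : EntryBounds N β ν) :
    ‖∫ x, ntr (tmat β x * (P (clipAll β x) * Q (clipAll β x) * A)) ∂(Measure.pi ν) +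
      ∫ x, (ntr (P (clipAll β x)) * ntr (P (clipAll β x) * Q (clipAll β x) * A) +
        s * (ntr (P (clipAll β x) * Q (clipAll β x)) * ntr (Q (clipAll β x) * A)))
        ∂(Measure.pi ν)‖ ≤ 200 * Λ ^ 32 / N := by
  have hΛ := h.one_le
  have hΛ0 : 0 ≤ Λ := zero_le_one.trans hΛ
  have hN1 : (1 : ℝ) ≤ N := by exact_mod_cast hN
  have hN0 : (0 : ℝ) < N := by linarith
  have hβΛ : β ≤ Λ := (abs_le_of_sq_le_sq' (by nlinarith [sq_nonneg β]) hΛ0).2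
  set T : Fin N → Fin N → ℂ := fun i j =>
    ∫ x, wmat (clipAll β x) i j * (P (clipAll β x) * Q (clipAll β x) * A) j i ∂(Measure.pi ν)
  set M : Fin N → Fin N → ℂ := fun i j => ∫ x, wmat (clipAll β x) i j ∂(Measure.pi ν)
  set F : Fin N → Fin N → ℂ := fun i j => ∫ x, ((P (clipAll β x) * Q (clipAll β x) * A) j i +
        (starRingEnd ℂ) (wmat (clipAll β x) i j) * mainTerm s P Q A i j (clipAll β x))
        ∂(Measure.pi ν)
  set S : Fin N → Fin N → ℂ := fun i j =>
    ∫ x, wmat (clipAll β x) i j * (starRingEnd ℂ) (wmat (clipAll β x) i j) ∂(Measure.pi ν)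
  set G : Fin N → Fin N → ℂ := fun i j =>
    ∫ x, mainTerm s P Q A i j (clipAll β x) ∂(Measure.pi ν)
  have hrem : ‖∑ i, ∑ j, (T i j - M i j * F i j + S i j * G i j)‖ ≤ 150 * Λ ^ 32 := by
    have e : ∑ i, ∑ j, (T i j - M i j * F i j + S i j * G i j) =
        ∫ z, (∑ i, ∑ j, expansionRem s P Q A i j (clipAll β z.1) (clipAll β z.2))
          ∂((Measure.pi ν).prod (Measure.pi ν)) := by
      have hi : ∀ i j, Integrable (fun z : (Idx N → ℂ) × (Idx N → ℂ) =>
          expansionRem s P Q A i j (clipAll β z.1) (clipAll β z.2))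
          ((Measure.pi ν).prod (Measure.pi ν)) := by
        intro i j
        refine integrable_clipAll_prod hβ (F := fun z => expansionRem s P Q A i j z.1 z.2) ?_
        have cw : Continuous fun z : (Idx N → ℂ) × (Idx N → ℂ) => wmat z.2 i j :=
          (continuous_wmat_apply i j).comp continuous_snd
        have cw1 : Continuous fun z : (Idx N → ℂ) × (Idx N → ℂ) => wmat z.1 i j :=
          (continuous_wmat_apply i j).comp continuous_fst
        have cup : Continuous fun z : (Idx N → ℂ) × (Idx N → ℂ) =>
            Function.update z.1 (idx i j) (z.2 (idx i j)) :=
          continuous_fst.update _ ((continuous_apply _).comp continuous_snd)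
        have cK : Continuous fun z : (Idx N → ℂ) × (Idx N → ℂ) => (P z.1 * Q z.1 * A) j i :=
          (h.continuous_entry j i).comp continuous_fst
        have cM : Continuous fun z : (Idx N → ℂ) × (Idx N → ℂ) => mainTerm s P Q A i j z.1 :=
          (h.continuous_mainTerm i j).comp continuous_fst
        exact ((cw.mul ((h.continuous_entry (A := A) j i).comp cup)).sub
          (cw.mul (cK.add ((Complex.continuous_conj.comp cw1).mul cM)))).add
          ((cw.mul (Complex.continuous_conj.comp cw)).mul cM)
      rw [integral_finsetSum _ fun i _ => integrable_finsetSum _ fun j _ => hi i j]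
      refine Finset.sum_congr rfl fun i _ => ?_
      rw [integral_finsetSum _ fun j _ => hi i j]
      exact Finset.sum_congr rfl fun j _ => (h.integral_expansionRem hβ i j).symm
    rw [e]
    exact norm_integral_le_const fun z => h.norm_sum_expansionRem_le hA hβN hβ
      (norm_clipAll_le hβ _) (norm_clipAll_le hβ _)
  have hF : ∀ i j, ‖F i j‖ ≤ 3 * Λ ^ 32 := fun i j => by
    refine norm_integral_le_const fun x => ?_
    refine (norm_add_le _ _).trans ?_
    obtain ⟨-, -, -, b4, -⟩ := h.norm_bounds hA (clipAll β x)
    have h1 := (norm_entry_le _ j i).trans b4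
    have h2 : ‖(starRingEnd ℂ) (wmat (clipAll β x) i j) * mainTerm s P Q A i j (clipAll β x)‖ ≤
        Λ * (2 * Λ ^ 8) := by
      rw [norm_mul, RCLike.norm_conj]
      exact mul_le_mul ((norm_wmat_apply_le (norm_clipAll_le hβ x) i j).trans hβΛ)
        (h.norm_mainTerm_le hA i j _) (norm_nonneg _) hΛ0
    have h3 : Λ ^ 4 ≤ Λ ^ 32 := pow_le_pow_right₀ hΛ (by norm_num)
    have h4 : Λ ^ 9 ≤ Λ ^ 32 := pow_le_pow_right₀ hΛ (by norm_num)
    have h5 : Λ * (2 * Λ ^ 8) = 2 * Λ ^ 9 := by ring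
    linarith
  have hG : ∀ i j, ‖G i j‖ ≤ 2 * Λ ^ 8 := fun i j =>
    norm_integral_le_const fun x => h.norm_mainTerm_le hA i j _
  -- the entries are almost centered
  have hMF : ‖∑ i, ∑ j, M i j * F i j‖ ≤ 3 * Λ ^ 32 := by
    have h1 : ∀ i j, ‖M i j * F i j‖ ≤ ((N : ℝ) ^ 2)⁻¹ * (3 * Λ ^ 32) := fun i j => by
      rw [norm_mul]
      exact mul_le_mul (norm_integral_wmat_le hβ hν i j) (hF i j) (norm_nonneg _) (by positivity)
    refine (norm_sum_le _ _).trans ((Finset.sum_le_sum fun i _ => (norm_sum_le _ _).trans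
      (Finset.sum_le_sum fun j _ => h1 i j)).trans (le_of_eq ?_))
    simp only [Finset.sum_const, Finset.card_univ, Fintype.card_fin, nsmul_eq_mul]
    field_simp
  -- the variances are almost `N⁻¹`, except on the diagonal, which has only `N` entries
  have hSG : ‖∑ i, ∑ j, ((N : ℂ)⁻¹ - S i j) * G i j‖ ≤ 6 * Λ ^ 32 := by
    have h1 : ∀ i j, ‖((N : ℂ)⁻¹ - S i j) * G i j‖ ≤ ((N : ℝ) ^ 2)⁻¹ * (2 * Λ ^ 8) +
        (if i = j then (β ^ 2 + (N : ℝ)⁻¹) * (2 * Λ ^ 8) else 0) := fun i j => by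
      rw [norm_mul, norm_sub_rev]
      by_cases hij : i = j
      · rw [if_pos hij]
        refine le_trans ?_ (le_add_of_nonneg_left (by positivity))
        exact mul_le_mul (norm_integral_wmat_sq_sub_le' hβ i j) (hG i j) (norm_nonneg _)
          (by positivity)
      · rw [if_neg hij, add_zero]
        exact mul_le_mul (norm_integral_wmat_sq_sub_le hν hij) (hG i j) (norm_nonneg _)
          (by positivity)
    refine (norm_sum_le _ _).trans ((Finset.sum_le_sum fun i _ => (norm_sum_le _ _).trans
      (Finset.sum_le_sum fun j _ => h1 i j)).trans ?_)
    simp only [Finset.sum_add_distrib, Finset.sum_const, Finset.card_univ, Fintype.card_fin,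
      nsmul_eq_mul, Finset.sum_ite_eq, Finset.mem_univ, if_true]
    have e : (N : ℝ) * (N * (((N : ℝ) ^ 2)⁻¹ * (2 * Λ ^ 8))) +
        N * ((β ^ 2 + (N : ℝ)⁻¹) * (2 * Λ ^ 8)) = 4 * Λ ^ 8 + 2 * Λ ^ 8 * (N * β ^ 2) := by
      field_simp; ring
    rw [e]
    have h3 : Λ ^ 8 ≤ Λ ^ 32 := pow_le_pow_right₀ hΛ (by norm_num)
    have h4 : Λ ^ 10 ≤ Λ ^ 32 := pow_le_pow_right₀ hΛ (by norm_num)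
    calc 4 * Λ ^ 8 + 2 * Λ ^ 8 * (N * β ^ 2) ≤ 4 * Λ ^ 8 + 2 * Λ ^ 8 * Λ ^ 2 := by gcongr
      _ = 4 * Λ ^ 8 + 2 * Λ ^ 10 := by ring
      _ ≤ _ := by linarith
  have e1 : ∫ x, ntr (tmat β x * (P (clipAll β x) * Q (clipAll β x) * A)) ∂(Measure.pi ν) =
      (N : ℂ)⁻¹ * ∑ i, ∑ j, T i j := by
    simp only [ntr_mul_eq_sum]
    rw [integral_const_mul]
    have hi : ∀ i j, Integrable (fun x => tmat β x i j *
        (P (clipAll β x) * Q (clipAll β x) * A) j i) (Measure.pi ν) := fun i j =>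
      integrable_clipAll hβ (F := fun u => wmat u i j * (P u * Q u * A) j i)
        ((continuous_wmat_apply i j).mul (h.continuous_entry j i))
    rw [integral_finsetSum _ fun i _ => integrable_finsetSum _ fun j _ => hi i j]
    congr 1
    refine Finset.sum_congr rfl fun i _ => ?_
    rw [integral_finsetSum _ fun j _ => hi i j]
    rfl
  have e2 : ∫ x, (ntr (P (clipAll β x)) * ntr (P (clipAll β x) * Q (clipAll β x) * A) +
        s * (ntr (P (clipAll β x) * Q (clipAll β x)) * ntr (Q (clipAll β x) * A)))
        ∂(Measure.pi ν) = (N : ℂ)⁻¹ * ((N : ℂ)⁻¹ * ∑ i, ∑ j, G i j) := by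
    simp only [← sum_mainTerm]
    rw [integral_const_mul, integral_const_mul]
    have hi : ∀ i j, Integrable (fun x => mainTerm s P Q A i j (clipAll β x)) (Measure.pi ν) :=
      fun i j => integrable_clipAll hβ (h.continuous_mainTerm i j)
    rw [integral_finsetSum _ fun i _ => integrable_finsetSum _ fun j _ => hi i j]
    congr 2
    refine Finset.sum_congr rfl fun i _ => ?_
    rw [integral_finsetSum _ fun j _ => hi i j]
  rw [e1, e2, ← mul_add]
  have e3 : ∑ i, ∑ j, T i j + (N : ℂ)⁻¹ * ∑ i, ∑ j, G i j =
      ∑ i, ∑ j, (T i j - M i j * F i j + S i j * G i j) + ∑ i, ∑ j, M i j * F i j +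
      ∑ i, ∑ j, ((N : ℂ)⁻¹ - S i j) * G i j := by
    simp only [Finset.mul_sum, ← Finset.sum_add_distrib]
    refine Finset.sum_congr rfl fun i _ => Finset.sum_congr rfl fun j _ => ?_
    ring
  rw [e3, norm_mul, norm_inv, Complex.norm_natCast, inv_mul_eq_div]
  gcongr
  refine (norm_add_le _ _).trans ((add_le_add (norm_add_le _ _) le_rfl).trans ?_)
  nlinarith [pow_nonneg hΛ0 32]

end Expectation

end TwoResolvent
end

noncomputable section
namespace TwoResolvent
open scoped ComplexOrder Matrix Matrix.Norms.L2Operator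

variable {N : ℕ}

/-! ### Self-averaging and the decoupled expansion -/

section SelfAveraging

variable {Λ : ℝ} {s : ℂ} {P Q : (Idx N → ℂ) → Matrix (Fin N) (Fin N) ℂ}
  {A : Matrix (Fin N) (Fin N) ℂ} {β : ℝ} {ν : Idx N → Measure ℂ} [∀ p, IsProbabilityMeasure (ν p)]

/-- The expectation of a function of the truncated entries. -/
def expect (β : ℝ) (ν : Idx N → Measure ℂ) [∀ p, IsProbabilityMeasure (ν p)]
    (F : (Idx N → ℂ) → ℂ) : ℂ :=
  ∫ x, F (clipAll β x) ∂(Measure.pi ν)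

lemma expect_add (hβ : 0 ≤ β) {F G : (Idx N → ℂ) → ℂ} (hF : Continuous F) (hG : Continuous G) :
    expect β ν (fun u => F u + G u) = expect β ν F + expect β ν G :=
  integral_add (integrable_clipAll hβ hF) (integrable_clipAll hβ hG)

lemma expect_const_mul (c : ℂ) (F : (Idx N → ℂ) → ℂ) :
    expect β ν (fun u => c * F u) = c * expect β ν F :=
  integral_const_mul _ _

lemma expect_const (c : ℂ) : expect β ν (fun _ => c) = c := by simp [expect]

lemma norm_expect_le {F : (Idx N → ℂ) → ℂ} {C : ℝ} (h : ∀ u, ‖F u‖ ≤ C) : ‖expect β ν F‖ ≤ C :=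
  norm_integral_le_const fun _ => h _

/-- The first absolute moment and the tail of a real function whose summed squared increments
are bounded. -/
lemma selfAveraging_re (hβ : 0 ≤ β) {f : (Idx N → ℂ) → ℝ} (hf : Continuous f) {V : ℝ}
    (hV0 : 0 ≤ V) (hV : ∀ u u' : Idx N → ℂ, (∀ p, ‖u p‖ ≤ β) → (∀ p, ‖u' p‖ ≤ β) →
      ∑ p, (f (Function.update u p (u' p)) - f u) ^ 2 ≤ V) :
    ∫ x, |f (clipAll β x) - ∫ y, f (clipAll β y) ∂(Measure.pi ν)| ∂(Measure.pi ν) ≤ (1 + V) / 2 ∧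
    ∀ (j : ℕ) {t : ℝ}, 0 < t →
      Measure.pi ν {x | t ≤ |f (clipAll β x) - ∫ y, f (clipAll β y) ∂(Measure.pi ν)|} ≤
        ENNReal.ofReal (momentConst j * (V / t ^ 2) ^ (2 ^ j)) := by
  set g : (Idx N → ℂ) → ℝ := fun x => f (clipAll β x) with hg
  have hgm : Measurable g := hf.measurable.comp (measurable_clipAll β)
  obtain ⟨C, hC⟩ := (isCompact_univ_pi fun _ : Idx N =>
    isCompact_closedBall (0 : ℂ) β).exists_bound_of_continuousOn hf.continuousOn
  have hgC : ∀ x, |g x| ≤ C := fun x => hC _ fun p _ => by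
    rw [mem_closedBall_zero_iff]; exact norm_clip_le hβ _
  have hgV : ∀ x x' : Idx N → ℂ, ∑ k, (g x - g (Function.update x k (x' k))) ^ 2 ≤ V := fun x x' => by
    refine le_trans (le_of_eq ?_) (hV _ _ (norm_clipAll_le hβ x) (norm_clipAll_le hβ x'))
    refine Finset.sum_congr rfl fun k _ => ?_
    simp only [hg, clipAll_update]
    ring
  refine ⟨?_, fun j t ht => concentration hgm hgC hV0 hgV j ht⟩
  set e := ∫ y, g y ∂(Measure.pi ν)
  have hgi : Integrable g (Measure.pi ν) := integrable_of_bdd hgm C hgC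
  have hYm : Measurable fun x => g x - e := hgm.sub measurable_const
  have hYC : ∀ x, |g x - e| ≤ C + |e| := fun x => (abs_sub _ _).trans (by linarith [hgC x])
  have h1 := dyadic_moment_le (ν := ν) hYm hYC hV0 (fun x x' => by simpa using hgV x x')
    (by rw [integral_sub hgi (integrable_const _)]; simp [e]) 0
  simp only [momentConst, zero_add, pow_one, pow_zero, one_mul] at h1
  have i1 : Integrable (fun x => |g x - e|) (Measure.pi ν) :=
    integrable_of_bdd hYm.abs (C + |e|) fun x => by
      rw [Real.norm_eq_abs, abs_abs]; exact hYC x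
  have i2 : Integrable (fun x => (g x - e) ^ 2) (Measure.pi ν) :=
    integrable_of_bdd (hYm.pow_const 2) ((C + |e|) ^ 2) fun x => by
      rw [Real.norm_eq_abs, abs_pow]; exact pow_le_pow_left₀ (abs_nonneg _) (hYC x) 2
  -- `|t| ≤ (1 + t²) / 2`
  calc ∫ x, |g x - e| ∂(Measure.pi ν) ≤ ∫ x, (2⁻¹ + 2⁻¹ * (g x - e) ^ 2) ∂(Measure.pi ν) := by
        refine integral_mono i1 ((integrable_const _).add (i2.const_mul _)) fun x => ?_
        simp only
        nlinarith [sq_nonneg (|g x - e| - 1), sq_abs (g x - e)]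
    _ = 2⁻¹ + 2⁻¹ * ∫ x, (g x - e) ^ 2 ∂(Measure.pi ν) := by
        rw [integral_add (integrable_const _) (i2.const_mul _), integral_const_mul]; simp
    _ ≤ (1 + V) / 2 := by linarith

/-- A complex function whose summed squared increments are bounded is close to its mean. -/
lemma selfAveraging (hβ : 0 ≤ β) {F : (Idx N → ℂ) → ℂ} (hF : Continuous F) {V : ℝ}
    (hV0 : 0 ≤ V) (hV : ∀ u u' : Idx N → ℂ, (∀ p, ‖u p‖ ≤ β) → (∀ p, ‖u' p‖ ≤ β) →
      ∑ p, ‖F (Function.update u p (u' p)) - F u‖ ^ 2 ≤ V) :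
    ∫ x, ‖F (clipAll β x) - expect β ν F‖ ∂(Measure.pi ν) ≤ 1 + V ∧
    ∀ (j : ℕ) {t : ℝ}, 0 < t → Measure.pi ν {x | t ≤ ‖F (clipAll β x) - expect β ν F‖} ≤
      2 * ENNReal.ofReal (momentConst j * (V / (t / 2) ^ 2) ^ (2 ^ j)) := by
  have hi : Integrable (fun x => F (clipAll β x)) (Measure.pi ν) := integrable_clipAll hβ hF
  have ere : (expect β ν F).re = ∫ x, (F (clipAll β x)).re ∂(Measure.pi ν) := (integral_re hi).symm
  have eim : (expect β ν F).im = ∫ x, (F (clipAll β x)).im ∂(Measure.pi ν) := (integral_im hi).symm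
  obtain ⟨a1, a2⟩ := selfAveraging_re (ν := ν) hβ (Complex.continuous_re.comp hF) hV0
    fun u u' hu hu' => by
      refine le_trans (Finset.sum_le_sum fun p _ => ?_) (hV u u' hu hu')
      simp only [Function.comp, ← Complex.sub_re]
      rw [← sq_abs]
      exact pow_le_pow_left₀ (abs_nonneg _) (Complex.abs_re_le_norm _) 2
  obtain ⟨b1, b2⟩ := selfAveraging_re (ν := ν) hβ (Complex.continuous_im.comp hF) hV0
    fun u u' hu hu' => by
      refine le_trans (Finset.sum_le_sum fun p _ => ?_) (hV u u' hu hu')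
      simp only [Function.comp, ← Complex.sub_im]
      rw [← sq_abs]
      exact pow_le_pow_left₀ (abs_nonneg _) (Complex.abs_im_le_norm _) 2
  simp only [Function.comp, ← ere, ← eim, ← Complex.sub_re, ← Complex.sub_im] at a1 a2 b1 b2
  constructor
  · have i0 : ∀ G : (Idx N → ℂ) → ℝ, Continuous G →
        Integrable (fun x => G (clipAll β x)) (Measure.pi ν) := fun G hG =>
      integrable_clipAll hβ hG
    have c0 : Continuous fun u => F u - expect β ν F := hF.sub continuous_const
    have i1 := i0 _ (Complex.continuous_re.comp c0).abs
    have i2 := i0 _ (Complex.continuous_im.comp c0).abs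
    calc ∫ x, ‖F (clipAll β x) - expect β ν F‖ ∂(Measure.pi ν) ≤
        ∫ x, (|(F (clipAll β x) - expect β ν F).re| + |(F (clipAll β x) - expect β ν F).im|)
          ∂(Measure.pi ν) :=
          integral_mono (i0 _ c0.norm) (i1.add i2) fun x => Complex.norm_le_abs_re_add_abs_im _
      _ ≤ _ := by
        refine (le_of_eq (integral_add i1 i2)).trans ?_
        refine (add_le_add a1 b1).trans (le_of_eq (by ring))
  · intro j t ht
    have hsub : {x | t ≤ ‖F (clipAll β x) - expect β ν F‖} ⊆
        {x | t / 2 ≤ |(F (clipAll β x) - expect β ν F).re|} ∪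
        {x | t / 2 ≤ |(F (clipAll β x) - expect β ν F).im|} := by
      intro x hx
      by_contra hc
      simp only [Set.mem_union, Set.mem_ofPred_eq, not_or, not_le] at hc hx
      have := Complex.norm_le_abs_re_add_abs_im (F (clipAll β x) - expect β ν F)
      linarith
    refine (measure_mono hsub).trans ((measure_union_le _ _).trans ?_)
    rw [two_mul]
    exact add_le_add (a2 j (half_pos ht)) (b2 j (half_pos ht))

/-- The traces of the two families of a pair are self-averaging. -/
lemma IsResPair.selfAveraging_ntr (h : IsResPair Λ s P Q) (hN : 0 < N) (hβ : 0 ≤ β)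
    (hβN : N * β ^ 2 ≤ Λ ^ 2) :
    ∫ x, ‖ntr (P (clipAll β x) * Q (clipAll β x)) - expect β ν fun u => ntr (P u * Q u)‖
      ∂(Measure.pi ν) ≤ 8000 * Λ ^ 12 / N ∧
    ∀ (j : ℕ) {t : ℝ}, 0 < t → Measure.pi ν {x | t ≤
      ‖ntr (P (clipAll β x) * Q (clipAll β x)) - expect β ν fun u => ntr (P u * Q u)‖} ≤
      2 * ENNReal.ofReal (momentConst j * (7200 * Λ ^ 12 / (N * t / 2) ^ 2) ^ (2 ^ j)) := by
  have hN0 : (0 : ℝ) < N := by exact_mod_cast hN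
  have hΛ0 : 0 ≤ Λ := zero_le_one.trans h.one_le
  have hc : Continuous fun u => (P u * Q u).trace := (h.contP.mul h.contQ).matrix_trace
  obtain ⟨a1, a2⟩ := selfAveraging (ν := ν) hβ hc (V := 7200 * Λ ^ 12) (by positivity)
    fun u u' hu hu' => h.sum_sq_trace_sub_le hβN hu hu'
  have e1 : (expect β ν fun u => ntr (P u * Q u)) =
      (N : ℂ)⁻¹ * expect β ν fun u => (P u * Q u).trace := expect_const_mul _ _
  have e2 : ∀ x : Idx N → ℂ, ‖ntr (P (clipAll β x) * Q (clipAll β x)) -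
      expect β ν fun u => ntr (P u * Q u)‖ = (N : ℝ)⁻¹ *
      ‖(P (clipAll β x) * Q (clipAll β x)).trace - expect β ν fun u => (P u * Q u).trace‖ :=
    fun x => by
      rw [e1, ntr, ← mul_sub, norm_mul, norm_inv, Complex.norm_natCast]
  constructor
  · simp only [e2]
    rw [integral_const_mul, inv_mul_eq_div]
    gcongr
    refine a1.trans ?_
    have := one_le_pow₀ h.one_le (n := 12)
    linarith
  · intro j t ht
    have hs : {x : Idx N → ℂ | t ≤ ‖ntr (P (clipAll β x) * Q (clipAll β x)) -
        expect β ν fun u => ntr (P u * Q u)‖} = {x | N * t ≤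
        ‖(P (clipAll β x) * Q (clipAll β x)).trace - expect β ν fun u => (P u * Q u).trace‖} := by
      ext x
      rw [Set.mem_ofPred_eq, Set.mem_ofPred_eq, e2, le_inv_mul_iff₀ hN0]
    rw [hs]
    exact a2 j (by positivity)

/-- A self-averaging factor may be replaced by its mean. -/
lemma norm_expect_mul_sub_le (hβ : 0 ≤ β) {F G : (Idx N → ℂ) → ℂ} (hF : Continuous F)
    (hG : Continuous G) {C : ℝ} (hC : ∀ u, ‖G u‖ ≤ C) {t : ℝ}
    (ht : ∫ x, ‖F (clipAll β x) - expect β ν F‖ ∂(Measure.pi ν) ≤ t) :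
    ‖expect β ν (fun u => F u * G u) - expect β ν F * expect β ν G‖ ≤ t * C := by
  have hC0 : 0 ≤ C := (norm_nonneg _).trans (hC 0)
  have e : expect β ν (fun u => F u * G u) - expect β ν F * expect β ν G =
      expect β ν fun u => (F u - expect β ν F) * G u := by
    rw [← expect_const_mul, sub_eq_iff_eq_add]
    refine Eq.trans ?_ (expect_add hβ (F := fun u => (F u - expect β ν F) * G u)
      (G := fun u => expect β ν F * G u) ((hF.sub continuous_const).mul hG)
      (continuous_const.mul hG))
    congr 1; ext u; ring
  rw [e]
  have i1 : Integrable (fun x => ‖F (clipAll β x) - expect β ν F‖) (Measure.pi ν) :=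
    integrable_clipAll hβ (F := fun u => ‖F u - expect β ν F‖) (hF.sub continuous_const).norm
  calc _ ≤ ∫ x, ‖F (clipAll β x) - expect β ν F‖ * C ∂(Measure.pi ν) := by
        refine norm_integral_le_of_norm_le (i1.mul_const _) (Eventually.of_forall fun x => ?_)
        rw [norm_mul]
        exact mul_le_mul_of_nonneg_left (hC _) (norm_nonneg _)
    _ ≤ t * C := by rw [integral_mul_const]; gcongr

lemma norm_one_le_one : ‖(1 : Matrix (Fin N) (Fin N) ℂ)‖ ≤ 1 := by
  rw [← Matrix.diagonal_one, Matrix.l2_opNorm_diagonal, pi_norm_le_iff_of_nonneg zero_le_one]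
  intro i; simp

/-- The first family of a pair, on its own. -/
lemma IsResPair.fst (h : IsResPair Λ s P Q) : IsResPair Λ 0 P fun _ => 1 where
  contP := h.contP
  contQ := continuous_const
  one_le := h.one_le
  norm_s := by simp
  normP := h.normP
  normQ := fun _ => norm_one_le_one.trans h.one_le
  hP := h.hP
  hQ := by simp

/-- The expectation of `⟨W P Q A⟩`, with the expectations of products of traces factorized. -/
lemma IsResPair.norm_expect_ntr_add_le (h : IsResPair Λ s P Q) (hA : ‖A‖ ≤ Λ ^ 2) (hN : 0 < N)
    (hβ : 0 ≤ β) (hβN : N * β ^ 2 ≤ Λ ^ 2) (hν : EntryBounds N β ν) :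
    ‖expect β ν (fun u => ntr (wmat u * (P u * Q u * A))) +
      (expect β ν (fun u => ntr (P u)) * expect β ν (fun u => ntr (P u * Q u * A)) +
      s * (expect β ν (fun u => ntr (P u * Q u)) * expect β ν (fun u => ntr (Q u * A))))‖ ≤
      20000 * Λ ^ 32 / N := by
  have hΛ := h.one_le
  have hΛ0 : 0 ≤ Λ := zero_le_one.trans hΛ
  have hN0 : (0 : ℝ) < N := by exact_mod_cast hN
  have h0 := h.norm_integral_ntr_add_le hA hN hβ hβN hν
  have s1 := (h.fst.selfAveraging_ntr (ν := ν) hN hβ hβN).1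
  have s2 := (h.selfAveraging_ntr (ν := ν) hN hβ hβN).1
  simp only [mul_one] at s1
  have cP : Continuous fun u => ntr (P u) := continuous_ntr.comp h.contP
  have cPQ : Continuous fun u => ntr (P u * Q u) := continuous_ntr.comp (h.contP.mul h.contQ)
  have cK : Continuous fun u => ntr (P u * Q u * A) :=
    continuous_ntr.comp ((h.contP.mul h.contQ).mul continuous_const)
  have cQ : Continuous fun u => ntr (Q u * A) :=
    continuous_ntr.comp (h.contQ.mul continuous_const)
  have d1 := norm_expect_mul_sub_le hβ cP cK (C := Λ ^ 4)
    (fun u => (norm_ntr_le _).trans (h.norm_bounds hA u).2.2.2.1) s1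
  have d2 := norm_expect_mul_sub_le hβ cPQ cQ (C := Λ ^ 4)
    (fun u => (norm_ntr_le _).trans (h.norm_bounds hA u).2.2.2.2) s2
  have d2' := (mul_le_of_le_one_left (norm_nonneg _) h.norm_s).trans d2
  rw [← norm_mul] at d2'
  have e0 : ∫ x, (ntr (P (clipAll β x)) * ntr (P (clipAll β x) * Q (clipAll β x) * A) +
        s * (ntr (P (clipAll β x) * Q (clipAll β x)) * ntr (Q (clipAll β x) * A)))
        ∂(Measure.pi ν) = expect β ν (fun u => ntr (P u) * ntr (P u * Q u * A)) +
        s * expect β ν (fun u => ntr (P u * Q u) * ntr (Q u * A)) := by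
    rw [← expect_const_mul]
    exact expect_add hβ (F := fun u => ntr (P u) * ntr (P u * Q u * A))
      (G := fun u => s * (ntr (P u * Q u) * ntr (Q u * A))) (cP.mul cK)
      (continuous_const.mul (cPQ.mul cQ))
  rw [e0] at h0
  change ‖expect β ν (fun u => ntr (wmat u * (P u * Q u * A))) + _‖ ≤ _ at h0
  set a := expect β ν (fun u => ntr (wmat u * (P u * Q u * A)))
  set b := expect β ν (fun u => ntr (P u) * ntr (P u * Q u * A))
  set b' := expect β ν (fun u => ntr (P u)) * expect β ν (fun u => ntr (P u * Q u * A))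
  set c := expect β ν (fun u => ntr (P u * Q u) * ntr (Q u * A))
  set c' := expect β ν (fun u => ntr (P u * Q u)) * expect β ν (fun u => ntr (Q u * A))
  have e : a + (b' + s * c') = (a + (b + s * c)) - (b - b') - s * (c - c') := by ring
  rw [e]
  refine (norm_sub_le _ _).trans ((add_le_add ((norm_sub_le _ _).trans
    (add_le_add h0 d1)) d2').trans ?_)
  have l1 : Λ ^ 16 ≤ Λ ^ 32 := pow_le_pow_right₀ hΛ (by norm_num)
  have e2 : 200 * Λ ^ 32 / N + 8000 * Λ ^ 12 / N * Λ ^ 4 + 8000 * Λ ^ 12 / N * Λ ^ 4 =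
      (200 * Λ ^ 32 + 16000 * Λ ^ 16) / N := by ring
  rw [e2]
  gcongr
  nlinarith [pow_nonneg hΛ0 32]

end SelfAveraging

/-! ### Resolvents of the random matrix -/

/-- The resolvent of `D + wmat u`. -/
def res (D : Matrix (Fin N) (Fin N) ℂ) (z : ℂ) (u : Idx N → ℂ) : Matrix (Fin N) (Fin N) ℂ :=
  resolvent (D + wmat u) z

section Resolvents

variable {D D₁ D₂ : Matrix (Fin N) (Fin N) ℂ} {z z₁ z₂ : ℂ} {Λ : ℝ}

lemma isUnit_res (hD : D.IsHermitian) (hz : z.im ≠ 0) (u : Idx N → ℂ) :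
    IsUnit (D + wmat u - z • 1) :=
  (resolvent_bound_im (hD.add (wmat_isHermitian u)) hz).1

lemma norm_res_le (hD : D.IsHermitian) (hz : z.im ≠ 0) (u : Idx N → ℂ) :
    ‖res D z u‖ ≤ |z.im|⁻¹ :=
  (resolvent_bound_im (hD.add (wmat_isHermitian u)) hz).2

lemma res_sub (hD : D.IsHermitian) (hz : z.im ≠ 0) (u v : Idx N → ℂ) :
    res D z v - res D z u = -(res D z u * (wmat v - wmat u) * res D z v) := by
  have h := resolvent_sub (isUnit_res hD hz u) (isUnit_res hD hz v)
  rw [sub_self, zero_smul, add_zero, add_sub_add_left_eq_sub] at h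
  rw [← neg_sub, res, res, h]

lemma continuous_res (hD : D.IsHermitian) (hz : z.im ≠ 0) : Continuous (res D z) := by
  rw [continuous_iff_continuousAt]
  intro u
  rw [ContinuousAt, tendsto_iff_norm_sub_tendsto_zero]
  have h1 : Tendsto (fun v => |z.im|⁻¹ * ‖wmat v - wmat u‖ * |z.im|⁻¹) (𝓝 u) (𝓝 0) := by
    have : Continuous fun v => |z.im|⁻¹ * ‖wmat v - wmat u‖ * |z.im|⁻¹ :=
      (continuous_const.mul (continuous_wmat.sub continuous_const).norm).mul continuous_const
    have h := this.tendsto u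
    simpa using h
  refine squeeze_zero (fun _ => norm_nonneg _) (fun v => ?_) h1
  rw [res_sub hD hz, norm_neg]
  exact norm_mul_mul_le (norm_res_le hD hz u) le_rfl (norm_res_le hD hz v)

/-- A pair of resolvents at spectral parameters away from the real line. -/
lemma isResPair_res (hD₁ : D₁.IsHermitian) (hD₂ : D₂.IsHermitian) (hΛ : 1 ≤ Λ)
    (h₁ : Λ⁻¹ ≤ |z₁.im|) (h₂ : Λ⁻¹ ≤ |z₂.im|) :
    IsResPair Λ 1 (res D₁ z₁ : (Idx N → ℂ) → _) (res D₂ z₂) := by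
  have hΛ0 : 0 < Λ⁻¹ := by positivity
  have n1 : z₁.im ≠ 0 := abs_pos.mp (hΛ0.trans_le h₁)
  have n2 : z₂.im ≠ 0 := abs_pos.mp (hΛ0.trans_le h₂)
  refine ⟨continuous_res hD₁ n1, continuous_res hD₂ n2, hΛ, by simp, fun u => ?_, fun u => ?_,
    res_sub hD₁ n1, fun u v => ?_⟩
  · exact (norm_res_le hD₁ n1 u).trans (inv_le_of_inv_le₀ (by positivity) h₁)
  · exact (norm_res_le hD₂ n2 u).trans (inv_le_of_inv_le₀ (by positivity) h₂)
  · rw [one_smul]; exact res_sub hD₂ n2 u v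

end Resolvents

end TwoResolvent
end

noncomputable section
namespace TwoResolvent
open scoped ComplexOrder Matrix Matrix.Norms.L2Operator

variable {N : ℕ}

/-! ### The law in expectation -/

section Law

variable {D D₁ D₂ : Matrix (Fin N) (Fin N) ℂ} {z z₁ z₂ w : ℂ} {Λ : ℝ} {s : ℂ}
  {Q : (Idx N → ℂ) → Matrix (Fin N) (Fin N) ℂ} {A : Matrix (Fin N) (Fin N) ℂ}
  {β : ℝ} {ν : Idx N → Measure ℂ} [∀ p, IsProbabilityMeasure (ν p)]

/-- `z + E ⟨G(z)⟩`, the random counterpart of `dysonPt`. -/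
def meanPt (β : ℝ) (ν : Idx N → Measure ℂ) [∀ p, IsProbabilityMeasure (ν p)]
    (D : Matrix (Fin N) (Fin N) ℂ) (z : ℂ) : ℂ :=
  z + expect β ν fun u => ntr (res D z u)

/-- Averaging preserves the sign of the imaginary part of `⟨G⟩`, so that `meanPt` lies on the
side of `z` and further away from the real line. -/
lemma im_meanPt (hD : D.IsHermitian) (hz : z.im ≠ 0) (hβ : 0 ≤ β) :
    |z.im| ≤ |(meanPt β ν D z).im| ∧ 0 < z.im * (meanPt β ν D z).im := by
  have hc : Continuous fun u : Idx N → ℂ => ntr (res D z u) :=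
    continuous_ntr.comp (continuous_res hD hz)
  have hi : Integrable (fun x => ntr (res D z (clipAll β x))) (Measure.pi ν) :=
    integrable_clipAll hβ hc
  have e : (expect β ν fun u => ntr (res D z u)).im =
      ∫ x, (ntr (res D z (clipAll β x))).im ∂(Measure.pi ν) := (integral_im hi).symm
  have h0 : 0 ≤ z.im * (expect β ν fun u => ntr (res D z u)).im := by
    rw [e, ← integral_const_mul]
    refine integral_nonneg fun x => ?_
    simp only [Pi.zero_apply]
    unfold res
    rw [resolvent_im (hD.add (wmat_isHermitian _)) hz, ← mul_assoc]
    exact mul_nonneg (mul_self_nonneg _) (nhs_nonneg _)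
  have hz2 : 0 < z.im * z.im := mul_self_pos.mpr hz
  unfold meanPt
  rw [Complex.add_im]
  set g := (expect β ν fun u => ntr (res D z u)).im
  refine ⟨sq_le_sq.mp ?_, ?_⟩
  · nlinarith [sq_nonneg g]
  · rw [mul_add]; linarith

lemma resolvent_meanPt_bounds (hD : D.IsHermitian) (hβ : 0 ≤ β) (hΛ : 1 ≤ Λ)
    (hz : Λ⁻¹ ≤ |z.im|) : IsUnit (D - meanPt β ν D z • 1) ∧ ‖resolvent D (meanPt β ν D z)‖ ≤ Λ := by
  have hΛ0 : 0 < Λ⁻¹ := by positivity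
  have hz0 : z.im ≠ 0 := abs_pos.mp (hΛ0.trans_le hz)
  obtain ⟨h1, h2⟩ := im_meanPt (ν := ν) hD hz0 hβ
  have hw : (meanPt β ν D z).im ≠ 0 := fun h => by rw [h] at h2; simp at h2
  obtain ⟨h3, h4⟩ := resolvent_bound_im hD hw
  exact ⟨h3, h4.trans (inv_le_of_inv_le₀ (by positivity) (hz.trans h1))⟩

/-- The self-consistent equation for `E ⟨G Q A⟩`. -/
lemma norm_expect_ntr_sub_le (hD : D.IsHermitian) (hz : Λ⁻¹ ≤ |z.im|)
    (h : IsResPair Λ s (res D z) Q)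
    (hA : ‖A * resolvent D (meanPt β ν D z)‖ ≤ Λ ^ 2) (hN : 0 < N) (hβ : 0 ≤ β)
    (hβN : N * β ^ 2 ≤ Λ ^ 2) (hν : EntryBounds N β ν) :
    ‖expect β ν (fun u => ntr (res D z u * Q u * A)) -
      (expect β ν (fun u => ntr (Q u * (A * resolvent D (meanPt β ν D z)))) +
      s * (expect β ν (fun u => ntr (res D z u * Q u)) *
        expect β ν (fun u => ntr (Q u * (A * resolvent D (meanPt β ν D z))))))‖ ≤
      20000 * Λ ^ 32 / N := by
  have hΛ := h.one_le
  have hΛ0 : 0 < Λ⁻¹ := by positivity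
  have hz0 : z.im ≠ 0 := abs_pos.mp (hΛ0.trans_le hz)
  obtain ⟨hu, -⟩ := resolvent_meanPt_bounds (ν := ν) hD hβ hΛ hz
  have key := h.norm_expect_ntr_add_le hA hN hβ hβN hν
  set g := expect β ν (fun u => ntr (res D z u)) with hg
  have hw : meanPt β ν D z = z + g := rfl
  set B := resolvent D (meanPt β ν D z)
  -- the resolvent identity `G = B - B (W + g) G` between `G` and the deterministic `B`
  have hpt : ∀ u, ntr (res D z u * Q u * A) = ntr (Q u * (A * B)) +
      ((-1) * ntr (wmat u * (res D z u * Q u * (A * B))) +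
        (-g) * ntr (res D z u * Q u * (A * B))) := by
    intro u
    have h1 := resolvent_sub hu (isUnit_res hD hz0 u)
    rw [hw, add_sub_cancel_left, add_sub_cancel_left] at h1
    change B - res D z u = B * (wmat u + g • 1) * res D z u at h1
    have h2 : res D z u * Q u * A = B * (Q u * A) - B * (wmat u * (res D z u * (Q u * A))) -
        g • (B * (res D z u * (Q u * A))) := by
      have h3 : res D z u = B - B * (wmat u + g • 1) * res D z u := by rw [← h1]; abel
      refine (congrArg (fun X => X * Q u * A) h3).trans ?_
      simp only [mul_add, add_mul, sub_mul, mul_assoc, Algebra.mul_smul_comm,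
        Algebra.smul_mul_assoc, one_mul]
      abel
    rw [h2, ntr_sub, ntr_sub, ntr_smul, ntr_mul_comm B, ntr_mul_comm B, ntr_mul_comm B]
    simp only [mul_assoc]
    ring
  have cP := h.contP
  have cQ := h.contQ
  have c1 : Continuous fun u => ntr (Q u * (A * B)) :=
    continuous_ntr.comp (cQ.mul continuous_const)
  have c3 : Continuous fun u => ntr (res D z u * Q u * (A * B)) :=
    continuous_ntr.comp ((cP.mul cQ).mul continuous_const)
  have c2 : Continuous fun u => ntr (wmat u * (res D z u * Q u * (A * B))) :=
    continuous_ntr.comp (continuous_wmat.mul ((cP.mul cQ).mul continuous_const))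
  have e : expect β ν (fun u => ntr (res D z u * Q u * A)) =
      expect β ν (fun u => ntr (Q u * (A * B))) +
      ((-1) * expect β ν (fun u => ntr (wmat u * (res D z u * Q u * (A * B)))) +
        (-g) * expect β ν (fun u => ntr (res D z u * Q u * (A * B)))) := by
    simp only [hpt]
    rw [← expect_const_mul, ← expect_const_mul]
    refine (expect_add hβ (F := fun u => ntr (Q u * (A * B)))
      (G := fun u => (-1) * ntr (wmat u * (res D z u * Q u * (A * B))) +
        (-g) * ntr (res D z u * Q u * (A * B))) c1
      ((continuous_const.mul c2).add (continuous_const.mul c3))).trans ?_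
    congr 1
    exact expect_add hβ (continuous_const.mul c2) (continuous_const.mul c3)
  rw [e, ← norm_neg]
  refine le_trans (le_of_eq ?_) key
  congr 1
  ring

/-- An approximate solution of the scalar Dyson equation is close to the solution. -/
lemma resolvent_sub_mdeM_le (hD : D.IsHermitian) (hΛ : 1 ≤ Λ) (hz : Λ⁻¹ ≤ |z.im|)
    (hw : 0 < z.im * w.im) {ε : ℝ} (hε : ‖w - z - ntr (resolvent D w)‖ ≤ ε)
    (hεΛ : ε ≤ (2 * Λ)⁻¹) :
    ‖resolvent D w - mdeM D z‖ ≤ 27 * Λ ^ 3 * ε ∧ ‖mdeM D z‖ ≤ 3 * Λ := by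
  have hΛ0 : 0 < Λ := by linarith
  set κ := (2 * Λ)⁻¹ with hκ
  have hκ0 : 0 < κ := by positivity
  have hκΛ : Λ⁻¹ = 2 * κ := by rw [hκ]; field_simp
  set e := w - z - ntr (resolvent D w) with he
  have him : |e.im| ≤ κ := (Complex.abs_im_le_norm e).trans (hε.trans hεΛ)
  -- `w` solves the Dyson equation exactly at the shifted spectral parameter `z + e`, which is
  -- still at distance `κ` from the real line
  have hdp : IsDysonPoint D (z + e) w := by
    refine ⟨by rw [he]; ring, ?_⟩
    rw [Complex.add_im]
    obtain ⟨h1, h2⟩ := abs_le.mp him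
    rcases le_or_gt 0 z.im with h | h
    · rw [abs_of_nonneg h] at hz
      have : 0 < w.im := by
        by_contra hc
        nlinarith
      exact mul_pos (by linarith) this
    · rw [abs_of_neg h] at hz
      have : w.im < 0 := by
        by_contra hc
        nlinarith
      exact mul_pos_of_neg_of_neg (by linarith) this
  have hf1 : Far ‖D‖ κ (z + e) := Or.inl (by
    rw [Complex.add_im]
    have := abs_sub_abs_le_abs_sub z.im (-e.im)
    rw [abs_neg, sub_neg_eq_add] at this
    linarith)
  have hf2 : Far ‖D‖ κ z := Or.inl (by linarith)
  have b1 := hdp.bounds hD hκ0 le_rfl hf1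
  obtain ⟨b2, hM⟩ := mdeM_bounds hD hκ0 le_rfl hf2
  have hn : 1 + κ⁻¹ ≤ 3 * Λ := by rw [hκ, inv_inv]; linarith
  have hr : (1 + κ) / κ ≤ 3 * Λ := by
    have : (1 + κ) / κ = 1 + κ⁻¹ := by field_simp; ring
    rw [this]; exact hn
  have hl := b1.lipschitz hκ0 b2
  rw [add_sub_cancel_left] at hl
  have n2 : ‖mdeM D z‖ ≤ 3 * Λ := by rw [hM]; exact b2.norm_le.trans hn
  refine ⟨?_, n2⟩
  have h3 := resolvent_sub_norm_le b1.isUnit b2.isUnit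
  rw [← hM] at h3
  refine h3.trans ?_
  calc ‖resolvent D w‖ * ‖mdeM D z‖ * ‖w - dysonPt D z‖
      ≤ (3 * Λ) * (3 * Λ) * (3 * Λ * ε) := by
        gcongr
        · exact b1.norm_le.trans hn
        · exact hl.trans (by gcongr)
    _ = _ := by ring

/-- The equation `T = τ + T τ` determines `T` stably. -/
lemma norm_sub_le_of_approx {T τ m : ℂ} {ε c K : ℝ} (hK : 0 < K) (h1 : ‖T - (τ + T * τ)‖ ≤ ε)
    (h2 : ‖τ - m‖ ≤ ε) (h3 : ‖1 + T‖ ≤ c) (h4 : K⁻¹ ≤ ‖1 - m‖) :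
    ‖T - (1 - m)⁻¹ * m‖ ≤ K * (ε * (1 + c)) := by
  have hm : 1 - m ≠ 0 := by
    rw [← norm_pos_iff]
    exact lt_of_lt_of_le (by positivity) h4
  have e : T - (1 - m)⁻¹ * m = (1 - m)⁻¹ * ((T - (τ + T * τ)) + (τ - m) * (1 + T)) := by
    field_simp
    ring
  have hε : 0 ≤ ε := (norm_nonneg _).trans h2
  rw [e, norm_mul, norm_inv]
  refine mul_le_mul (inv_le_of_inv_le₀ hK h4) ?_ (norm_nonneg _) hK.le
  refine (norm_add_le _ _).trans ?_
  rw [norm_mul, mul_add, mul_one]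
  exact add_le_add h1 (mul_le_mul h2 h3 (norm_nonneg _) hε)

/-- The two-resolvent law in expectation, at distance at least `Λ⁻¹` from the real line. With
the resolvents `B_j` of `D_j` at `meanPt`, the self-consistent equation reads `T ≈ τ + T τ` for
`T = E ⟨G₁ G₂⟩` and `τ = E ⟨G₂ B₁⟩`, and `τ ≈ ⟨B₁ B₂⟩ ≈ ⟨M₁ M₂⟩`. -/
lemma norm_expect_ntr_mul_sub_le (hD₁ : D₁.IsHermitian) (hD₂ : D₂.IsHermitian) (hΛ : 1 ≤ Λ)
    (h₁ : Λ⁻¹ ≤ |z₁.im|) (h₂ : Λ⁻¹ ≤ |z₂.im|) (hN : 0 < N) (hβ : 0 ≤ β)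
    (hβN : N * β ^ 2 ≤ Λ ^ 2) (hν : EntryBounds N β ν) (hbig : 40000 * Λ ^ 33 ≤ N) :
    ‖expect β ν (fun u => ntr (res D₁ z₁ u * res D₂ z₂ u)) -
      ntr (twoResolventM (mdeM D₁ z₁) (mdeM D₂ z₂))‖ ≤ 40000000 * Λ ^ 40 / N := by
  have hΛ0 : 0 < Λ := by linarith
  have hN0 : (0 : ℝ) < N := by exact_mod_cast hN
  have hi : 0 < Λ⁻¹ := by positivity
  set ε := 20000 * Λ ^ 32 / N with hε
  have hε0 : 0 ≤ ε := by positivity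
  have hεΛ : ε ≤ (2 * Λ)⁻¹ := by
    rw [hε, div_le_iff₀ hN0, inv_mul_eq_div, le_div_iff₀ (by positivity)]
    calc 20000 * Λ ^ 32 * (2 * Λ) = 40000 * Λ ^ 33 := by ring
      _ ≤ (N : ℝ) := hbig
  have hp := isResPair_res (N := N) hD₁ hD₂ hΛ h₁ h₂
  have hp2 := isResPair_res (N := N) hD₂ hD₁ hΛ h₂ h₁
  have hΛ2 : Λ ≤ Λ ^ 2 := le_self_pow₀ hΛ (by norm_num)
  set B₁ := resolvent D₁ (meanPt β ν D₁ z₁) with hB₁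
  set B₂ := resolvent D₂ (meanPt β ν D₂ z₂) with hB₂
  have nB₁ : ‖B₁‖ ≤ Λ := (resolvent_meanPt_bounds hD₁ hβ hΛ h₁).2
  have nB₂ : ‖B₂‖ ≤ Λ := (resolvent_meanPt_bounds hD₂ hβ hΛ h₂).2
  have nBB : ‖B₁ * B₂‖ ≤ Λ ^ 2 := by
    rw [sq]; exact (norm_mul_le _ _).trans (mul_le_mul nB₁ nB₂ (norm_nonneg _) hΛ0.le)
  -- the self-consistent equations for `E ⟨G₁⟩`, `E ⟨G₂⟩`, `E ⟨G₁ G₂⟩` and `E ⟨G₂ B₁⟩`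
  have a1 := norm_expect_ntr_sub_le (A := 1) hD₁ h₁ hp.fst
    (by rw [one_mul]; exact nB₁.trans hΛ2) hN hβ hβN hν
  have a2 := norm_expect_ntr_sub_le (A := 1) hD₂ h₂ hp2.fst
    (by rw [one_mul]; exact nB₂.trans hΛ2) hN hβ hβN hν
  have a3 := norm_expect_ntr_sub_le (A := 1) hD₁ h₁ hp
    (by rw [one_mul]; exact nB₁.trans hΛ2) hN hβ hβN hν
  have a4 := norm_expect_ntr_sub_le (A := B₁) hD₂ h₂ hp2.fst nBB hN hβ hβN hν
  simp only [mul_one, one_mul, zero_mul, add_zero, expect_const, ← hB₁, ← hB₂] at a1 a2 a3 a4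
  obtain ⟨c1, m1⟩ := resolvent_sub_mdeM_le (w := meanPt β ν D₁ z₁) (ε := ε) hD₁ hΛ h₁
    (im_meanPt hD₁ (abs_pos.mp (hi.trans_le h₁)) hβ).2
    (by rw [← hB₁]; unfold meanPt; rw [add_sub_cancel_left]; exact a1) hεΛ
  obtain ⟨c2, m2⟩ := resolvent_sub_mdeM_le (w := meanPt β ν D₂ z₂) (ε := ε) hD₂ hΛ h₂
    (im_meanPt hD₂ (abs_pos.mp (hi.trans_le h₂)) hβ).2
    (by rw [← hB₂]; unfold meanPt; rw [add_sub_cancel_left]; exact a2) hεΛ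
  rw [← hB₁] at c1
  rw [← hB₂] at c2
  set M₁ := mdeM D₁ z₁
  set M₂ := mdeM D₂ z₂
  set T := expect β ν (fun u => ntr (res D₁ z₁ u * res D₂ z₂ u))
  set τ := expect β ν (fun u => ntr (res D₂ z₂ u * B₁))
  have hone : 1 ≤ Λ ^ 4 := one_le_pow₀ hΛ
  have hτ : ‖τ - ntr (M₁ * M₂)‖ ≤ 200 * Λ ^ 4 * ε := by
    have h5 : ‖ntr (B₁ * B₂) - ntr (M₁ * M₂)‖ ≤ 162 * Λ ^ 4 * ε := by
      rw [← ntr_sub]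
      refine (norm_ntr_le _).trans ?_
      have e : B₁ * B₂ - M₁ * M₂ = (B₁ - M₁) * B₂ + M₁ * (B₂ - M₂) := by noncomm_ring
      rw [e]
      refine (norm_add_le _ _).trans ((add_le_add (norm_mul_le _ _) (norm_mul_le _ _)).trans ?_)
      calc ‖B₁ - M₁‖ * ‖B₂‖ + ‖M₁‖ * ‖B₂ - M₂‖ ≤
          27 * Λ ^ 3 * ε * Λ + 3 * Λ * (27 * Λ ^ 3 * ε) := by gcongr
        _ = 108 * Λ ^ 4 * ε := by ring
        _ ≤ _ := by gcongr; norm_num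
    have h6 : ε ≤ Λ ^ 4 * ε := le_mul_of_one_le_left hε0 hone
    calc _ = ‖(τ - ntr (B₁ * B₂)) + (ntr (B₁ * B₂) - ntr (M₁ * M₂))‖ := by congr 1; ring
      _ ≤ ε + 162 * Λ ^ 4 * ε := (norm_add_le _ _).trans (add_le_add a4 h5)
      _ ≤ _ := by nlinarith
  have hT : ‖1 + T‖ ≤ 2 * Λ ^ 2 := by
    have : ‖T‖ ≤ Λ ^ 2 := norm_expect_le fun u => (norm_ntr_le _).trans (hp.norm_PQ u)
    refine (norm_add_le _ _).trans ?_
    rw [norm_one]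
    have := one_le_pow₀ hΛ (n := 2)
    linarith
  have hm : (3 * Λ)⁻¹ ≤ ‖1 - ntr (M₁ * M₂)‖ := by
    obtain ⟨d1, e1⟩ := mdeM_bounds hD₁ (κ := Λ⁻¹) hi le_rfl (Or.inl h₁)
    obtain ⟨d2, e2⟩ := mdeM_bounds hD₂ (κ := Λ⁻¹) hi le_rfl (Or.inl h₂)
    have h := d1.norm_one_sub hi d2
    rw [← e1, ← e2] at h
    refine le_trans ?_ h
    have : Λ⁻¹ / (1 + Λ⁻¹) = (Λ + 1)⁻¹ := by field_simp
    rw [this]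
    exact inv_anti₀ (by linarith) (by linarith)
  have h3 : ‖T - (τ + T * τ)‖ ≤ 200 * Λ ^ 4 * ε := by
    have e : (expect β ν fun u => ntr (res D₂ z₂ u * B₁)) = τ := rfl
    refine a3.trans ?_
    nlinarith
  have hfin := norm_sub_le_of_approx (by positivity) h3 hτ hT hm
  have e : ntr (twoResolventM M₁ M₂) = (1 - ntr (M₁ * M₂))⁻¹ * ntr (M₁ * M₂) := by
    unfold twoResolventM; rw [ntr_smul]
  rw [e]
  refine hfin.trans ?_
  have h7 := one_le_pow₀ hΛ (n := 2)
  calc 3 * Λ * (200 * Λ ^ 4 * ε * (1 + 2 * Λ ^ 2)) ≤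
      3 * Λ * (200 * Λ ^ 4 * ε * (Λ ^ 2 + 2 * Λ ^ 2)) := by gcongr
    _ = 1800 * 20000 * Λ ^ 39 / N := by rw [hε]; ring
    _ ≤ 40000000 * Λ ^ 40 / N := by
      gcongr
      · norm_num
      · norm_num

end Law

end TwoResolvent
end

noncomputable section
namespace TwoResolvent

/-! ### A maximum principle with a weight on the circle -/

/-- An entire function that is `1` at the origin and, on the circle of radius `r`, has modulus
`2 |Im ζ + y| / r`. For `|y| > 2 r`, where `Im ζ + y` is never small on the circle, it is
replaced by the constant `1`. -/
def circleWeight (r y : ℝ) (ζ : ℂ) : ℂ :=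
  if |y| ≤ 2 * r then 1 - (ζ ^ 2 + 2 * Complex.I * y * ζ) / r ^ 2 else 1

lemma circleWeight_zero (r y : ℝ) : circleWeight r y 0 = 1 := by simp [circleWeight]

lemma differentiable_circleWeight (r y : ℝ) : Differentiable ℂ (circleWeight r y) := by
  unfold circleWeight
  split_ifs <;> fun_prop

lemma norm_circleWeight {r y : ℝ} (hr : 0 < r) (hy : |y| ≤ 2 * r) {ζ : ℂ} (hζ : ‖ζ‖ = r) :
    ‖circleWeight r y ζ‖ = 2 * |y + ζ.im| / r := by
  have hr' : (r : ℂ) ≠ 0 := by exact_mod_cast hr.ne'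
  have h1 : ζ * (starRingEnd ℂ) ζ = (r : ℂ) ^ 2 := by rw [Complex.mul_conj', hζ]
  have h2 : ζ - (starRingEnd ℂ) ζ = 2 * ζ.im * Complex.I := by
    rw [Complex.sub_conj]; push_cast; ring
  have e : circleWeight r y ζ = -(2 * Complex.I * ζ * ((y + ζ.im : ℝ) : ℂ)) / r ^ 2 := by
    unfold circleWeight
    rw [if_pos hy]
    field_simp
    push_cast
    linear_combination -h1 - ζ * h2
  rw [e, norm_div, norm_neg, norm_mul, norm_mul, norm_mul, hζ, norm_pow, Complex.norm_real,
    Complex.norm_real, Complex.norm_I, Real.norm_eq_abs, Real.norm_eq_abs, abs_of_pos hr]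
  simp
  field_simp

lemma norm_circleWeight_le {r y : ℝ} (hr : 0 < r) {ζ : ℂ} (hζ : ‖ζ‖ = r) :
    ‖circleWeight r y ζ‖ ≤ 6 := by
  by_cases hy : |y| ≤ 2 * r
  · rw [norm_circleWeight hr hy hζ, div_le_iff₀ hr]
    have h1 := abs_add_le y ζ.im
    have h2 := Complex.abs_im_le_norm ζ
    linarith
  · simp [circleWeight, hy]

lemma norm_circleWeight_le_of_close {r y τ : ℝ} (hr : 0 < r) (hτ : τ ≤ r) {ζ : ℂ} (hζ : ‖ζ‖ = r)
    (h : |y + ζ.im| ≤ τ) : ‖circleWeight r y ζ‖ ≤ 2 * τ / r := by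
  have hy : |y| ≤ 2 * r := by
    have h1 := abs_sub_abs_le_abs_sub y (-ζ.im)
    rw [abs_neg, sub_neg_eq_add] at h1
    linarith [Complex.abs_im_le_norm ζ]
  rw [norm_circleWeight hr hy hζ]
  gcongr

/-- The points of a regular net on the circle of radius `r`. -/
def netPt (r : ℝ) (n m : ℕ) : ℂ :=
  r * Complex.exp (((2 * Real.pi * m / n - Real.pi : ℝ) : ℂ) * Complex.I)

lemma norm_netPt {r : ℝ} (hr : 0 < r) (n m : ℕ) : ‖netPt r n m‖ = r := by
  unfold netPt
  rw [norm_mul, Complex.norm_exp_ofReal_mul_I, mul_one, Complex.norm_real, Real.norm_eq_abs,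
    abs_of_pos hr]

lemma exists_netPt {r : ℝ} (hr : 0 < r) {n : ℕ} (hn : 0 < n) {ζ : ℂ} (hζ : ‖ζ‖ = r) :
    ∃ m ≤ n, ‖ζ - netPt r n m‖ ≤ 2 * Real.pi * r / n := by
  have hn0 : (0 : ℝ) < n := by exact_mod_cast hn
  have hpi := Real.pi_pos
  set θ := Complex.arg ζ with hθ
  have h1 : 0 ≤ (θ + Real.pi) * n / (2 * Real.pi) := by
    have := Complex.neg_pi_lt_arg ζ
    have : 0 ≤ θ + Real.pi := by linarith
    positivity
  have h2 : (θ + Real.pi) * n / (2 * Real.pi) ≤ n := by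
    rw [div_le_iff₀ (by positivity)]
    have := Complex.arg_le_pi ζ
    nlinarith
  set m := ⌊(θ + Real.pi) * n / (2 * Real.pi)⌋₊ with hm
  refine ⟨m, ?_, ?_⟩
  · have := (Nat.floor_le h1).trans h2
    exact_mod_cast this
  · set φ := 2 * Real.pi * m / n - Real.pi with hφ
    have hζe : ζ = r * Complex.exp ((θ : ℂ) * Complex.I) := by
      rw [← hζ]; exact (Complex.norm_mul_exp_arg_mul_I ζ).symm
    have h3 : |θ - φ| ≤ 2 * Real.pi / n := by
      have a1 := Nat.floor_le h1
      have a2 := Nat.lt_floor_add_one ((θ + Real.pi) * n / (2 * Real.pi))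
      rw [← hm] at a1 a2
      rw [le_div_iff₀ (by positivity)] at a1
      rw [div_lt_iff₀ (by positivity)] at a2
      have e : θ - φ = ((θ + Real.pi) * n - m * (2 * Real.pi)) / n := by
        rw [hφ]; field_simp; ring
      rw [e, abs_div, abs_of_pos hn0, abs_of_nonneg (by linarith)]
      gcongr
      nlinarith
    have h4 : ζ - netPt r n m = netPt r n m * (Complex.exp (Complex.I * ((θ - φ : ℝ) : ℂ)) - 1) := by
      have e : Complex.exp ((θ : ℂ) * Complex.I) = Complex.exp ((φ : ℂ) * Complex.I) *
          Complex.exp (Complex.I * ((θ - φ : ℝ) : ℂ)) := by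
        rw [← Complex.exp_add]; congr 1; push_cast; ring
      have e2 : netPt r n m = r * Complex.exp ((φ : ℂ) * Complex.I) := rfl
      rw [e2]
      conv_lhs => rw [hζe]
      linear_combination (r : ℂ) * e
    rw [h4, norm_mul, norm_netPt hr]
    have h5 := Real.norm_exp_I_mul_ofReal_sub_one_le (x := θ - φ)
    rw [Real.norm_eq_abs] at h5
    calc r * ‖Complex.exp (Complex.I * ((θ - φ : ℝ) : ℂ)) - 1‖ ≤ r * (2 * Real.pi / n) := by
          gcongr; exact h5.trans h3
      _ = _ := by ring

/-- A bound at the origin from a bound at those points of a net on a circle at which the two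
shifted imaginary parts are not too small. -/
lemma norm_apply_zero_le {F : ℂ → ℂ} {r B τ b : ℝ} (hr : 0 < r) (hb : 0 ≤ b)
    (hF : ∀ ζ, ‖ζ‖ ≤ 2 * r → DifferentiableAt ℂ F ζ) (hB : ∀ ζ, ‖ζ‖ ≤ 2 * r → ‖F ζ‖ ≤ B)
    (y₁ y₂ : ℝ) {n : ℕ} (hn : 0 < n) (hτ : τ ≤ r) (hτn : 2 * Real.pi * r / n ≤ τ / 2)
    (hnet : ∀ m ≤ n, τ / 2 ≤ |y₁ + (netPt r n m).im| → τ / 2 ≤ |y₂ + (netPt r n m).im| →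
      ‖F (netPt r n m)‖ ≤ b) (k : ℕ) :
    ‖F 0‖ ≤ 36 ^ k * (b + 2 * Real.pi * B / n) + (12 * τ / r) ^ k * B := by
  have hn0 : (0 : ℝ) < n := by exact_mod_cast hn
  have hpi := Real.pi_pos
  have hB0 : 0 ≤ B := (norm_nonneg _).trans (hB 0 (by simpa using hr.le))
  have hτ0 : 0 ≤ τ := by
    have : 0 ≤ 2 * Real.pi * r / n := by positivity
    linarith
  -- Cauchy's estimate on circles of radius `r`, which stay in the disc of radius `2 r`
  have hderiv : ∀ ζ ∈ Metric.closedBall (0 : ℂ) r, ‖deriv F ζ‖ ≤ B / r := by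
    intro ζ hζ
    rw [mem_closedBall_zero_iff] at hζ
    refine Complex.norm_deriv_le_of_forall_mem_sphere_norm_le hr ?_ ?_
    · refine DifferentiableOn.diffContOnCl fun x hx => ?_
      have hx' := Metric.closure_ball_subset_closedBall hx
      rw [mem_closedBall_iff_norm] at hx'
      refine (hF x ?_).differentiableWithinAt
      have := norm_le_norm_add_norm_sub' x ζ
      linarith
    · intro x hx
      rw [mem_sphere_iff_norm] at hx
      refine hB x ?_
      have := norm_le_norm_add_norm_sub' x ζ
      linarith
  have hlip : ∀ ζ ξ : ℂ, ‖ζ‖ ≤ r → ‖ξ‖ ≤ r → ‖F ζ - F ξ‖ ≤ B / r * ‖ζ - ξ‖ := by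
    intro ζ ξ hζ hξ
    refine (convex_closedBall (0 : ℂ) r).norm_image_sub_le_of_norm_deriv_le (fun x hx => hF x ?_)
      hderiv (by simpa using hξ) (by simpa using hζ)
    rw [mem_closedBall_zero_iff] at hx
    linarith
  have hgood : ∀ ζ : ℂ, ‖ζ‖ = r → τ ≤ |y₁ + ζ.im| → τ ≤ |y₂ + ζ.im| →
      ‖F ζ‖ ≤ b + 2 * Real.pi * B / n := by
    intro ζ hζ h1 h2
    obtain ⟨m, hm, hd⟩ := exists_netPt hr hn hζ
    have him : |ζ.im - (netPt r n m).im| ≤ τ / 2 := by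
      rw [← Complex.sub_im]
      exact (Complex.abs_im_le_norm _).trans (hd.trans hτn)
    have hy : ∀ y : ℝ, τ ≤ |y + ζ.im| → τ / 2 ≤ |y + (netPt r n m).im| := fun y h => by
      have h3 := abs_sub_abs_le_abs_sub (y + ζ.im) (y + (netPt r n m).im)
      rw [add_sub_add_left_eq_sub] at h3
      linarith
    have h3 := hnet m hm (hy _ h1) (hy _ h2)
    have h4 := hlip ζ (netPt r n m) hζ.le (norm_netPt hr n m).le
    have h5 : B / r * ‖ζ - netPt r n m‖ ≤ 2 * Real.pi * B / n := by
      calc B / r * ‖ζ - netPt r n m‖ ≤ B / r * (2 * Real.pi * r / n) := by gcongr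
        _ = _ := by field_simp
    linarith [norm_le_norm_add_norm_sub' (F ζ) (F (netPt r n m))]
  -- The weight equals one at the origin and is small at those points of the circle at which no
  -- bound other than `B` is available.
  set H : ℂ → ℂ := fun ζ => F ζ * (circleWeight r y₁ ζ * circleWeight r y₂ ζ) ^ k with hH
  have hH0 : H 0 = F 0 := by simp [hH, circleWeight_zero]
  have hmain : ‖H 0‖ ≤ 36 ^ k * (b + 2 * Real.pi * B / n) + (12 * τ / r) ^ k * B := by
    refine Complex.norm_le_of_forall_mem_frontier_norm_le (U := Metric.ball (0 : ℂ) r)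
      Metric.isBounded_ball ?_ ?_ (subset_closure (Metric.mem_ball_self hr))
    · refine DifferentiableOn.diffContOnCl fun x hx => ?_
      have hx' := Metric.closure_ball_subset_closedBall hx
      rw [mem_closedBall_zero_iff] at hx'
      refine DifferentiableAt.differentiableWithinAt ?_
      exact (hF x (by linarith)).mul (((differentiable_circleWeight r y₁ x).mul
        (differentiable_circleWeight r y₂ x)).pow k)
    · intro ζ hζ
      rw [frontier_ball _ hr.ne', mem_sphere_zero_iff_norm] at hζ
      have w1 := norm_circleWeight_le (y := y₁) hr hζ
      have w2 := norm_circleWeight_le (y := y₂) hr hζ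
      have hFB := hB ζ (by linarith)
      rw [hH]
      simp only
      rw [norm_mul, norm_pow, norm_mul]
      have t1 : 0 ≤ 36 ^ k * (b + 2 * Real.pi * B / n) := by positivity
      have t2 : 0 ≤ (12 * τ / r) ^ k * B := by positivity
      by_cases h1 : τ ≤ |y₁ + ζ.im|
      · by_cases h2 : τ ≤ |y₂ + ζ.im|
        · have h3 := hgood ζ hζ h1 h2
          calc ‖F ζ‖ * (‖circleWeight r y₁ ζ‖ * ‖circleWeight r y₂ ζ‖) ^ k
              ≤ (b + 2 * Real.pi * B / n) * (6 * 6) ^ k := by gcongr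
            _ ≤ _ := by norm_num; linarith
        · have w3 := norm_circleWeight_le_of_close hr hτ hζ (not_le.mp h2).le
          calc ‖F ζ‖ * (‖circleWeight r y₁ ζ‖ * ‖circleWeight r y₂ ζ‖) ^ k
              ≤ B * (6 * (2 * τ / r)) ^ k := by gcongr
            _ = (12 * τ / r) ^ k * B := by rw [mul_comm]; congr 2; ring
            _ ≤ _ := by linarith
      · have w3 := norm_circleWeight_le_of_close hr hτ hζ (not_le.mp h1).le
        calc ‖F ζ‖ * (‖circleWeight r y₁ ζ‖ * ‖circleWeight r y₂ ζ‖) ^ k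
            ≤ B * ((2 * τ / r) * 6) ^ k := by gcongr
          _ = (12 * τ / r) ^ k * B := by rw [mul_comm]; congr 2; ring
          _ ≤ _ := by linarith
  rwa [hH0] at hmain

end TwoResolvent
end

noncomputable section
namespace TwoResolvent
open scoped ComplexOrder Matrix Matrix.Norms.L2Operator

variable {N : ℕ}

/-! ### The law on the whole domain, for truncated entries -/

section Deviation

variable {D D₁ D₂ H : Matrix (Fin N) (Fin N) ℂ} {z z₁ z₂ : ℂ} {L κ : ℝ}

/-- The error in the two-resolvent law, along a common shift of the spectral parameters. -/
def lawDiff (D₁ D₂ : Matrix (Fin N) (Fin N) ℂ) (z₁ z₂ : ℂ) (H : Matrix (Fin N) (Fin N) ℂ)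
    (ζ : ℂ) : ℂ :=
  ntr (resolvent (D₁ + H) (z₁ + ζ) * resolvent (D₂ + H) (z₂ + ζ)) -
    ntr (twoResolventM (mdeM D₁ (z₁ + ζ)) (mdeM D₂ (z₂ + ζ)))

lemma resolvent_far (hD : D.IsHermitian) (hH : H.IsHermitian) (hκ : 0 < κ) (hL : ‖D‖ ≤ L)
    (hHn : ‖H‖ ≤ 2 + κ / 4) (hz : Far L (3 * κ / 4) z) :
    IsUnit (D + H - z • 1) ∧ ‖resolvent (D + H) z‖ ≤ 2 / κ := by
  rcases hz with h | h
  · have h0 : 0 < |z.im| := lt_of_lt_of_le (by positivity) h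
    obtain ⟨h1, h2⟩ := resolvent_bound_im (hD.add hH) (abs_pos.mp h0)
    refine ⟨h1, h2.trans ?_⟩
    rw [inv_le_comm₀ h0 (by positivity), inv_div]
    linarith
  · obtain ⟨h1, h2⟩ := resolvent_bound_re (H := D + H) (z := z) (c := κ / 2) (by positivity)
      (by linarith [norm_add_le D H])
    exact ⟨h1, h2.trans (le_of_eq (by rw [inv_div]))⟩

lemma differentiableAt_mdeM (hD : D.IsHermitian) (hκ : 0 < κ) (hL : ‖D‖ ≤ L) (hz : Far L κ z) :
    DifferentiableAt ℂ (mdeM D) z := by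
  have hκ2 : 0 < κ / 2 := by positivity
  have hnear : mdeM D =ᶠ[𝓝 z] fun z' => resolvent D (dysonPt D z') := by
    filter_upwards [Metric.ball_mem_nhds z hκ2] with z' hz'
    have h1 := hz.add (ζ := z' - z) (κ' := κ / 2)
      (by rw [← dist_eq_norm]; exact (Metric.mem_ball.mp hz').le)
    rw [add_sub_cancel] at h1
    exact (mdeM_bounds hD hκ2 hL (h1.mono (by linarith))).2
  refine DifferentiableAt.congr_of_eventuallyEq ?_ hnear
  exact differentiableAt_resolvent (differentiableAt_dysonPt hD hκ hL hz)
    (mdeM_bounds hD hκ hL hz).1.isUnit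

/-- On the event that the norm of the random matrix is not large, the error in the law is
holomorphic and bounded. -/
lemma lawDiff_bounds (hD₁ : D₁.IsHermitian) (hD₂ : D₂.IsHermitian) (hH : H.IsHermitian)
    (hκ : 0 < κ) (hL₁ : ‖D₁‖ ≤ L) (hL₂ : ‖D₂‖ ≤ L) (hHn : ‖H‖ ≤ 2 + κ / 4) (h₁ : Far L κ z₁)
    (h₂ : Far L κ z₂) {ζ : ℂ} (hζ : ‖ζ‖ ≤ κ / 4) :
    DifferentiableAt ℂ (lawDiff D₁ D₂ z₁ z₂ H) ζ ∧
      ‖lawDiff D₁ D₂ z₁ z₂ H ζ‖ ≤ 4 / κ ^ 2 + 2 / κ + 2 := by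
  have f1 : Far L (3 * κ / 4) (z₁ + ζ) := (h₁.add hζ).mono (by linarith)
  have f2 : Far L (3 * κ / 4) (z₂ + ζ) := (h₂.add hζ).mono (by linarith)
  have hκ2 : 0 < κ / 2 := by positivity
  obtain ⟨u1, n1⟩ := resolvent_far hD₁ hH hκ hL₁ hHn f1
  obtain ⟨u2, n2⟩ := resolvent_far hD₂ hH hκ hL₂ hHn f2
  have g1 : Far L (κ / 2) (z₁ + ζ) := f1.mono (by linarith)
  have g2 : Far L (κ / 2) (z₂ + ζ) := f2.mono (by linarith)
  obtain ⟨b1, e1⟩ := mdeM_bounds hD₁ hκ2 hL₁ g1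
  obtain ⟨b2, e2⟩ := mdeM_bounds hD₂ hκ2 hL₂ g2
  have hm := b1.norm_one_sub hκ2 b2
  rw [← e1, ← e2] at hm
  have hpos : 0 < κ / 2 / (1 + κ / 2) := by positivity
  have hne : 1 - ntr (mdeM D₁ (z₁ + ζ) * mdeM D₂ (z₂ + ζ)) ≠ 0 := by
    rw [← norm_pos_iff]; linarith
  have htw : ∀ ξ, ntr (twoResolventM (mdeM D₁ (z₁ + ξ)) (mdeM D₂ (z₂ + ξ))) =
      (1 - ntr (mdeM D₁ (z₁ + ξ) * mdeM D₂ (z₂ + ξ)))⁻¹ *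
        ntr (mdeM D₁ (z₁ + ξ) * mdeM D₂ (z₂ + ξ)) := fun ξ => by
    unfold twoResolventM; rw [ntr_smul]
  constructor
  · have hadd : ∀ z : ℂ, DifferentiableAt ℂ (fun ξ => z + ξ) ζ := fun z => by fun_prop
    have d1 := differentiableAt_resolvent (H := D₁ + H) (hadd z₁) u1
    have d2 := differentiableAt_resolvent (H := D₂ + H) (hadd z₂) u2
    have m1 : DifferentiableAt ℂ (fun ξ => mdeM D₁ (z₁ + ξ)) ζ :=
      (differentiableAt_mdeM hD₁ hκ2 hL₁ g1).comp ζ (hadd z₁)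
    have m2 : DifferentiableAt ℂ (fun ξ => mdeM D₂ (z₂ + ξ)) ζ :=
      (differentiableAt_mdeM hD₂ hκ2 hL₂ g2).comp ζ (hadd z₂)
    have t := differentiableAt_ntr (m1.mul m2)
    unfold lawDiff
    simp only [htw]
    exact (differentiableAt_ntr (d1.mul d2)).sub
      ((((differentiableAt_const (1 : ℂ)).sub t).inv hne).mul t)
  · unfold lawDiff
    rw [htw]
    set m := ntr (mdeM D₁ (z₁ + ζ) * mdeM D₂ (z₂ + ζ))
    -- only `1 - m` is bounded below, but this suffices
    have e3 : (1 - m)⁻¹ * m = (1 - m)⁻¹ - 1 := by field_simp; ring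
    rw [e3]
    have h3 : ‖ntr (resolvent (D₁ + H) (z₁ + ζ) * resolvent (D₂ + H) (z₂ + ζ))‖ ≤ 4 / κ ^ 2 := by
      refine (norm_ntr_le _).trans ((norm_mul_le _ _).trans ?_)
      calc _ ≤ 2 / κ * (2 / κ) := mul_le_mul n1 n2 (norm_nonneg _) (by positivity)
        _ = _ := by field_simp; norm_num
    have h4 : ‖(1 - m)⁻¹‖ ≤ 2 / κ + 1 := by
      rw [norm_inv]
      refine (inv_anti₀ hpos hm).trans (le_of_eq ?_)
      field_simp
    refine (norm_sub_le _ _).trans ((add_le_add h3 (norm_sub_le _ _)).trans ?_)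
    rw [norm_one]
    linarith

variable {Λ β : ℝ} {ν : Idx N → Measure ℂ} [∀ p, IsProbabilityMeasure (ν p)]

/-- The deviation estimate at spectral parameters at distance at least `Λ⁻¹` from the real line,
from the law in expectation and concentration. -/
lemma measure_lawDiff_le (hD₁ : D₁.IsHermitian) (hD₂ : D₂.IsHermitian) (hΛ : 10000 ≤ Λ)
    (h₁ : Λ⁻¹ ≤ |z₁.im|) (h₂ : Λ⁻¹ ≤ |z₂.im|) (hN : 0 < N) (hβ : 0 ≤ β)
    (hβN : N * β ^ 2 ≤ Λ ^ 2) (hν : EntryBounds N β ν) (hbig : 40000 * Λ ^ 33 ≤ N) (j : ℕ) :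
    Measure.pi ν {x | Λ ^ 42 / N < ‖ntr (res D₁ z₁ (clipAll β x) * res D₂ z₂ (clipAll β x)) -
      ntr (twoResolventM (mdeM D₁ z₁) (mdeM D₂ z₂))‖} ≤
      2 * ENNReal.ofReal (momentConst j * (115200 / Λ ^ 72) ^ (2 ^ j)) := by
  have hΛ1 : 1 ≤ Λ := by linarith
  have hΛ0 : 0 < Λ := by linarith
  have hN0 : (0 : ℝ) < N := by exact_mod_cast hN
  have hp := isResPair_res (N := N) hD₁ hD₂ hΛ1 h₁ h₂
  have hE := norm_expect_ntr_mul_sub_le hD₁ hD₂ hΛ1 h₁ h₂ hN hβ hβN hν hbig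
  have hC := (hp.selfAveraging_ntr (ν := ν) hN hβ hβN).2 j (t := Λ ^ 42 / N / 2) (by positivity)
  set E := expect β ν fun u => ntr (res D₁ z₁ u * res D₂ z₂ u)
  set M := ntr (twoResolventM (mdeM D₁ z₁) (mdeM D₂ z₂))
  have hb : 40000000 * Λ ^ 40 / N ≤ Λ ^ 42 / N / 2 := by
    rw [div_div, mul_comm (N : ℝ), ← div_div]
    gcongr
    rw [le_div_iff₀ (by norm_num)]
    calc 40000000 * Λ ^ 40 * 2 = 80000000 * Λ ^ 40 := by ring
      _ ≤ Λ ^ 2 * Λ ^ 40 := by gcongr; nlinarith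
      _ = _ := by ring
  have e : 7200 * Λ ^ 12 / (N * (Λ ^ 42 / N / 2) / 2) ^ 2 = 115200 / Λ ^ 72 := by
    field_simp
    norm_num
  rw [e] at hC
  refine (measure_mono fun x hx => ?_).trans hC
  rw [Set.mem_ofPred_eq] at hx ⊢
  set X := ntr (res D₁ z₁ (clipAll β x) * res D₂ z₂ (clipAll β x))
  have h3 : ‖X - M‖ ≤ ‖X - E‖ + ‖E - M‖ := norm_sub_le_norm_sub_add_norm_sub _ _ _
  linarith

/-- The deviation estimate on the whole domain, from a union bound over a net on the circle of
radius `κ / 8` and the weighted maximum principle. -/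
lemma measure_lawDiff_zero_le (hD₁ : D₁.IsHermitian) (hD₂ : D₂.IsHermitian) (hκ : 0 < κ)
    (hL₁ : ‖D₁‖ ≤ L) (hL₂ : ‖D₂‖ ≤ L) (h₁ : Far L κ z₁) (h₂ : Far L κ z₂) (hΛ : 10000 ≤ Λ)
    (hΛκ : 2 / Λ ≤ κ / 8) (hΛN : 2 * Real.pi * (κ / 8) / N ≤ 2 / Λ / 2)
    (hN : 0 < N) (hβ : 0 ≤ β) (hβN : N * β ^ 2 ≤ Λ ^ 2) (hν : EntryBounds N β ν)
    (hbig : 40000 * Λ ^ 33 ≤ N) (j k : ℕ) :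
    Measure.pi ν {x | 36 ^ k * (Λ ^ 42 / N + 2 * Real.pi * (4 / κ ^ 2 + 2 / κ + 2) / N) +
      (12 * (2 / Λ) / (κ / 8)) ^ k * (4 / κ ^ 2 + 2 / κ + 2) <
      ‖lawDiff D₁ D₂ z₁ z₂ (tmat β x) 0‖} ≤
    Measure.pi ν {x | 2 + κ / 4 ≤ ‖tmat β x‖} +
      (N + 1 : ℕ) * (2 * ENNReal.ofReal (momentConst j * (115200 / Λ ^ 72) ^ (2 ^ j))) := by
  have hΛ0 : 0 < Λ := by linarith
  have hN0 : (0 : ℝ) < N := by exact_mod_cast hN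
  set r := κ / 8 with hr
  have hr0 : 0 < r := by positivity
  set B := 4 / κ ^ 2 + 2 / κ + 2 with hB
  -- the event that the law fails at a point of the net at which both shifted spectral
  -- parameters are at distance at least `Λ⁻¹` from the real line
  set bad : ℕ → Set (Idx N → ℂ) := fun m => {x | 2 / Λ / 2 ≤ |z₁.im + (netPt r N m).im| ∧
    2 / Λ / 2 ≤ |z₂.im + (netPt r N m).im| ∧
    Λ ^ 42 / N < ‖lawDiff D₁ D₂ z₁ z₂ (tmat β x) (netPt r N m)‖} with hbad
  have hsub : {x | 36 ^ k * (Λ ^ 42 / N + 2 * Real.pi * B / N) + (12 * (2 / Λ) / r) ^ k * B <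
      ‖lawDiff D₁ D₂ z₁ z₂ (tmat β x) 0‖} ⊆ {x : Idx N → ℂ | 2 + κ / 4 ≤ ‖tmat β x‖} ∪
      ⋃ m ∈ Finset.range (N + 1), bad m := by
    intro x hx
    by_contra hc
    rw [Set.mem_union, not_or] at hc
    obtain ⟨hc1, hc2⟩ := hc
    rw [Set.mem_ofPred_eq, not_le] at hc1
    simp only [Set.mem_iUnion, not_exists, Finset.mem_range] at hc2
    rw [Set.mem_ofPred_eq] at hx
    refine absurd hx (not_lt.mpr ?_)
    have hlaw : ∀ ζ : ℂ, ‖ζ‖ ≤ 2 * r → _ := fun ζ hζ =>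
      lawDiff_bounds hD₁ hD₂ (tmat_isHermitian β x) hκ hL₁ hL₂ hc1.le h₁ h₂ (ζ := ζ)
        (by rw [hr] at hζ; linarith)
    refine norm_apply_zero_le hr0 (by positivity) (fun ζ hζ => (hlaw ζ hζ).1)
      (fun ζ hζ => (hlaw ζ hζ).2) z₁.im z₂.im hN hΛκ hΛN ?_ k
    intro m hm a1 a2
    by_contra hb
    exact hc2 m (by omega) ⟨a1, a2, not_le.mp hb⟩
  refine (measure_mono hsub).trans ((measure_union_le _ _).trans ?_)
  gcongr
  refine (measure_biUnion_finset_le _ _).trans ?_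
  have hle : ∀ m ∈ Finset.range (N + 1), Measure.pi ν (bad m) ≤
      2 * ENNReal.ofReal (momentConst j * (115200 / Λ ^ 72) ^ (2 ^ j)) := by
    intro m _
    by_cases hm : 2 / Λ / 2 ≤ |z₁.im + (netPt r N m).im| ∧ 2 / Λ / 2 ≤ |z₂.im + (netPt r N m).im|
    · have e : 2 / Λ / 2 = Λ⁻¹ := by field_simp
      rw [e] at hm
      refine le_trans (measure_mono fun x hx => ?_) (measure_lawDiff_le (z₁ := z₁ + netPt r N m)
        (z₂ := z₂ + netPt r N m) hD₁ hD₂ hΛ (by rw [Complex.add_im]; exact hm.1)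
        (by rw [Complex.add_im]; exact hm.2) hN hβ hβN hν hbig j)
      exact hx.2.2
    · have : bad m = ∅ := by
        ext x
        simp only [hbad, Set.mem_ofPred_eq, Set.mem_empty_iff_false, iff_false]
        exact fun h => hm ⟨h.1, h.2.1⟩
      rw [this, measure_empty]
      positivity
  refine (Finset.sum_le_card_nsmul _ _ _ hle).trans ?_
  rw [Finset.card_range, nsmul_eq_mul]

end Deviation

end TwoResolvent
end

noncomputable section
namespace TwoResolvent
open scoped ComplexOrder Matrix Matrix.Norms.L2Operator

variable {N : ℕ}

/-! ### Truncation of the entries of a Wigner matrix -/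

/-- A centered law on `ℂ` with a bounded moment of order `n + 2`. -/
structure IsCentered (n : ℕ) (c : ℝ) (σ : Measure ℂ) : Prop where
  prob : IsProbabilityMeasure σ
  integrable_id : Integrable (fun x : ℂ => x) σ
  integrable_sq : Integrable (fun x : ℂ => ‖x‖ ^ 2) σ
  integrable_pow : Integrable (fun x : ℂ => ‖x‖ ^ (n + 2)) σ
  mean : ∫ x, x ∂σ = 0
  moment_le : ∫ x, ‖x‖ ^ (n + 2) ∂σ ≤ c

lemma integrable_of_integrable_norm_pow_one {σ : Measure ℂ}
    (h : Integrable (fun x : ℂ => ‖x‖ ^ 1) σ) : Integrable (fun x : ℂ => x) σ := by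
  simp only [pow_one] at h
  exact (integrable_norm_iff measurable_id.aestronglyMeasurable).mp h

lemma EntryLaws.isCentered_od {Cp : ℕ → ℝ} {νd : Measure ℝ} {νod : Measure ℂ}
    (h : EntryLaws Cp νd νod) (n : ℕ) : IsCentered n (Cp (n + 2)) νod where
  prob := h.prob_od
  integrable_id := integrable_of_integrable_norm_pow_one (h.integrable_od 1 le_rfl)
  integrable_sq := h.integrable_od 2 (by norm_num)
  integrable_pow := h.integrable_od (n + 2) (by omega)
  mean := h.mean_od
  moment_le := by
    have h1 := h.moment_le (n + 2) (by omega)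
    have h2 : 0 ≤ ∫ x, |x| ^ (n + 2) ∂νd := integral_nonneg fun x => by positivity
    linarith

lemma EntryLaws.isCentered_d {Cp : ℕ → ℝ} {νd : Measure ℝ} {νod : Measure ℂ}
    (h : EntryLaws Cp νd νod) (n : ℕ) :
    IsCentered n (Cp (n + 2)) (νd.map ((↑) : ℝ → ℂ)) := by
  have hm : Measurable ((↑) : ℝ → ℂ) := Complex.measurable_ofReal
  have := h.prob_d
  have hi : ∀ p, 1 ≤ p → Integrable (fun x : ℂ => ‖x‖ ^ p) (νd.map ((↑) : ℝ → ℂ)) := by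
    intro p hp
    rw [integrable_map_measure (measurable_norm.pow_const p).aestronglyMeasurable hm.aemeasurable]
    refine (h.integrable_d p hp).congr (Eventually.of_forall fun x => ?_)
    simp [Complex.norm_real]
  refine ⟨Measure.isProbabilityMeasure_map hm.aemeasurable,
    integrable_of_integrable_norm_pow_one (hi 1 le_rfl), hi 2 (by norm_num), hi _ (by omega), ?_, ?_⟩
  · rw [integral_map (f := fun x : ℂ => x) hm.aemeasurable measurable_id.aestronglyMeasurable]
    have e : ∫ x : ℝ, (x : ℂ) ∂νd = ((∫ x, x ∂νd : ℝ) : ℂ) := integral_ofReal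
    rw [e, h.mean_d]; simp
  · rw [integral_map hm.aemeasurable (measurable_norm.pow_const _).aestronglyMeasurable]
    simp only [Complex.norm_real, Real.norm_eq_abs]
    have h1 := h.moment_le (n + 2) (by omega)
    have h2 : 0 ≤ ∫ x, ‖x‖ ^ (n + 2) ∂νod := integral_nonneg fun x => by positivity
    linarith

section Clip

variable {n : ℕ} {c q : ℝ} {σ : Measure ℂ}

lemma one_le_norm_pow_div (hq : 1 ≤ q) {x : ℂ} (hx : q < ‖x‖) (n : ℕ) : 1 ≤ ‖x‖ ^ n / q ^ n := by
  rw [one_le_div (by positivity)]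
  exact pow_le_pow_left₀ (by linarith) hx.le n

lemma norm_clip_sub_le (hq : 1 ≤ q) (x : ℂ) (n : ℕ) :
    ‖clip q x - x‖ ≤ ‖x‖ ^ (n + 2) / q ^ n := by
  have hq0 : 0 < q := by linarith
  unfold clip
  split_ifs with h
  · rw [sub_self, norm_zero]; positivity
  · push Not at h
    have h1 := one_le_norm_pow_div hq h n
    have hx1 : 1 ≤ ‖x‖ := hq.trans h.le
    rw [zero_sub, norm_neg, pow_add, mul_div_right_comm]
    calc ‖x‖ ≤ ‖x‖ ^ 2 := le_self_pow₀ hx1 (by norm_num)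
      _ ≤ _ := le_mul_of_one_le_left (by positivity) h1

lemma norm_sq_sub_clip_le (hq : 1 ≤ q) (x : ℂ) (n : ℕ) :
    ‖x‖ ^ 2 - ‖clip q x‖ ^ 2 ≤ ‖x‖ ^ (n + 2) / q ^ n := by
  have hq0 : 0 < q := by linarith
  unfold clip
  split_ifs with h
  · rw [sub_self]; positivity
  · push Not at h
    have h1 := one_le_norm_pow_div hq h n
    rw [norm_zero, pow_add, mul_div_right_comm]
    simp only [ne_eq, OfNat.ofNat_ne_zero, not_false_eq_true, zero_pow, sub_zero]
    exact le_mul_of_one_le_left (by positivity) h1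

lemma norm_clip_le_norm (q : ℝ) (x : ℂ) : ‖clip q x‖ ≤ ‖x‖ := by
  unfold clip
  split_ifs
  · exact le_rfl
  · simp

lemma IsCentered.div_le (h : IsCentered n c σ) (hq : 1 ≤ q) :
    ∫ x, ‖x‖ ^ (n + 2) / q ^ n ∂σ ≤ c / q ^ n := by
  rw [integral_div]
  have := h.moment_le
  gcongr

lemma IsCentered.norm_integral_clip_le (h : IsCentered n c σ) (hq : 1 ≤ q) :
    ‖∫ x, clip q x ∂σ‖ ≤ c / q ^ n := by
  have := h.prob
  have hi : Integrable (clip q) σ := integrable_of_bdd (measurable_clip q) q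
    (norm_clip_le (by linarith))
  have e : ∫ x, clip q x ∂σ = ∫ x, (clip q x - x) ∂σ := by
    rw [integral_sub hi h.integrable_id, h.mean, sub_zero]
  rw [e]
  exact (norm_integral_le_of_norm_le (h.integrable_pow.div_const _)
    (Eventually.of_forall fun x => norm_clip_sub_le hq x n)).trans (h.div_le hq)

lemma IsCentered.integral_clip_sq (h : IsCentered n c σ) (hq : 1 ≤ q) :
    ∫ x, ‖clip q x‖ ^ 2 ∂σ ≤ ∫ x, ‖x‖ ^ 2 ∂σ ∧
      ∫ x, ‖x‖ ^ 2 ∂σ - c / q ^ n ≤ ∫ x, ‖clip q x‖ ^ 2 ∂σ := by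
  have := h.prob
  have hi : Integrable (fun x => ‖clip q x‖ ^ 2) σ :=
    integrable_of_bdd ((measurable_clip q).norm.pow_const 2) (q ^ 2) fun x => by
      rw [norm_pow, norm_norm]
      exact pow_le_pow_left₀ (norm_nonneg _) (norm_clip_le (by linarith) x) 2
  constructor
  · exact integral_mono hi h.integrable_sq fun x =>
      pow_le_pow_left₀ (norm_nonneg _) (norm_clip_le_norm q x) 2
  · have h1 : ∫ x, (‖x‖ ^ 2 - ‖clip q x‖ ^ 2) ∂σ ≤ c / q ^ n :=
      (integral_mono (h.integrable_sq.sub hi) (h.integrable_pow.div_const _)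
        fun x => norm_sq_sub_clip_le hq x n).trans (h.div_le hq)
    rw [integral_sub h.integrable_sq hi] at h1
    linarith

lemma IsCentered.measure_lt_norm_le (h : IsCentered n c σ) (hq : 1 ≤ q) :
    σ {x | q < ‖x‖} ≤ ENNReal.ofReal (c / q ^ n) := by
  have := h.prob
  have hmk := mul_meas_ge_le_integral_of_nonneg (μ := σ)
    (f := fun x => ‖x‖ ^ (n + 2) / q ^ n) (Eventually.of_forall fun _ => by positivity)
    (h.integrable_pow.div_const _) 1
  rw [one_mul] at hmk
  rw [ENNReal.le_ofReal_iff_toReal_le (measure_ne_top _ _)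
    ((norm_nonneg _).trans (h.norm_integral_clip_le hq))]
  refine le_trans (measureReal_mono (fun x hx => ?_)) (hmk.trans (h.div_le hq))
  have hx' : q < ‖x‖ := hx
  have h1 := one_le_norm_pow_div hq hx' n
  have hx1 : 1 ≤ ‖x‖ := hq.trans hx'.le
  show 1 ≤ ‖x‖ ^ (n + 2) / q ^ n
  rw [pow_add, mul_div_right_comm]
  exact one_le_mul_of_one_le_of_one_le h1 (one_le_pow₀ hx1)

lemma clip_div (hN : 0 < N) (x : ℂ) :
    clip (q / √(N : ℝ)) (x / (√(N : ℝ) : ℂ)) = clip q x / (√(N : ℝ) : ℂ) := by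
  have hs : 0 < √(N : ℝ) := Real.sqrt_pos.mpr (by exact_mod_cast hN)
  have e : ‖x / (√(N : ℝ) : ℂ)‖ = ‖x‖ / √(N : ℝ) := by
    rw [norm_div, Complex.norm_real, Real.norm_eq_abs, abs_of_pos hs]
  unfold clip
  rw [e]
  by_cases h : ‖x‖ ≤ q
  · rw [if_pos h, if_pos (by gcongr)]
  · rw [if_neg h, if_neg, zero_div]
    rw [div_le_div_iff_of_pos_right hs]; exact h

/-- The truncation of the rescaled law. -/
lemma IsCentered.map_div (h : IsCentered n c σ) (hq : 1 ≤ q) (hN : 0 < N) :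
    ‖∫ y, clip (q / √(N : ℝ)) y ∂(σ.map fun x : ℂ => x / (√(N : ℝ) : ℂ))‖ ≤ c / q ^ n ∧
    ∫ y, ‖clip (q / √(N : ℝ)) y‖ ^ 2 ∂(σ.map fun x : ℂ => x / (√(N : ℝ) : ℂ)) =
      (N : ℝ)⁻¹ * ∫ x, ‖clip q x‖ ^ 2 ∂σ ∧
    (σ.map fun x : ℂ => x / (√(N : ℝ) : ℂ)) {y | q / √(N : ℝ) < ‖y‖} ≤
      ENNReal.ofReal (c / q ^ n) := by
  have hN1 : (1 : ℝ) ≤ N := by exact_mod_cast hN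
  have hs : 1 ≤ √(N : ℝ) := Real.one_le_sqrt.mpr hN1
  have hs0 : 0 < √(N : ℝ) := by linarith
  have hm : Measurable fun x : ℂ => x / (√(N : ℝ) : ℂ) := by fun_prop
  have hn : ‖(√(N : ℝ) : ℂ)‖ = √(N : ℝ) := by
    rw [Complex.norm_real, Real.norm_eq_abs, abs_of_pos hs0]
  refine ⟨?_, ?_, ?_⟩
  · rw [integral_map hm.aemeasurable (measurable_clip _).aestronglyMeasurable]
    simp only [clip_div hN]
    rw [integral_div, norm_div, hn]
    exact (div_le_self (norm_nonneg _) hs).trans (h.norm_integral_clip_le hq)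
  · rw [integral_map hm.aemeasurable ((measurable_clip _).norm.pow_const 2).aestronglyMeasurable]
    simp only [clip_div hN, norm_div, hn, div_pow]
    rw [Real.sq_sqrt (by linarith), integral_div, inv_mul_eq_div]
  · rw [Measure.map_apply hm (measurableSet_lt measurable_const measurable_norm)]
    have e : (fun x : ℂ => x / (√(N : ℝ) : ℂ)) ⁻¹' {y | q / √(N : ℝ) < ‖y‖} =
        {x | q < ‖x‖} := by
      ext x
      simp only [Set.mem_preimage, Set.mem_ofPred_eq, norm_div, hn]
      exact div_lt_div_iff_of_pos_right hs0
    rw [e]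
    exact h.measure_lt_norm_le hq

end Clip

lemma wmat_entries {W : Matrix (Fin N) (Fin N) ℂ} (hW : W.IsHermitian) :
    wmat (fun p : Idx N => W p.1.1 p.1.2) = W := by
  ext i j
  simp only [wmat, Matrix.of_apply, idx]
  rcases lt_trichotomy i j with h | h | h
  · simp [h, min_eq_left h.le, max_eq_right h.le]
  · subst h
    simp only [lt_irrefl, if_false, min_self, max_self]
    have := hW.apply i i
    exact Complex.conj_eq_iff_re.mp this
  · simp only [h.not_gt, h, if_false, if_true, min_eq_right h.le, max_eq_left h.le]
    exact hW.apply i j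

/-- The entries of a Wigner matrix may be replaced by truncated independent ones, at the price of
a small probability. -/
lemma IsWigner.exists_truncation {Cp : ℕ → ℝ} {Ω : Type*} [MeasurableSpace Ω] {P : Measure Ω}
    [IsProbabilityMeasure P] {W : Ω → Matrix (Fin N) (Fin N) ℂ} (hW : IsWigner Cp P W)
    (hN : 0 < N) {q η : ℝ} (hq : 1 ≤ q) {n : ℕ} (hη : Cp (n + 2) / q ^ n ≤ η)
    (hηN : η ≤ ((N : ℝ) ^ 2)⁻¹) :
    ∃ (ν : Idx N → Measure ℂ) (_ : ∀ p, IsProbabilityMeasure (ν p)),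
      EntryBounds N (q / √(N : ℝ)) ν ∧ ∀ T : Set (Matrix (Fin N) (Fin N) ℂ),
        P {ω | W ω ∈ T} ≤ Measure.pi ν {x | tmat (q / √(N : ℝ)) x ∈ T} +
          (N ^ 2 : ℕ) * ENNReal.ofReal η := by
  obtain ⟨νd, νod, hlaw, hod, hd⟩ := hW.entries
  have hN1 : (1 : ℝ) ≤ N := by exact_mod_cast hN
  set X : Idx N → Ω → ℂ := fun p ω => W ω p.1.1 p.1.2 with hX
  have hcases : ∀ p : Idx N, HasLaw (X p) (νod.map fun x : ℂ => x / (√(N : ℝ) : ℂ)) P ∧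
      p.1.1 ≠ p.1.2 ∨ HasLaw (X p) ((νd.map ((↑) : ℝ → ℂ)).map
        fun x : ℂ => x / (√(N : ℝ) : ℂ)) P ∧ p.1.1 = p.1.2 := by
    intro p
    rcases p.2.lt_or_eq with h | h
    · exact Or.inl ⟨hod _ _ h, h.ne⟩
    · refine Or.inr ⟨?_, h⟩
      have e : ((νd.map ((↑) : ℝ → ℂ)).map fun x : ℂ => x / (√(N : ℝ) : ℂ)) =
          νd.map fun x : ℝ => (x : ℂ) / (√(N : ℝ) : ℂ) :=
        Measure.map_map (by fun_prop) Complex.measurable_ofReal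
      rw [e]
      have := hd p.1.1
      simp only [hX, ← h]
      exact this
  have hae : ∀ p, AEMeasurable (X p) P := fun p => by
    rcases hcases p with h | h <;> exact h.1.aemeasurable
  -- Every entry is a rescaled centered variable; the variance is known off the diagonal only.
  have hc : ∀ p, ∃ σ, IsCentered n (Cp (n + 2)) σ ∧
      P.map (X p) = σ.map (fun x : ℂ => x / (√(N : ℝ) : ℂ)) ∧
      (p.1.1 ≠ p.1.2 → ∫ x, ‖x‖ ^ 2 ∂σ = 1) := fun p => by
    rcases hcases p with h | h
    · exact ⟨νod, hlaw.isCentered_od n, h.1.map_eq, fun _ => hlaw.variance_od⟩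
    · exact ⟨_, hlaw.isCentered_d n, h.1.map_eq, fun h' => absurd h.2 h'⟩
  refine ⟨fun p => P.map (X p), fun p => Measure.isProbabilityMeasure_map (hae p), ?_, ?_⟩
  · have hNN : (N : ℝ)⁻¹ * ((N : ℝ) ^ 2)⁻¹ ≤ ((N : ℝ) ^ 2)⁻¹ :=
      mul_le_of_le_one_left (by positivity) (inv_le_one_of_one_le₀ hN1)
    have hNi : 0 ≤ (N : ℝ)⁻¹ := by positivity
    refine ⟨fun p => ?_, fun p hp => ?_, fun p hp => ?_⟩ <;> obtain ⟨σ, h1, h2, h3⟩ := hc p <;>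
      obtain ⟨a, b, -⟩ := h1.map_div (N := N) hq hN <;> rw [h2]
    · exact a.trans (hη.trans hηN)
    · rw [b]
      have := (h1.integral_clip_sq hq).1
      rw [h3 hp] at this
      exact mul_le_of_le_one_right hNi this
    · rw [b]
      have := (h1.integral_clip_sq hq).2
      rw [h3 hp] at this
      have h4 : (N : ℝ)⁻¹ * (1 - ((N : ℝ) ^ 2)⁻¹) ≤ (N : ℝ)⁻¹ * ∫ x, ‖clip q x‖ ^ 2 ∂σ := by
        gcongr; linarith
      linarith
  · intro T
    have hmeas : AEMeasurable (fun ω p => X p ω) P := aemeasurable_pi_lambda _ hae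
    have hmap : P.map (fun ω p => X p ω) = Measure.pi fun p => P.map (X p) :=
      (iIndepFun_iff_map_fun_eq_pi_map hae).mp hW.indep
    -- where no entry exceeds the cutoff, truncation does not change the matrix
    have hsub : {ω | W ω ∈ T} ⊆ (fun ω p => X p ω) ⁻¹' {x | tmat (q / √(N : ℝ)) x ∈ T} ∪
        ⋃ p ∈ (Finset.univ : Finset (Idx N)), {ω | q / √(N : ℝ) < ‖X p ω‖} := by
      intro ω hω
      by_contra hcon
      rw [Set.mem_union, not_or] at hcon
      obtain ⟨h1, h2⟩ := hcon
      simp only [Set.mem_iUnion, not_exists, Finset.mem_univ, Set.mem_ofPred_eq,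
        not_lt, forall_const] at h2
      refine h1 ?_
      show tmat (q / √(N : ℝ)) (fun p => X p ω) ∈ T
      have e : clipAll (q / √(N : ℝ)) (fun p => X p ω) = fun p => X p ω := by
        ext p
        simp only [clipAll, clip, if_pos (h2 p)]
      unfold tmat
      rw [e, hX, wmat_entries (hW.isHermitian ω)]
      exact hω
    refine (measure_mono hsub).trans ((measure_union_le _ _).trans (add_le_add ?_ ?_))
    · rw [← hmap]
      -- `T` is arbitrary; the inequality that is needed here holds for nonmeasurable sets as
      -- well
      exact Measure.le_map_apply hmeas _
    · refine (measure_biUnion_finset_le _ _).trans ?_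
      have hle : ∀ p ∈ (Finset.univ : Finset (Idx N)), P {ω | q / √(N : ℝ) < ‖X p ω‖} ≤
          ENNReal.ofReal η := by
        intro p _
        obtain ⟨σ, h1, h2, -⟩ := hc p
        obtain ⟨-, -, b⟩ := h1.map_div (N := N) hq hN
        rw [← h2, Measure.map_apply_of_aemeasurable (hae p)
          (measurableSet_lt measurable_const measurable_norm)] at b
        exact b.trans (ENNReal.ofReal_le_ofReal hη)
      refine (Finset.sum_le_card_nsmul _ _ _ hle).trans ?_
      rw [nsmul_eq_mul]
      gcongr
      have : Fintype.card (Idx N) ≤ Fintype.card (Fin N × Fin N) := Fintype.card_subtype_le _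
      simpa [sq] using this

end TwoResolvent
end

noncomputable section
namespace TwoResolvent
open scoped ComplexOrder Matrix Matrix.Norms.L2Operator

/-! ### Asymptotics of the parameters -/

section Asymptotics

variable {ε : ℝ}

lemma tendsto_natCast_rpow (hε : 0 < ε) : Tendsto (fun N : ℕ => (N : ℝ) ^ ε) atTop atTop :=
  (tendsto_rpow_atTop hε).comp tendsto_natCast_atTop_atTop

lemma rpow_pow_eq (N m : ℕ) : ((N : ℝ) ^ ε) ^ m = (N : ℝ) ^ (ε * m) := by
  rw [Real.rpow_mul (Nat.cast_nonneg N), Real.rpow_natCast]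

/-- Small powers of `N^ε` are dominated by `N`. -/
lemma rpow_pow_le {N : ℕ} (hN : 0 < N) {m : ℕ} {a : ℝ} (h : ε * m ≤ a) :
    ((N : ℝ) ^ ε) ^ m ≤ (N : ℝ) ^ a := by
  rw [rpow_pow_eq]
  exact Real.rpow_le_rpow_of_exponent_le (by exact_mod_cast hN) h

lemma eventually_const_le_rpow (hε : 0 < ε) (c : ℝ) : ∀ᶠ N : ℕ in atTop, c ≤ (N : ℝ) ^ ε :=
  (tendsto_natCast_rpow hε).eventually_ge_atTop c

/-- With a cutoff at `N^ε`, a high enough moment makes the truncation errors negligible. -/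
lemma eventually_truncation (hε : 0 < ε) {K : ℝ} (hK : 0 < K) (Cp : ℕ → ℝ) :
    ∃ n : ℕ, ∀ᶠ N : ℕ in atTop, Cp (n + 2) / ((N : ℝ) ^ ε) ^ n ≤ (N : ℝ) ^ (-(K + 4)) ∧
      (N : ℝ) ^ (-(K + 4)) ≤ ((N : ℝ) ^ 2)⁻¹ ∧
      (N ^ 2 : ℕ) * ENNReal.ofReal ((N : ℝ) ^ (-(K + 4))) ≤
        ENNReal.ofReal ((N : ℝ) ^ (-K) / 4) := by
  obtain ⟨n, hn⟩ := exists_nat_ge ((K + 5) / ε)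
  rw [div_le_iff₀ hε] at hn
  refine ⟨n, ?_⟩
  filter_upwards [eventually_ge_atTop 2, eventually_const_le_rpow one_pos (Cp (n + 2))] with N hN hC
  have hN0 : (0 : ℝ) < N := by exact_mod_cast (by omega : 0 < N)
  have hN1 : (1 : ℝ) ≤ N := by exact_mod_cast (by omega : 1 ≤ N)
  have hN2 : (2 : ℝ) ≤ N := by exact_mod_cast hN
  refine ⟨?_, ?_, ?_⟩
  · rw [rpow_pow_eq, div_le_iff₀ (by positivity), ← Real.rpow_add hN0]
    refine hC.trans (Real.rpow_le_rpow_of_exponent_le hN1 ?_)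
    linarith
  · rw [← Real.rpow_natCast, ← Real.rpow_neg hN0.le]
    refine Real.rpow_le_rpow_of_exponent_le hN1 ?_
    push_cast
    linarith
  · rw [← ENNReal.ofReal_natCast, ← ENNReal.ofReal_mul (by positivity)]
    refine ENNReal.ofReal_le_ofReal ?_
    have e : (N : ℝ) ^ (-(K + 4)) = (N : ℝ) ^ (-K) * ((N : ℝ) ^ 4)⁻¹ := by
      rw [← Real.rpow_natCast, ← Real.rpow_neg hN0.le, ← Real.rpow_add hN0]
      congr 1; push_cast; ring
    rw [e]
    push_cast
    have h1 : (N : ℝ) ^ 2 * ((N : ℝ) ^ (-K) * ((N : ℝ) ^ 4)⁻¹) =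
        (N : ℝ) ^ (-K) / (N : ℝ) ^ 2 := by field_simp
    rw [h1]
    gcongr
    nlinarith

/-- A high enough moment makes the concentration estimate strong enough for a union bound. -/
lemma eventually_concentration (hε : 0 < ε) (K : ℝ) :
    ∃ j : ℕ, ∀ᶠ N : ℕ in atTop, (N + 1 : ℕ) * (2 * ENNReal.ofReal (momentConst j *
      (115200 / ((N : ℝ) ^ ε) ^ 72) ^ (2 ^ j))) ≤ ENNReal.ofReal ((N : ℝ) ^ (-K) / 4) := by
  obtain ⟨j, hj⟩ := exists_nat_ge ((K + 3) / ε)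
  rw [div_le_iff₀ hε] at hj
  have hj2 : (j : ℝ) ≤ (2 ^ j : ℕ) := by exact_mod_cast Nat.lt_two_pow_self.le
  refine ⟨j, ?_⟩
  filter_upwards [eventually_ge_atTop 1, eventually_const_le_rpow one_pos (16 * momentConst j),
    eventually_const_le_rpow hε 115200] with N hN hC hq
  have hN0 : (0 : ℝ) < N := by exact_mod_cast (by omega : 0 < N)
  have hN1 : (1 : ℝ) ≤ N := by exact_mod_cast hN
  have hm := momentConst_nonneg j
  rw [Real.rpow_one] at hC
  set q := (N : ℝ) ^ ε with hqdef
  have hq0 : 0 < q := by linarith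
  have h1 : 115200 / q ^ 72 ≤ q⁻¹ := by
    rw [div_le_iff₀ (by positivity)]
    calc (115200 : ℝ) ≤ q := hq
      _ ≤ q ^ 71 := le_self_pow₀ (by linarith) (by norm_num)
      _ = q⁻¹ * q ^ 72 := by field_simp
  have h2 : (q⁻¹) ^ (2 ^ j) ≤ (N : ℝ) ^ (-(K + 3)) := by
    rw [inv_pow, Real.rpow_neg hN0.le]
    refine inv_anti₀ (by positivity) ?_
    rw [hqdef, rpow_pow_eq]
    refine Real.rpow_le_rpow_of_exponent_le hN1 (hj.trans ?_)
    rw [mul_comm]; gcongr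
  have e : (N : ℝ) ^ (-(K + 3)) = (N : ℝ) ^ (-K) * ((N : ℝ) ^ 3)⁻¹ := by
    rw [← Real.rpow_natCast, ← Real.rpow_neg hN0.le, ← Real.rpow_add hN0]
    congr 1; push_cast; ring
  have h3 : momentConst j * (115200 / q ^ 72) ^ (2 ^ j) ≤
      momentConst j * ((N : ℝ) ^ (-K) * ((N : ℝ) ^ 3)⁻¹) := by
    rw [← e]
    gcongr
    exact (pow_le_pow_left₀ (by positivity) h1 _).trans h2
  have e2 : (2 : ENNReal) = ENNReal.ofReal 2 := by simp
  rw [← ENNReal.ofReal_natCast, e2, ← ENNReal.ofReal_mul (by norm_num),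
    ← ENNReal.ofReal_mul (by positivity)]
  refine ENNReal.ofReal_le_ofReal ?_
  have hNN : ((N + 1 : ℕ) : ℝ) ≤ 2 * N := by push_cast; linarith
  calc ((N + 1 : ℕ) : ℝ) * (2 * (momentConst j * (115200 / q ^ 72) ^ (2 ^ j)))
      ≤ 2 * N * (2 * (momentConst j * ((N : ℝ) ^ (-K) * ((N : ℝ) ^ 3)⁻¹))) := by gcongr
    _ = (16 * momentConst j) * ((N : ℝ) ^ 2)⁻¹ * ((N : ℝ) ^ (-K) / 4) := by
      field_simp; ring
    _ ≤ 1 * ((N : ℝ) ^ (-K) / 4) := by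
      gcongr
      rw [← div_eq_mul_inv, div_le_one (by positivity)]
      nlinarith
    _ = _ := one_mul _

/-- The norm of the truncated matrix exceeds `2 + κ / 4` with very small probability. -/
lemma eventually_norm_tmat (hε : 0 < ε) (hε1 : ε ≤ 1 / 100) {K κ : ℝ} (hκ : 0 < κ) :
    ∀ᶠ N : ℕ in atTop, ∀ (ν : Idx N → Measure ℂ) [∀ p, IsProbabilityMeasure (ν p)],
      EntryBounds N ((N : ℝ) ^ ε / √(N : ℝ)) ν →
      Measure.pi ν {x | 2 + κ / 4 ≤ ‖tmat ((N : ℝ) ^ ε / √(N : ℝ)) x‖} ≤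
        ENNReal.ofReal ((N : ℝ) ^ (-K) / 4) := by
  set θ : ℝ := (2 + κ / 16) / (2 + κ / 8) with hθ
  have hθ0 : 0 < θ := by positivity
  have hθ1 : θ < 1 := by rw [hθ, div_lt_one (by positivity)]; linarith
  have hlog : 0 < -Real.log θ := by linarith [Real.log_neg hθ0 hθ1]
  have hlim := (tendsto_rpow_mul_exp_neg_mul_atTop_nhds_zero ((K + 1) / ε) _ hlog).comp
    (tendsto_natCast_rpow hε)
  filter_upwards [eventually_ge_atTop 1, eventually_const_le_rpow hε 2,
    eventually_const_le_rpow hε (576 / κ),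
    hlim.eventually_lt_const (by norm_num : (0 : ℝ) < 1 / 4)] with N hN hq2 hqκ hexp ν _ hν
  have hN0 : (0 : ℝ) < N := by exact_mod_cast (by omega : 0 < N)
  have hN1 : (1 : ℝ) ≤ N := by exact_mod_cast hN
  have hq8 : ((N : ℝ) ^ ε) ^ 8 ≤ N := by
    have := rpow_pow_le (ε := ε) (N := N) (by omega) (m := 8) (a := 1)
      (by push_cast; linarith)
    rwa [Real.rpow_one] at this
  simp only [Function.comp] at hexp
  have hexp' : (N : ℝ) * θ ^ ((N : ℝ) ^ ε) ≤ (N : ℝ) ^ (-K) / 4 := by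
    have e1 : ((N : ℝ) ^ ε) ^ ((K + 1) / ε) = (N : ℝ) ^ (K + 1) := by
      rw [← Real.rpow_mul hN0.le]; congr 1; field_simp
    have e2 : Real.exp (- -Real.log θ * (N : ℝ) ^ ε) = θ ^ ((N : ℝ) ^ ε) := by
      rw [neg_neg, Real.rpow_def_of_pos hθ0]
    rw [e1, e2] at hexp
    have e3 : (N : ℝ) * θ ^ ((N : ℝ) ^ ε) =
        (N : ℝ) ^ (-K) * ((N : ℝ) ^ (K + 1) * θ ^ ((N : ℝ) ^ ε)) := by
      rw [← mul_assoc, ← Real.rpow_add hN0]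
      congr 1
      rw [neg_add_cancel_left, Real.rpow_one]
    rw [e3, div_eq_mul_one_div]
    gcongr
  set q := (N : ℝ) ^ ε with hqdef
  have hq0 : 0 < q := by linarith
  have hs0 : 0 < √(N : ℝ) := Real.sqrt_pos.mpr hN0
  have hsq : q ^ 4 ≤ √(N : ℝ) := by
    refine Real.le_sqrt_of_sq_le ?_
    calc (q ^ 4) ^ 2 = q ^ 8 := by ring
      _ ≤ (N : ℝ) := hq8
  -- The trace of the power `2 ^ (s + 1)` is used, which lies between `N^ε` and `2 N^ε`: it is
  -- much larger than `log N`, and small enough for the corrections in the walk bound to vanish.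
  obtain ⟨s, hs1, hs2⟩ := exists_nat_pow_near (x := q) (y := 2) (by linarith) (by norm_num)
  set β := q / √(N : ℝ) with hβ
  have hβ0 : 0 ≤ β := by positivity
  have hβ1 : β * q ^ 3 ≤ 1 := by
    rw [hβ, div_mul_eq_mul_div, div_le_one hs0]
    calc q * q ^ 3 = q ^ 4 := by ring
      _ ≤ _ := hsq
  have hqκ' : 36 / q ≤ κ / 16 := by
    rw [div_le_iff₀ hq0]
    rw [div_le_iff₀ hκ] at hqκ
    linarith
  have hmain := measure_norm_tmat_ge_le (ν := ν) (by omega : 0 < N) hβ0 hν s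
    (ρ := 2 + κ / 8) (by positivity)
  set m : ℝ := ((2 ^ (s + 1) + 1 : ℕ) : ℝ) with hm
  have hm3 : m ≤ 3 * q := by
    rw [hm]; push_cast; rw [pow_succ]; linarith
  have hm0 : 0 ≤ m := by positivity
  have hb : m ^ 3 / N + m ^ 2 * β ≤ 36 / q := by
    have h1 : m ^ 3 / N ≤ 27 / q := by
      rw [div_le_div_iff₀ hN0 hq0]
      calc m ^ 3 * q ≤ (3 * q) ^ 3 * q := by gcongr
        _ = 27 * q ^ 4 := by ring
        _ ≤ 27 * q ^ 8 := by gcongr <;> linarith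
        _ ≤ 27 * N := by gcongr
    have h2 : m ^ 2 * β ≤ 9 / q := by
      rw [le_div_iff₀ hq0]
      calc m ^ 2 * β * q ≤ (3 * q) ^ 2 * β * q := by gcongr
        _ = 9 * (β * q ^ 3) := by ring
        _ ≤ 9 * 1 := by gcongr
        _ = 9 := by norm_num
    have : 36 / q = 27 / q + 9 / q := by ring
    linarith
  have hβκ : β ≤ κ / 8 := by
    have h1 : β ≤ 1 / q := by
      rw [le_div_iff₀ hq0]
      refine le_trans ?_ hβ1
      gcongr
      exact le_self_pow₀ (by linarith) (by norm_num)
    have h2 : 1 / q ≤ 36 / q := by gcongr; norm_num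
    linarith
  refine (measure_mono fun x hx => ?_).trans (hmain.trans (ENNReal.ofReal_le_ofReal ?_))
  · rw [Set.mem_ofPred_eq] at hx ⊢
    linarith
  · refine le_trans ?_ hexp'
    gcongr
    have h1 : (2 + m ^ 3 / N + m ^ 2 * β) / (2 + κ / 8) ≤ θ := by
      exact div_le_div_of_nonneg_right (by linarith) (by positivity)
    calc ((2 + m ^ 3 / N + m ^ 2 * β) / (2 + κ / 8)) ^ 2 ^ (s + 1) ≤ θ ^ 2 ^ (s + 1) := by
          gcongr
      _ = θ ^ ((2 ^ (s + 1) : ℕ) : ℝ) := (Real.rpow_natCast _ _).symm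
      _ ≤ θ ^ q := by
        refine Real.rpow_le_rpow_of_exponent_ge hθ0 hθ1.le ?_
        push_cast; exact hs2.le

/-- The error bound on the whole domain is below `N^ξ / N`. -/
lemma eventually_error (hε : 0 < ε) {ξ κ B : ℝ} (hξ : ε * 43 ≤ ξ) (hκ : 0 < κ) (hB : 0 ≤ B) :
    ∃ k : ℕ, ∀ᶠ N : ℕ in atTop,
      36 ^ k * (((N : ℝ) ^ ε) ^ 42 / N + 2 * Real.pi * B / N) +
        (12 * (2 / (N : ℝ) ^ ε) / (κ / 8)) ^ k * B ≤ (N : ℝ) ^ ξ * (1 / N) := by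
  -- with this choice, `N^(-ε k) ≤ N⁻¹`
  obtain ⟨k, hk⟩ := exists_nat_ge (1 / ε)
  rw [div_le_iff₀ hε] at hk
  refine ⟨k, ?_⟩
  filter_upwards [eventually_ge_atTop 1, eventually_const_le_rpow hε 1,
    eventually_const_le_rpow hε (36 ^ k * (1 + 2 * Real.pi * B) + (192 / κ) ^ k * B)]
    with N hN hq1 hC
  have hN0 : (0 : ℝ) < N := by exact_mod_cast (by omega : 0 < N)
  have hN1 : (1 : ℝ) ≤ N := by exact_mod_cast hN
  have hpi := Real.pi_pos
  have h43 : ((N : ℝ) ^ ε) ^ 43 ≤ (N : ℝ) ^ ξ := rpow_pow_le (by omega) (by push_cast; exact hξ)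
  have hNk : (N : ℝ) ≤ ((N : ℝ) ^ ε) ^ k := by
    rw [rpow_pow_eq]
    calc (N : ℝ) = (N : ℝ) ^ (1 : ℝ) := (Real.rpow_one _).symm
      _ ≤ _ := Real.rpow_le_rpow_of_exponent_le hN1 (by linarith)
  set q := (N : ℝ) ^ ε
  have hq0 : 0 < q := by linarith
  have e1 : (12 * (2 / q) / (κ / 8)) ^ k = (192 / κ) ^ k / q ^ k := by
    rw [← div_pow]; congr 1; field_simp; norm_num
  have hq42 : 1 ≤ q ^ 42 := one_le_pow₀ hq1
  rw [e1]
  calc 36 ^ k * (q ^ 42 / N + 2 * Real.pi * B / N) + (192 / κ) ^ k / q ^ k * B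
      ≤ 36 ^ k * (q ^ 42 / N + 2 * Real.pi * B * q ^ 42 / N) +
        (192 / κ) ^ k * q ^ 42 / N * B := by
        have h1 : 2 * Real.pi * B / N ≤ 2 * Real.pi * B * q ^ 42 / N :=
          div_le_div_of_nonneg_right (le_mul_of_one_le_right (by positivity) hq42) hN0.le
        have h2 : (192 / κ) ^ k / q ^ k ≤ (192 / κ) ^ k * q ^ 42 / N :=
          (div_le_div_of_nonneg_left (by positivity) hN0 hNk).trans
            (div_le_div_of_nonneg_right (le_mul_of_one_le_right (by positivity) hq42) hN0.le)
        exact add_le_add (mul_le_mul_of_nonneg_left (add_le_add le_rfl h1) (by positivity))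
          (mul_le_mul_of_nonneg_right h2 hB)
    _ = (36 ^ k * (1 + 2 * Real.pi * B) + (192 / κ) ^ k * B) * q ^ 42 / N := by ring
    _ ≤ q * q ^ 42 / N := by gcongr
    _ = q ^ 43 * (1 / N) := by ring
    _ ≤ _ := by gcongr

end Asymptotics

end TwoResolvent
end

noncomputable section
namespace TwoResolvent
open scoped ComplexOrder Matrix Matrix.Norms.L2Operator

/-! ### The global law -/

theorem existsUnique_isMDEValue {L δ : ℝ} (hL : 0 < L) (hδ : 0 < δ) {N : ℕ}
    {D : Matrix (Fin N) (Fin N) ℂ} {z : ℂ} (hD : D.IsHermitian) (hDL : opNorm D ≤ L)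
    (hz : δ ≤ spectralDist L z) : ∃! M : Matrix (Fin N) (Fin N) ℂ, IsMDEValue D z M := by
  -- `opNorm` is by definition the norm on matrices that is in scope here
  obtain ⟨w, -, hw⟩ := exists_isMDEValue hD (half_pos hδ) hDL (far_of_spectralDist hL hz)
  exact ⟨_, hw, fun M hM => hM.unique hD hw⟩

section

variable {L δ : ℝ} {N : ℕ}

lemma Params.far₁ (hL : 0 < L) (u : Params L δ N) : Far L (δ / 2) u.z₁ :=
  far_of_spectralDist hL u.dist₁

lemma Params.far₂ (hL : 0 < L) (u : Params L δ N) : Far L (δ / 2) u.z₂ :=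
  far_of_spectralDist hL u.dist₂

theorem Params.one_sub_ntr_ne_zero (hL : 0 < L) (hδ : 0 < δ) (u : Params L δ N) :
    1 - ntr (mdeM u.D₁ u.z₁ * mdeM u.D₂ u.z₂) ≠ 0 := by
  have hκ := half_pos hδ
  obtain ⟨b₁, e₁⟩ := mdeM_bounds u.herm₁ hκ u.norm₁ (u.far₁ hL)
  obtain ⟨b₂, e₂⟩ := mdeM_bounds u.herm₂ hκ u.norm₂ (u.far₂ hL)
  rw [e₁, e₂, ← norm_pos_iff]
  exact lt_of_lt_of_le (by positivity) (b₁.norm_one_sub hκ b₂)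

end

section

variable {Ω : ℕ → Type*} [∀ N, MeasurableSpace (Ω N)] {P : ∀ N, Measure (Ω N)}
  [∀ N, IsProbabilityMeasure (P N)]
  {W : ∀ N, Ω N → Matrix (Fin N) (Fin N) ℂ} {Cp : ℕ → ℝ}

/-- An event for a Wigner matrix is compared with the same event for matrices with bounded
entries, up to a probability that is smaller than any power of `N`. -/
lemma eventually_exists_truncation {ε K : ℝ} (hε : 0 < ε) (hK : 0 < K)
    (hW : ∀ N, IsWigner Cp (P N) (W N)) :
    ∀ᶠ N : ℕ in atTop, ∃ (ν : Idx N → Measure ℂ) (_ : ∀ p, IsProbabilityMeasure (ν p)),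
      EntryBounds N ((N : ℝ) ^ ε / √(N : ℝ)) ν ∧
      ∀ T : Set (Matrix (Fin N) (Fin N) ℂ), P N {ω | W N ω ∈ T} ≤
        Measure.pi ν {x | tmat ((N : ℝ) ^ ε / √(N : ℝ)) x ∈ T} +
          ENNReal.ofReal ((N : ℝ) ^ (-K) / 4) := by
  obtain ⟨n, hn⟩ := eventually_truncation hε hK Cp
  filter_upwards [hn, eventually_ge_atTop 1, eventually_const_le_rpow hε 1]
    with N ⟨h1, h2, h3⟩ hN hq
  obtain ⟨ν, hν, hb, hT⟩ := (hW N).exists_truncation hN hq h1 h2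
  exact ⟨ν, hν, hb, fun T => (hT T).trans (by gcongr)⟩

theorem wvhp_isUnit {L δ : ℝ} (hL : 0 < L) (hδ : 0 < δ) (hW : ∀ N, IsWigner Cp (P N) (W N)) :
    WVHP P (fun N (u : Params L δ N) =>
      {ω | IsUnit (u.D₁ + W N ω - u.z₁ • (1 : Matrix (Fin N) (Fin N) ℂ)) ∧
        IsUnit (u.D₂ + W N ω - u.z₂ • (1 : Matrix (Fin N) (Fin N) ℂ))}) := by
  intro K hK
  have hκ := half_pos hδ
  rw [← eventually_atTop]
  filter_upwards [eventually_exists_truncation (by norm_num : (0 : ℝ) < 1 / 100) hK hW,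
    eventually_norm_tmat (K := K) (by norm_num : (0 : ℝ) < 1 / 100) le_rfl hκ]
    with N ⟨ν, hν, hb, hT⟩ hnorm
  have hN0 : (0 : ℝ) ≤ (N : ℝ) ^ (-K) := by positivity
  refine iSup_le fun u => (hT {H | ¬(IsUnit (u.D₁ + H - u.z₁ • 1) ∧
    IsUnit (u.D₂ + H - u.z₂ • 1))}).trans ?_
  -- both matrices are invertible where the norm of the random matrix is below `2 + δ / 8`
  have hsub : {x | tmat ((N : ℝ) ^ (1 / 100 : ℝ) / √(N : ℝ)) x ∈
      {H | ¬(IsUnit (u.D₁ + H - u.z₁ • 1) ∧ IsUnit (u.D₂ + H - u.z₂ • 1))}} ⊆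
      {x | 2 + δ / 2 / 4 ≤ ‖tmat ((N : ℝ) ^ (1 / 100 : ℝ) / √(N : ℝ)) x‖} := by
    intro x hx
    by_contra hc
    rw [Set.mem_ofPred_eq, not_le] at hc
    exact hx ⟨(resolvent_far u.herm₁ (tmat_isHermitian _ x) hκ u.norm₁ hc.le
        ((u.far₁ hL).mono (by linarith))).1,
      (resolvent_far u.herm₂ (tmat_isHermitian _ x) hκ u.norm₂ hc.le
        ((u.far₂ hL).mono (by linarith))).1⟩
  refine (add_le_add_left ((measure_mono hsub).trans (hnorm ν hb)) _).trans ?_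
  rw [← ENNReal.ofReal_add (by positivity) (by positivity)]
  exact ENNReal.ofReal_le_ofReal (by linarith)

theorem stochDom_two_resolvent {L δ : ℝ} (hL : 0 < L) (hδ : 0 < δ)
    (hW : ∀ N, IsWigner Cp (P N) (W N)) :
    StochDom P
      (fun N (u : Params L δ N) ω =>
        ‖ntr (resolvent (u.D₁ + W N ω) u.z₁ * resolvent (u.D₂ + W N ω) u.z₂) -
          ntr (twoResolventM (mdeM u.D₁ u.z₁) (mdeM u.D₂ u.z₂))‖)
      (fun N _ _ => 1 / (N : ℝ)) := by
  intro ξ hξ K hK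
  -- The cutoff is `Λ = N^ε`; the error bound loses `Λ^43`, which is at most `N^ξ`.
  set κ := δ / 2 with hκdef
  have hκ : 0 < κ := half_pos hδ
  set ε : ℝ := min ξ 1 / 100 with hεdef
  have hmin : 0 < min ξ 1 := lt_min hξ one_pos
  have hε : 0 < ε := by positivity
  have hε1 : ε ≤ 1 / 100 := by
    rw [hεdef]; exact div_le_div_of_nonneg_right (min_le_right _ _) (by norm_num)
  have hεξ : ε * 43 ≤ ξ := by
    have := min_le_left ξ 1
    rw [hεdef]; linarith
  set B : ℝ := 4 / κ ^ 2 + 2 / κ + 2 with hB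
  have hB0 : 0 ≤ B := by positivity
  obtain ⟨j, hj⟩ := eventually_concentration hε K
  obtain ⟨k, hk⟩ := eventually_error hε hεξ hκ hB0
  rw [← eventually_atTop]
  filter_upwards [eventually_exists_truncation hε hK hW,
    eventually_norm_tmat (K := K) hε hε1 hκ, hj, hk, eventually_ge_atTop 1,
    eventually_const_le_rpow hε 40000, eventually_const_le_rpow hε (16 / κ),
    eventually_const_le_rpow hε (Real.pi * κ / 4)]
    with N ⟨ν, hν, hb, hT⟩ hnorm hj hk hN hq1 hq2 hq3
  have hN0 : (0 : ℝ) < N := by exact_mod_cast (by omega : 0 < N)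
  have hq34 : ((N : ℝ) ^ ε) ^ 34 ≤ N := by
    have := rpow_pow_le (ε := ε) (N := N) (by omega) (m := 34) (a := 1) (by push_cast; linarith)
    rwa [Real.rpow_one] at this
  set q := (N : ℝ) ^ ε with hqdef
  have hq0 : 0 < q := by linarith
  have hq_one : 1 ≤ q := by linarith
  have hNβ : N * (q / √(N : ℝ)) ^ 2 ≤ q ^ 2 := by
    rw [div_pow, Real.sq_sqrt hN0.le]
    exact le_of_eq (by field_simp)
  have hqκ : 2 / q ≤ κ / 8 := by
    rw [div_le_iff₀ hκ] at hq2
    rw [div_le_iff₀ hq0]; linarith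
  have hbig : 40000 * q ^ 33 ≤ N := by
    calc 40000 * q ^ 33 ≤ q * q ^ 33 := by gcongr
      _ = q ^ 34 := by ring
      _ ≤ N := hq34
  have hqN : 2 * Real.pi * (κ / 8) / N ≤ 2 / q / 2 := by
    have h1 : q * q ≤ N := by
      calc q * q = q ^ 2 := by ring
        _ ≤ q ^ 34 := pow_le_pow_right₀ hq_one (by norm_num)
        _ ≤ N := hq34
    have e : 2 / q / 2 = 1 / q := by field_simp
    rw [e, div_le_div_iff₀ hN0 hq0]
    calc 2 * Real.pi * (κ / 8) * q = Real.pi * κ / 4 * q := by ring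
      _ ≤ q * q := by gcongr
      _ ≤ 1 * N := by linarith
  have hNK : (0 : ℝ) ≤ (N : ℝ) ^ (-K) := by positivity
  refine iSup_le fun u => ?_
  have hmain := measure_lawDiff_zero_le u.herm₁ u.herm₂ hκ u.norm₁ u.norm₂ (u.far₁ hL)
    (u.far₂ hL) (by linarith : 10000 ≤ q) hqκ hqN (by omega) (by positivity) hNβ hb hbig j k
  have hset : {ω | (N : ℝ) ^ ξ * (1 / (N : ℝ)) <
      ‖ntr (resolvent (u.D₁ + W N ω) u.z₁ * resolvent (u.D₂ + W N ω) u.z₂) -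
        ntr (twoResolventM (mdeM u.D₁ u.z₁) (mdeM u.D₂ u.z₂))‖} =
      {ω | W N ω ∈ {H | (N : ℝ) ^ ξ * (1 / (N : ℝ)) < ‖lawDiff u.D₁ u.D₂ u.z₁ u.z₂ H 0‖}} := by
    simp only [lawDiff, add_zero, Set.mem_ofPred_eq]
  rw [hset]
  refine (hT _).trans ?_
  refine (add_le_add_left (((measure_mono fun x hx => lt_of_le_of_lt hk hx).trans hmain).trans
    (add_le_add (hnorm ν hb) hj)) _).trans ?_
  rw [← ENNReal.ofReal_add (by positivity) (by positivity),
    ← ENNReal.ofReal_add (by positivity) (by positivity)]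
  exact ENNReal.ofReal_le_ofReal (by linarith)

end

end TwoResolvent
end

theorem mainTheorem3 (L : ℝ) (hL : 0 < L) (δ : ℝ) (hδ : 0 < δ) (Cp : ℕ → ℝ) :
    -- the solution of the Matrix Dyson equation exists and is unique
    (∀ (N : ℕ) (D : Matrix (Fin N) (Fin N) ℂ) (z : ℂ), D.IsHermitian →
      TwoResolvent.opNorm D ≤ L → δ ≤ TwoResolvent.spectralDist L z →
      ∃! M : Matrix (Fin N) (Fin N) ℂ, TwoResolvent.IsMDEValue D z M) ∧
    -- the deterministic approximation is well defined
    (∀ (N : ℕ) (u : TwoResolvent.Params L δ N),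
      1 - TwoResolvent.ntr
        (TwoResolvent.mdeM u.D₁ u.z₁ * TwoResolvent.mdeM u.D₂ u.z₂) ≠ 0) ∧
    -- the global law, with a constant that depends only on `δ`, `L` and the moment bounds
    ∃ C : ℝ, 0 < C ∧
      ∀ (Ω : ℕ → Type*) [∀ N, MeasurableSpace (Ω N)] (P : ∀ N, Measure (Ω N))
        [∀ N, IsProbabilityMeasure (P N)] (W : ∀ N, Ω N → Matrix (Fin N) (Fin N) ℂ),
        (∀ N, TwoResolvent.IsWigner Cp (P N) (W N)) →
        TwoResolvent.WVHP P (fun N (u : TwoResolvent.Params L δ N) =>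
          {ω | IsUnit (u.D₁ + W N ω - u.z₁ • (1 : Matrix (Fin N) (Fin N) ℂ)) ∧
            IsUnit (u.D₂ + W N ω - u.z₂ • (1 : Matrix (Fin N) (Fin N) ℂ))}) ∧
        TwoResolvent.StochDom P
          (fun N (u : TwoResolvent.Params L δ N) ω =>
            ‖TwoResolvent.ntr
                (TwoResolvent.resolvent (u.D₁ + W N ω) u.z₁ *
                  TwoResolvent.resolvent (u.D₂ + W N ω) u.z₂) -
              TwoResolvent.ntr
                (TwoResolvent.twoResolventM (TwoResolvent.mdeM u.D₁ u.z₁)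
                  (TwoResolvent.mdeM u.D₂ u.z₂))‖)
          (fun N _ _ => C / (N : ℝ)) := by
  refine ⟨fun N D z hD hDL hz => TwoResolvent.existsUnique_isMDEValue hL hδ hD hDL hz,
    fun N u => u.one_sub_ntr_ne_zero hL hδ, 1, one_pos, fun Ω _ P _ W hW => ?_⟩
  exact ⟨TwoResolvent.wvhp_isUnit hL hδ hW, TwoResolvent.stochDom_two_resolvent hL hδ hW⟩
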